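/- Let $R$ be a commutative local ring with maximal ideal $\mathfrak{m}_R$ and group of units $R^\times$. For a group $G$ write $H_2(G)=H_2(G,\mathbb{Z})$, and for commuting $g,h\in G$ let $\mathbf{c}(g,h)\in H_2(G)$ be the class of the bar cycle $[g|h]-[h|g]$. Let \[ (R^\times\otimes R^\times)_\sigma:=(R^\times\otimes_{\mathbb{Z}}R^\times)/\langle c\otimes d+d\otimes c : c,d\in R^\times\rangle . \] Let $H_2(R)$ be the second homology of the additive group of $R$, and let $H_2(R)_{R^\times}$ be its group of coinvariants under the action of $R^\times$ induced by multiplication $a.r=ar$ on $R$. Let $K$ be the subgroup of $(R^\times\otimes R^\times)_\sigma\oplus H_2(R)_{R^\times}$ generated by the elements $\bigl(a\otimes(1-a),\,2\,\mathbf{c}(a,1-a)\bigr)$ for all $a\in R$ with $a,1-a\in R^\times$, where $\mathbf{c}(a,1-a)$ also denotes the image of this class in $H_2(R)_{R^\times}$. (i) If $R/\mathfrak{m}_R$ has at least three elements, then there is an isomorphism of abelian groups \[ H_2(\mathrm{GL}_2(R))\simeq H_2(\mathrm{GL}_1(R))\oplus\Bigl((R^\times\otimes R^\times)_\sigma\oplus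 H_2(R)_{R^\times}\Bigr)/K . \] (ii) If $R/\mathfrak{m}_R$ has at least four elements, then there is an isomorphism of abelian groups \[ H_2(\mathrm{SL}_2(R))_{R^\times}\simeq\Bigl((R^\times\otimes R^\times)_\sigma\oplus H_2(R)_{R^\times}\Bigr)/K , \] where the left side is the group of coinvariants for the action of $a\in R^\times$ on $H_2(\mathrm{SL}_2(R))$ induced by conjugation by $\mathrm{diag}(a,1)$. -/

import Mathlib

open scoped TensorProduct

universe u

noncomputable section

namespace BlochWigner

/-- The trivial `G`-module `ℤ` (lifted to the universe of `G`). -/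
abbrev trivZ (G : Type u) [Group G] : Rep.{u} (ULift.{u} ℤ) G :=
  Rep.trivial (ULift.{u} ℤ) G (ULift.{u} ℤ)

/-- The second homology group `H₂(G) = H₂(G, ℤ)` of a group with integral coefficients. -/
abbrev H2Z (G : Type u) [Group G] : Type u := groupHomology.H2 (trivZ G)

/-- The map `H₂(G) → H₂(H)` induced by a group homomorphism. -/
def H2Z.map {G H : Type u} [Group G] [Group H] (f : G →* H) :
    H2Z G →ₗ[ULift.{u} ℤ] H2Z H :=
  (groupHomology.map (A := trivZ G) (B := trivZ H) f
    (Rep.ofHom ⟨LinearMap.id, fun _ => rfl⟩) 2).hom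

theorem H2Z.map_id {G : Type u} [Group G] :
    H2Z.map (MonoidHom.id G) = LinearMap.id := by
  have h := groupHomology.map_id (A := trivZ G) 2
  exact congrArg ModuleCat.Hom.hom h

theorem H2Z.map_comp {G H K : Type u} [Group G] [Group H] [Group K]
    (f : G →* H) (g : H →* K) :
    H2Z.map (g.comp f) = H2Z.map g ∘ₗ H2Z.map f := by
  have h := groupHomology.map_comp (A := trivZ G) (B := trivZ H) (C := trivZ K) f g
    (Rep.ofHom ⟨LinearMap.id, fun _ => rfl⟩) (Rep.ofHom ⟨LinearMap.id, fun _ => rfl⟩) 2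
  exact congrArg ModuleCat.Hom.hom h

/-- An action of a group `M` on `G` by automorphisms induces an action of `M` on `H₂(G)`. -/
def H2Z.rep {M G : Type u} [Group M] [Group G] (φ : M →* MulAut G) :
    Representation (ULift.{u} ℤ) M (H2Z G) where
  toFun m := H2Z.map (φ m).toMonoidHom
  map_one' := by rw [_root_.map_one]; exact H2Z.map_id
  map_mul' m n := by
    rw [_root_.map_mul]; exact H2Z.map_comp (φ n).toMonoidHom (φ m).toMonoidHom

/-- The bar chain `[g|h] - [h|g]`. -/
def cChain {G : Type u} [Group G] (g h : G) : G × G →₀ ULift.{u} ℤ :=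
  Finsupp.single (g, h) 1 - Finsupp.single (h, g) 1

theorem cChain_mem {G : Type u} [Group G] {g h : G} (hgh : Commute g h) :
    cChain g h ∈ groupHomology.cycles₂ (trivZ G) := by
  change (groupHomology.d₂₁ (trivZ G)).hom (cChain g h) = 0
  have e : h * g = g * h := hgh.eq.symm
  erw [cChain, map_sub, groupHomology.d₂₁_single, groupHomology.d₂₁_single]
  simp [e]
  abel

/-- For commuting elements `g, h` of `G`, the class `c(g, h) ∈ H₂(G)` of `[g|h] - [h|g]`. -/
def cClass {G : Type u} [Group G] (g h : G) (hgh : Commute g h) : H2Z G :=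
  groupHomology.H2π (trivZ G) ⟨cChain g h, cChain_mem hgh⟩

section Ring

variable (R : Type u) [CommRing R]

/-- The units of `R` act on the additive group of `R` by multiplication, `a.r = ar`. -/
def unitsActAdd : Rˣ →* MulAut (Multiplicative R) where
  toFun a := AddEquiv.toMultiplicative (DistribMulAction.toAddEquiv R a)
  map_one' := by ext x; exact congrArg Multiplicative.ofAdd (one_smul Rˣ x.toAdd)
  map_mul' a b := by ext x; exact congrArg Multiplicative.ofAdd (mul_smul a b x.toAdd)

/-- `H₂(R)_{R^×}`: coinvariants of the second homology of the additive group of `R`. -/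
abbrev H2AddCoinv : Type u := (H2Z.rep (unitsActAdd R)).Coinvariants

/-- The image of `c(x, y) ∈ H₂(R)` in `H₂(R)_{R^×}`. -/
def cAdd (x y : R) : H2AddCoinv R :=
  Representation.Coinvariants.mk _
    (cClass (Multiplicative.ofAdd x) (Multiplicative.ofAdd y) (Commute.all _ _))

/-- The diagonal matrix `diag(a, 1)`. -/
def diagOne (a : Rˣ) : Matrix (Fin 2) (Fin 2) R := !![(a : R), 0; 0, 1]

theorem diagOne_mul (a b : Rˣ) : diagOne R (a * b) = diagOne R a * diagOne R b := by
  simp [diagOne]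

theorem diagOne_one : diagOne R 1 = 1 := by
  simp [diagOne, Matrix.one_fin_two]

theorem diagOne_inv_mul (a : Rˣ) : diagOne R a⁻¹ * diagOne R a = 1 := by
  rw [← diagOne_mul, inv_mul_cancel, diagOne_one]

theorem det_diagOne (a : Rˣ) : (diagOne R a).det = a := by
  simp [diagOne, Matrix.det_fin_two]

/-- Conjugation `A ↦ diag(a, 1) A diag(a, 1)⁻¹` on `SL₂(R)`. -/
def conjSL (a : Rˣ) :
    Matrix.SpecialLinearGroup (Fin 2) R →* Matrix.SpecialLinearGroup (Fin 2) R where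
  toFun A := ⟨diagOne R a * A.1 * diagOne R a⁻¹, by
    simp [Matrix.det_mul, det_diagOne]⟩
  map_one' := by
    apply Subtype.ext
    simp only [Matrix.SpecialLinearGroup.coe_one, mul_one]
    rw [← diagOne_mul, mul_inv_cancel, diagOne_one]
  map_mul' A B := by
    apply Subtype.ext
    change diagOne R a * (A.1 * B.1) * diagOne R a⁻¹
      = diagOne R a * A.1 * diagOne R a⁻¹ * (diagOne R a * B.1 * diagOne R a⁻¹)
    calc diagOne R a * (A.1 * B.1) * diagOne R a⁻¹
        = diagOne R a * A.1 * 1 * B.1 * diagOne R a⁻¹ := by simp only [mul_one, mul_assoc]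
      _ = _ := by rw [← diagOne_inv_mul R a]; simp only [mul_assoc]

theorem conjSL_mul (a b : Rˣ) : conjSL R (a * b) = (conjSL R a).comp (conjSL R b) := by
  ext1 A
  apply Subtype.ext
  change diagOne R (a * b) * A.1 * diagOne R (a * b)⁻¹
    = diagOne R a * (diagOne R b * A.1 * diagOne R b⁻¹) * diagOne R a⁻¹
  rw [mul_inv_rev, diagOne_mul, diagOne_mul]
  simp only [mul_assoc]

theorem conjSL_one : conjSL R 1 = MonoidHom.id _ := by
  ext1 A
  apply Subtype.ext
  change diagOne R 1 * A.1 * diagOne R 1⁻¹ = A.1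
  rw [inv_one, diagOne_one, one_mul, mul_one]

/-- The action of `R^×` on `SL₂(R)` through conjugation in `GL₂(R)` by the section
`a ↦ diag(a, 1)` of the determinant. -/
def unitsActSL : Rˣ →* MulAut (Matrix.SpecialLinearGroup (Fin 2) R) where
  toFun a := MonoidHom.toMulEquiv (conjSL R a) (conjSL R a⁻¹)
    (by rw [← conjSL_mul, inv_mul_cancel, conjSL_one])
    (by rw [← conjSL_mul, mul_inv_cancel, conjSL_one])
  map_one' := by
    apply MulEquiv.toMonoidHom_injective
    exact conjSL_one R
  map_mul' a b := by
    apply MulEquiv.toMonoidHom_injective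
    exact conjSL_mul R a b

/-- `H₂(SL₂(R))_{R^×}`. -/
abbrev H2SLCoinv : Type u := (H2Z.rep (unitsActSL R)).Coinvariants

/-- The subgroup of `R^× ⊗ R^×` generated by all `c ⊗ d + d ⊗ c`. -/
def symmRel : AddSubgroup (Additive Rˣ ⊗[ℤ] Additive Rˣ) :=
  AddSubgroup.closure
    {t | ∃ c d : Rˣ, t = Additive.ofMul c ⊗ₜ[ℤ] Additive.ofMul d
      + Additive.ofMul d ⊗ₜ[ℤ] Additive.ofMul c}

/-- `(R^× ⊗ R^×)_σ`. -/
abbrev TensorSigma : Type u := (Additive Rˣ ⊗[ℤ] Additive Rˣ) ⧸ symmRel R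

/-- The class of `a ⊗ b` in `(R^× ⊗ R^×)_σ`. -/
def tensorSigma (a b : Rˣ) : TensorSigma R :=
  QuotientAddGroup.mk (Additive.ofMul a ⊗ₜ[ℤ] Additive.ofMul b)

/-- The subgroup `K` of `(R^× ⊗ R^×)_σ ⊕ H₂(R)_{R^×}` generated by the elements
`(a ⊗ (1 - a), 2 c(a, 1 - a))` with `a, 1 - a ∈ R^×` (below, `b = 1 - a`). -/
def subgroupK : AddSubgroup (TensorSigma R × H2AddCoinv R) :=
  AddSubgroup.closure
    {t | ∃ a b : Rˣ, (b : R) = 1 - (a : R) ∧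
      t = (tensorSigma R a b, 2 • cAdd R (a : R) (b : R))}

/-- `((R^× ⊗ R^×)_σ ⊕ H₂(R)_{R^×}) / K`. -/
abbrev QuotK : Type u := (TensorSigma R × H2AddCoinv R) ⧸ subgroupK R

end Ring

end BlochWigner

end

/-! The argument is dual. For an injective abelian group `D`, the group `Hom(H₂(G), D)` is `H²(G,
D)` (`exists_cocycle_ev_eq`, `exists_eq_coboundary`). Since every abelian group embeds in an
injective one, injectivity and surjectivity of maps into `H₂(GL₂(R))` become extension and vanishing
statements for 2-cocycles.

`GL₂(R)` acts on the projective line, with upper triangular stabilizers. Call a tuple of points in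
general position when the residue classes are distinct. A residue field with at least three elements
gives four such points, so the complexes of functions on these tuples are exact in low degrees
(`exists_primitive₁`, `exists_primitive₂`), and the action on triples is transitive. Hence a cocycle
on upper triangular matrices extends to `GL₂(R)` once its pullbacks to pairs agree coherently on
triples and an obstruction on quadruples vanishes (`exists_descent`, `boundary_eq_zero`).

Let `t` and `t - 1` be units. The central element `(t, 1)` of the torus kills the mixed terms of the
Borel cohomology, so a class is determined by its restrictions to the torus and to the unipotent
radical. Modulo classes pulled back along the determinant, the relevant ones are an antisymmetric
pairing `B` on units and an `R^×`-invariant class `f` on `R`. Explicit trivializations give the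
obstruction `B a b - 2 (f a b - f b a)`, where `a` is the cross-ratio and `b = 1 - a`
(`boundary_pairing`, `boundary_unip`). Up to the sign of `f`, its vanishing says that `(B, f)` kills
`K`. So `QuotK R` is the kernel of `det` on `H₂(GL₂(R))` (`exists_quotK_hom`), and `a ↦ diag(a, 1)`
splits off `H₂(GL₁(R))`.

For (ii), `GL₂(R) = SL₂(R) ⋊ R^×`. With at least four residue elements some `t ^ 2 - 1` is a unit
and `SL₂(R)` is perfect, so the coinvariants of `H₂(SL₂(R))` are the same kernel
(`exists_H2SLCoinv_hom`). -/

noncomputable section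

set_option linter.unusedSectionVars false

namespace BlochWigner

/-! ### Second homology tested by 2-cocycles with injective coefficients. -/

section Cocycles

/-- The cocycle condition for `D`-valued functions on `G × G` (trivial action on `D`). -/
def IsCocycle {G D : Type*} [Group G] [AddCommGroup D] (f : G → G → D) : Prop :=
  ∀ g h k, f g h + f (g * h) k = f h k + f g (h * k)

/-- The coboundary of `w : G → D`. -/
def coboundary {G D : Type*} [Group G] [AddCommGroup D] (w : G → D) (g h : G) : D :=
  w g + w h - w (g * h)

/-- Characters with values in ℚ/ℤ separate the points of `A`, and a product of divisible groups is
divisible, hence injective. -/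
theorem exists_injective_hull (A : Type u) [AddCommGroup A] :
    ∃ (D : Type u) (_ : AddCommGroup D) (_ : Module.Baer ℤ D) (ι : A →+ D),
      Function.Injective ι := by
  refine ⟨CharacterModule A → ULift.{u} (AddCircle (1 : ℚ)), inferInstance,
    Module.Baer.of_divisible _, ⟨⟨fun a i ↦ ULift.up (i a), by ext; simp⟩, fun a b => by
      ext; simp⟩, ?_⟩
  exact (injective_iff_map_eq_zero _).mpr
    fun _ h0 ↦ CharacterModule.eq_zero_of_character_apply (congr_arg ULift.down <| congr_fun h0 ·)

variable {G H D : Type u} [Group G] [Group H] [AddCommGroup D]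

/-- The evaluation of `f : G × G → D` on 2-chains. -/
def evChain (f : G → G → D) : (G × G →₀ ULift.{u} ℤ) →+ D :=
  Finsupp.liftAddHom fun p => (zmultiplesHom D (f p.1 p.2)).comp AddEquiv.ulift.toAddMonoidHom

@[simp]
theorem evChain_single (f : G → G → D) (p : G × G) (n : ULift.{u} ℤ) :
    evChain f (Finsupp.single p n) = n.down • f p.1 p.2 := by
  simp only [evChain, Finsupp.liftAddHom_apply_single]
  rfl

theorem evChain_d₃₂ {f : G → G → D} (hf : IsCocycle f) (x : G × G × G →₀ ULift.{u} ℤ) :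
    evChain f ((groupHomology.d₃₂ (trivZ G)).hom x) = 0 := by
  induction x using Finsupp.induction_linear with
  | zero => simp
  | add x y hx hy =>
    have : (groupHomology.d₃₂ (trivZ G)).hom (x + y) = (groupHomology.d₃₂ (trivZ G)).hom x +
      (groupHomology.d₃₂ (trivZ G)).hom y := map_add _ _ _
    rw [this, map_add, hx, hy, add_zero]
  | single p n =>
    obtain ⟨g, h, k⟩ := p
    have : (groupHomology.d₃₂ (trivZ G)).hom (Finsupp.single (g, h, k) n) =
        Finsupp.single (h, k) n - Finsupp.single (g * h, k) n
          + Finsupp.single (g, h * k) n - Finsupp.single (g, h) n :=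
      groupHomology.d₃₂_single (A := trivZ G) (g, h, k) n
    rw [this]
    simp only [map_add, map_sub, evChain_single]
    rw [← smul_sub, ← smul_add, ← smul_sub]
    have h := hf g h k
    rw [show f _ _ - f _ _ + f _ _ - f _ _ = (0 : D) by
      rw [sub_add_eq_add_sub, ← h]; abel, smul_zero]

theorem ker_H2π_le {f : G → G → D} (hf : IsCocycle f) :
    AddMonoidHom.ker (groupHomology.H2π (trivZ G)).hom.toAddMonoidHom ≤
      ((evChain f).comp (groupHomology.cycles₂ (trivZ G)).subtype.toAddMonoidHom).ker := by
  intro x hx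
  obtain ⟨y, hy⟩ := (groupHomology.H2π_eq_zero_iff x).1 hx
  change evChain f x.1 = 0
  rw [← hy]
  exact evChain_d₃₂ hf y

/-- The homomorphism `H₂(G) → D` given by a cocycle. -/
def ev (f : G → G → D) (hf : IsCocycle f) : H2Z G →+ D :=
  ((QuotientAddGroup.lift (AddMonoidHom.ker (groupHomology.H2π (trivZ G)).hom.toAddMonoidHom)
    ((evChain f).comp (groupHomology.cycles₂ (trivZ G)).subtype.toAddMonoidHom)
    (ker_H2π_le hf)).comp
    (QuotientAddGroup.quotientKerEquivOfSurjective _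
      ((ModuleCat.epi_iff_surjective _).1 (inferInstance :
        CategoryTheory.Epi (groupHomology.H2π (trivZ G))))).symm.toAddMonoidHom)

theorem ev_H2π (f : G → G → D) (hf : IsCocycle f) (x : groupHomology.cycles₂ (trivZ G)) :
    ev f hf (groupHomology.H2π (trivZ G) x) = evChain f x.1 := by
  have := (QuotientAddGroup.quotientKerEquivOfSurjective
    (groupHomology.H2π (trivZ G)).hom.toAddMonoidHom
      ((ModuleCat.epi_iff_surjective _).1 (inferInstance :
        CategoryTheory.Epi (groupHomology.H2π (trivZ G))))).symm_apply_apply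
        (QuotientAddGroup.mk x)
  exact congrArg (QuotientAddGroup.lift (groupHomology.H2π (trivZ G)).hom.toAddMonoidHom.ker
    ((evChain f).comp (groupHomology.cycles₂ (trivZ G)).subtype.toAddMonoidHom)
    (ker_H2π_le hf)) this

theorem ev_cClass (f : G → G → D) (hf : IsCocycle f) (g h : G) (hgh : Commute g h) :
    ev f hf (cClass g h hgh) = f g h - f h g := by
  rw [cClass, ev_H2π]
  simp only [cChain, map_sub]
  erw [evChain_single, evChain_single]
  simp

theorem IsCocycle.comap {f : G → G → D} (hf : IsCocycle f) (φ : H →* G) :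
    IsCocycle fun x y => f (φ x) (φ y) := fun x y z => by
  simpa using hf (φ x) (φ y) (φ z)

theorem evChain_chainsMap₂ (f : G → G → D) (φ : H →* G) (x : H × H →₀ ULift.{u} ℤ) :
    evChain f ((groupHomology.chainsMap₂ (A := trivZ H) (B := trivZ G) φ
      (Rep.ofHom ⟨LinearMap.id, fun _ => rfl⟩)).hom x) =
      evChain (fun x y => f (φ x) (φ y)) x := by
  induction x using Finsupp.induction_linear with
  | zero => simp
  | add x y hx hy =>
    rw [map_add (evChain fun x y => f (φ x) (φ y)), ← hx, ← hy, ← map_add]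
    exact congrArg _ (map_add _ _ _)
  | single p n =>
    rw [evChain_single]
    refine Eq.trans (congrArg (evChain f) (?_ : _ = Finsupp.single (φ p.1, φ p.2) n)) ?_
    · simp [Prod.map]
    · simp

theorem ev_map (f : G → G → D) (hf : IsCocycle f) (φ : H →* G) (x : H2Z H) :
    ev f hf (H2Z.map φ x) = ev (fun x y => f (φ x) (φ y)) (hf.comap φ) x := by
  induction x using groupHomology.H2_induction_on with
  | h x =>
  rw [ev_H2π]
  have := groupHomology.H2π_comp_map_apply (A := trivZ H) (B := trivZ G) φ
    (Rep.ofHom ⟨LinearMap.id, fun _ => rfl⟩) x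
  refine (congrArg (ev f hf) this).trans ?_
  rw [ev_H2π]
  exact evChain_chainsMap₂ f φ x.1

theorem ev_add (f f' : G → G → D) (hf : IsCocycle f) (hf' : IsCocycle f')
    (hff' : IsCocycle fun x y => f x y + f' x y) (x : H2Z G) :
    ev _ hff' x = ev f hf x + ev f' hf' x := by
  induction x using groupHomology.H2_induction_on with
  | h x =>
  rw [ev_H2π, ev_H2π, ev_H2π]
  have : (evChain fun x y => f x y + f' x y) = evChain f + evChain f' := by
    ext; simp
  rw [this]; rfl

theorem IsCocycle.add {f f' : G → G → D} (hf : IsCocycle f) (hf' : IsCocycle f') :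
    IsCocycle fun x y => f x y + f' x y := fun g h k => by
  have := hf g h k; have := hf' g h k
  dsimp only; grind

theorem IsCocycle.sub {f f' : G → G → D} (hf : IsCocycle f) (hf' : IsCocycle f') :
    IsCocycle fun x y => f x y - f' x y := fun g h k => by
  have := hf g h k; have := hf' g h k
  dsimp only; grind

theorem isCocycle_coboundary (w : G → D) : IsCocycle (coboundary w) := fun g h k => by
  simp only [coboundary, mul_assoc]; abel

theorem evChain_coboundary (w : G → D) (x : G × G →₀ ULift.{u} ℤ) :
    evChain (coboundary w) x = (Finsupp.liftAddHom fun g => (zmultiplesHom D (w g)).comp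
      AddEquiv.ulift.toAddMonoidHom) ((groupHomology.d₂₁ (trivZ G)).hom x) := by
  induction x using Finsupp.induction_linear with
  | zero => simp
  | add x y hx hy =>
    have : (groupHomology.d₂₁ (trivZ G)).hom (x + y) = (groupHomology.d₂₁ (trivZ G)).hom x +
      (groupHomology.d₂₁ (trivZ G)).hom y := map_add _ _ _
    rw [this, map_add, hx, hy, map_add]
  | single p n =>
    obtain ⟨g, h⟩ := p
    have : (groupHomology.d₂₁ (trivZ G)).hom (Finsupp.single (g, h) n) =
        Finsupp.single h n - Finsupp.single (g * h) n + Finsupp.single g n :=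
      groupHomology.d₂₁_single (A := trivZ G) (g, h) n
    rw [this, map_add, map_sub]
    simp only [Finsupp.liftAddHom_apply_single, evChain_single, coboundary]
    change _ = n.down • w h - n.down • w (g * h) + n.down • w g
    rw [smul_sub, smul_add]; abel

theorem ev_coboundary (w : G → D) (hw : IsCocycle (coboundary w)) (x : H2Z G) :
    ev _ hw x = 0 := by
  induction x using groupHomology.H2_induction_on with
  | h x =>
  rw [ev_H2π, evChain_coboundary]
  have : (groupHomology.d₂₁ (trivZ G)).hom x.1 = 0 := x.2
  rw [this, map_zero]

/-- Cohomologous cocycles have the same evaluation on `H₂`. -/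
theorem ev_congr {f f' : G → G → D} (hf : IsCocycle f) (hf' : IsCocycle f') (w : G → D)
    (h : ∀ x y, f x y = f' x y + coboundary w x y) (x : H2Z G) : ev f hf x = ev f' hf' x := by
  obtain rfl : f = fun x y => f' x y + coboundary w x y := by ext; apply h
  rw [ev_add f' _ hf' (isCocycle_coboundary w), ev_coboundary, add_zero]

theorem ev_sub (f f' : G → G → D) (hf : IsCocycle f) (hf' : IsCocycle f')
    (hff' : IsCocycle fun x y => f x y - f' x y) (x : H2Z G) :
    ev _ hff' x = ev f hf x - ev f' hf' x := by
  have := ev_add _ f' hff' hf' (hff'.add hf') x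
  rw [eq_sub_iff_add_eq, ← this]
  congr! with a b
  abel

/-- The map `g` descends to the image of `p`, and injectivity of `D` extends it from there to `N`.
-/
theorem exists_factor (hD : Module.Baer ℤ D) {M N : Type*} [AddCommGroup M] [AddCommGroup N]
    (p : M →+ N) (g : M →+ D) (h : ∀ x, p x = 0 → g x = 0) : ∃ k : N →+ D, ∀ x, k (p x) = g x := by
  obtain ⟨k, hk⟩ := hD.extension_property_addMonoidHom (QuotientAddGroup.kerLift p)
    (QuotientAddGroup.kerLift_injective p) (QuotientAddGroup.lift p.ker g h)
  exact ⟨k, fun x => DFunLike.congr_fun hk (x : M ⧸ p.ker)⟩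

theorem evChain_of_addMonoidHom (c : (G × G →₀ ULift.{u} ℤ) →+ D) :
    evChain (fun g h => c (Finsupp.single (g, h) 1)) = c := by
  refine Finsupp.addHom_ext fun p n => ?_
  rw [evChain_single, ← map_zsmul, Finsupp.smul_single]
  congr 2
  ext; simp

/-- Surjectivity of `H²(G, D) → Hom(H₂(G), D)`: a character of cycles extends to all chains, and its
values on bar generators form a cocycle because it kills boundaries. -/
theorem exists_cocycle_ev_eq (hD : Module.Baer ℤ D) (χ : H2Z G →+ D) :
    ∃ (f : G → G → D) (hf : IsCocycle f), ev f hf = χ := by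
  obtain ⟨c, hc⟩ := exists_factor hD (groupHomology.cycles₂ (trivZ G)).subtype.toAddMonoidHom
    (χ.comp (groupHomology.H2π (trivZ G)).hom.toAddMonoidHom) (by
      intro x hx
      have : x = 0 := Subtype.ext hx
      rw [this, map_zero])
  have hf : IsCocycle fun g h => c (Finsupp.single (g, h) 1) := by
    intro g h k
    have hb := groupHomology.d₃₂_apply_mem_cycles₂ (A := trivZ G) (Finsupp.single (g, h, k) 1)
    have h0 := hc ⟨_, hb⟩
    have h1 : groupHomology.H2π (trivZ G) ⟨_, hb⟩ = 0 :=
      (groupHomology.H2π_eq_zero_iff _).2 ⟨_, rfl⟩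
    have h2 : c ((groupHomology.d₃₂ (trivZ G)).hom (Finsupp.single (g, h, k) 1)) = 0 :=
      h0.trans ((congrArg χ h1).trans (map_zero χ))
    have : (groupHomology.d₃₂ (trivZ G)).hom (Finsupp.single (g, h, k) 1) =
        Finsupp.single (h, k) 1 - Finsupp.single (g * h, k) 1
          + Finsupp.single (g, h * k) 1 - Finsupp.single (g, h) 1 :=
      groupHomology.d₃₂_single (A := trivZ G) (g, h, k) 1
    rw [this] at h2
    simp only [map_add, map_sub] at h2
    dsimp only
    grind
  refine ⟨_, hf, ?_⟩
  ext x
  induction x using groupHomology.H2_induction_on with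
  | h x =>
  rw [ev_H2π, evChain_of_addMonoidHom]
  exact hc x

/-- Injectivity of the same map: a functional vanishing on cycles factors through `d₂₁`, and the
factor, read on generators, is `w`. -/
theorem exists_eq_coboundary (hD : Module.Baer ℤ D) (f : G → G → D) (hf : IsCocycle f)
    (h : ∀ x, ev f hf x = 0) : ∃ w : G → D, f = coboundary w := by
  obtain ⟨k, hk⟩ := exists_factor hD (groupHomology.d₂₁ (trivZ G)).hom.toAddMonoidHom
    (evChain f) (fun x hx => by
      have := h (groupHomology.H2π (trivZ G) ⟨x, hx⟩)
      rwa [ev_H2π] at this)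
  refine ⟨fun g => k (Finsupp.single g 1), ?_⟩
  ext x y
  have h1 := hk (Finsupp.single (x, y) 1)
  have : (groupHomology.d₂₁ (trivZ G)).hom (Finsupp.single (x, y) 1) =
        Finsupp.single y 1 - Finsupp.single (x * y) 1 + Finsupp.single x 1 :=
      groupHomology.d₂₁_single (A := trivZ G) (x, y) 1
  have h2 := (congrArg k this).symm.trans h1
  rw [evChain_single, map_add, map_sub] at h2
  simp only [ULift.one_down, one_smul] at h2
  rw [coboundary, ← h2]; abel

/-- Classes in `H₂` are separated by the cocycles with values in injective groups. -/
theorem H2Z_ext {x y : H2Z G} (h : ∀ (D : Type u) [AddCommGroup D] (f : G → G → D)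
    (hf : IsCocycle f), ev f hf x = ev f hf y) : x = y := by
  obtain ⟨D, _, hD, ι, hι⟩ := exists_injective_hull (H2Z G)
  obtain ⟨f, hf, rfl⟩ := exists_cocycle_ev_eq hD ι
  exact hι (h D f hf)

theorem ev_one (x : H2Z H) (f : G → G → D)
    (h1 : IsCocycle fun x y => f ((1 : H →* G) x) ((1 : H →* G) y)) : ev _ h1 x = 0 := by
  have : (fun x y => f ((1 : H →* G) x) ((1 : H →* G) y)) = coboundary fun _ => f 1 1 := by
    ext; simp [coboundary]
  rw [← ev_coboundary (fun _ : H => f 1 1) (isCocycle_coboundary _) x]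
  congr!

theorem IsCocycle.conj {f : G → G → D} (hf : IsCocycle f) (g x y : G) :
    f (g * x * g⁻¹) (g * y * g⁻¹) = f x y +
      coboundary (fun x => f (g * x * g⁻¹) g - f g x) x y := by
  have h1 := hf g x y
  have h2 := hf (g * x * g⁻¹) g y
  have h3 := hf (g * x * g⁻¹) (g * y * g⁻¹) g
  simp only [coboundary]
  have e1 : g * x * g⁻¹ * g = g * x := by group
  have e2 : g * y * g⁻¹ * g = g * y := by group
  have e3 : g * x * g⁻¹ * (g * y * g⁻¹) = g * (x * y) * g⁻¹ := by group
  rw [e1] at h2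
  rw [e2, e3] at h3
  linear_combination (norm := module) h1 - h2 + h3

/-- Inner automorphisms act trivially on `H₂`. -/
theorem H2Z.map_eq_of_conj (φ φ' : H →* G) (g : G) (h : ∀ x, φ' x = g * φ x * g⁻¹) (x : H2Z H) :
    H2Z.map φ' x = H2Z.map φ x := by
  refine H2Z_ext fun D _ f hf => ?_
  rw [ev_map, ev_map]
  refine ev_congr _ _ (fun x => f (g * φ x * g⁻¹) g - f g (φ x)) (fun x y => ?_) x
  rw [h, h, hf.conj]
  simp [coboundary]

theorem cClass_mul_right (g h k : G) (hh : Commute g h) (hk : Commute g k)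
    (hhk : Commute g (h * k)) : cClass g (h * k) hhk = cClass g h hh + cClass g k hk := by
  refine H2Z_ext fun D _ f hf => ?_
  rw [map_add, ev_cClass, ev_cClass, ev_cClass]
  have h1 := hf g h k
  have h2 := hf h g k
  have h3 := hf h k g
  rw [hh.eq] at h1
  rw [hk.eq] at h2
  grind

theorem cClass_swap (g h : G) (hh : Commute g h) :
    cClass h g hh.symm = - cClass g h hh := by
  refine H2Z_ext fun D _ f hf => ?_
  rw [map_neg, ev_cClass, ev_cClass]
  abel

theorem cClass_mul_left (g h k : G) (hg : Commute g k) (hh : Commute h k)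
    (hgh : Commute (g * h) k) : cClass (g * h) k hgh = cClass g k hg + cClass h k hh := by
  rw [← neg_inj, ← cClass_swap, cClass_mul_right k g h hg.symm hh.symm, cClass_swap _ _ hg,
    cClass_swap _ _ hh]
  abel

theorem map_cClass (φ : H →* G) (g h : H) (hh : Commute g h) (hh' : Commute (φ g) (φ h)) :
    H2Z.map φ (cClass g h hh) = cClass (φ g) (φ h) hh' := by
  refine H2Z_ext fun D _ f hf => ?_
  rw [ev_map, ev_cClass, ev_cClass]

end Cocycles

/-! ### Cocycles on semidirect products; a central element killing mixed terms. -/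

section Semidirect

/-- A `D`-valued homomorphism, for `G` multiplicative and `D` additive. -/
def IsMulAddHom {G D : Type*} [Group G] [AddCommGroup D] (k : G → D) : Prop :=
  ∀ x y, k (x * y) = k x + k y

/-- The automorphism `θ` of `N` acts without fixed points and cofixed points on `Hom(N, D)`. -/
structure RegularOn {N : Type*} [Group N] (θ : MulAut N) (D : Type*) [AddCommGroup D] : Prop where
  exists_sub_eq : ∀ k : N → D, IsMulAddHom k → ∃ m : N → D, IsMulAddHom m ∧
    ∀ x, m (θ x) - m x = k x
  eq_zero : ∀ k : N → D, IsMulAddHom k → (∀ x, k (θ x) = k x) → ∀ x, k x = 0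

variable {G N Q D : Type u} [Group G] [Group N] [Group Q] [AddCommGroup D]

/-- The primitive is forced: `w (i n * s q) = w₁ n + w₂ q - f (i n) (s q)`. It works once `h` holds,
that is, once the primitives respect the commutation `s q * i n = i (act q n) * s q`. -/
theorem exists_eq_coboundary_of_split (i : N →* G) (s : Q →* G) (act : Q → N → N)
    (hact : ∀ q n, s q * i n = i (act q n) * s q)
    (hd : ∀ g, ∃ n q, i n * s q = g)
    (hinj : ∀ n q n' q', i n * s q = i n' * s q' → n = n' ∧ q = q')
    (f : G → G → D) (hf : IsCocycle f) (w₁ : N → D) (w₂ : Q → D)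
    (h₁ : ∀ n n', f (i n) (i n') = coboundary w₁ n n')
    (h₂ : ∀ q q', f (s q) (s q') = coboundary w₂ q q')
    (h : ∀ q n, f (s q) (i n) - w₁ n = f (i (act q n)) (s q) - w₁ (act q n)) :
    ∃ w : G → D, f = coboundary w := by
  choose dn dq hd using hd
  have hdn : ∀ n q, dn (i n * s q) = n := fun n q => (hinj _ _ _ _ (hd (i n * s q))).1
  have hdq : ∀ n q, dq (i n * s q) = q := fun n q => (hinj _ _ _ _ (hd (i n * s q))).2
  refine ⟨fun g => w₁ (dn g) + w₂ (dq g) - f (i (dn g)) (s (dq g)), ?_⟩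
  ext g g'
  obtain ⟨n, q, rfl⟩ : ∃ n q, i n * s q = g := ⟨_, _, hd g⟩
  obtain ⟨n', q', rfl⟩ : ∃ n q, i n * s q = g' := ⟨_, _, hd g'⟩
  have e : i n * s q * (i n' * s q') = i (n * act q n') * s (q * q') := by
    rw [map_mul, map_mul, mul_assoc, ← mul_assoc (s q), hact]
    simp only [mul_assoc]
  simp only [coboundary]
  rw [e]
  rw [hdn, hdq, hdn, hdq, hdn, hdq, map_mul, map_mul]
  have c1 := hf (i n) (s q) (i n' * s q')
  have c2 := hf (s q) (i n') (s q')
  have c3 := hf (i (act q n')) (s q) (s q')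
  have c4 := hf (i n) (i (act q n')) (s q * s q')
  have c5 := h₁ n (act q n')
  have c6 := h₂ q q'
  have c7 := h q n'
  rw [hact] at c2
  have e2 : s q * (i n' * s q') = i (act q n') * (s q * s q') := by
    rw [← mul_assoc, hact, mul_assoc]
  rw [e2] at c1
  simp only [coboundary] at c5 c6
  linear_combination (norm := module) c1 - c2 + c3 - c4 + c5 + c6 + c7

/-- Beyond the two restrictions, the only remaining invariant is a class in `H¹(Q, Hom(N, D))`. The
central `z` acts trivially on that group, while `z - 1` is invertible on the coefficients, so the
class is zero. -/
theorem ev_eq_zero_of_semidirect (hD : Module.Baer ℤ D) (φ : Q →* MulAut N) (z : Q)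
    (hz : ∀ q, z * q = q * z) (hreg : RegularOn (φ z) D) (f : N ⋊[φ] Q → N ⋊[φ] Q → D)
    (hf : IsCocycle f)
    (hN : ∀ x, ev _ (hf.comap (SemidirectProduct.inl : N →* N ⋊[φ] Q)) x = 0)
    (hQ : ∀ x, ev _ (hf.comap (SemidirectProduct.inr : Q →* N ⋊[φ] Q)) x = 0) :
    ∃ w, f = coboundary w := by
  obtain ⟨w₁, h₁⟩ := exists_eq_coboundary hD _ _ hN
  obtain ⟨w₂, h₂⟩ := exists_eq_coboundary hD _ _ hQ
  have h₁' := fun x y => congrFun (congrFun h₁ x) y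
  have h₂' := fun x y => congrFun (congrFun h₂ x) y
  clear h₁ h₂
  simp only [coboundary] at h₁' h₂'
  set i : N →* N ⋊[φ] Q := SemidirectProduct.inl
  set s : Q →* N ⋊[φ] Q := SemidirectProduct.inr
  have hact : ∀ q n, s q * i n = i (φ q n) * s q := fun q n => by
    ext <;> simp [s, i]
  -- The failure of the compatibility required by `exists_eq_coboundary_of_split`; it is a crossed
  -- homomorphism from `Q` to `Hom(N, D)`.
  let lam : Q → N → D := fun q n =>
    f (s q) (i n) - w₁ n - f (i (φ q n)) (s q) + w₁ (φ q n)
  have lam_hom : ∀ q, IsMulAddHom (lam q) := by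
    intro q x y
    have c1 := hf (s q) (i x) (i y)
    have c2 := hf (i (φ q x)) (s q) (i y)
    have c3 := hf (i (φ q x)) (i (φ q y)) (s q)
    rw [hact] at c1 c2
    have c4 := h₁' x y
    have c5 := h₁' (φ q x) (φ q y)
    simp only [← map_mul] at c1 c2 c3 c4 c5
    simp only [lam, map_mul]
    simp only [← map_mul]
    linear_combination (norm := module) -c1 + c2 - c3 - c4 + c5
  have lam_mul : ∀ q r n, lam (q * r) n = lam r n + lam q (φ r n) := by
    intro q r n
    have c1 := hf (s q) (s r) (i n)
    have c2 := hf (s q) (i (φ r n)) (s r)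
    have c3 := hf (i (φ q (φ r n))) (s q) (s r)
    rw [hact] at c1 c2
    simp only [lam, map_mul, MulAut.mul_apply]
    linear_combination (norm := module) c1 - c2 + c3
  -- Changing `w₁` by `m` makes the crossed homomorphism vanish at `z`. By centrality its other
  -- values are then fixed by `z`, hence zero.
  obtain ⟨m, hm, hm'⟩ := hreg.exists_sub_eq (fun x => - lam z x) (fun x y => by
    linear_combination (norm := module) -lam_hom z x y)
  have key : ∀ q n, lam q n + m (φ q n) - m n = 0 := by
    intro q
    refine hreg.eq_zero (fun n => lam q n + m (φ q n) - m n) (fun x y => ?_) (fun n => ?_)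
    · dsimp only
      rw [lam_hom q x y, map_mul, hm, hm]; abel
    · have c1 := lam_mul z q n
      have c2 := lam_mul q z n
      rw [hz] at c1
      have c3 := hm' n
      have c4 := hm' (φ q n)
      have c5 : φ q (φ z n) = φ z (φ q n) := by
        rw [← MulAut.mul_apply, ← MulAut.mul_apply, ← map_mul, ← map_mul, hz]
      rw [c5]
      linear_combination (norm := module) c1 - c2 + c4 - c3
  refine exists_eq_coboundary_of_split i s (fun q n => φ q n) hact
    (fun g => ⟨g.left, g.right, SemidirectProduct.inl_left_mul_inr_right g⟩)
    (fun n q n' q' h => ⟨?_, ?_⟩) f hf (fun n => w₁ n + m n) w₂ (fun n n' => ?_) h₂'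
    (fun q n => ?_)
  · simpa [i, s] using congrArg SemidirectProduct.left h
  · simpa [i, s] using congrArg SemidirectProduct.right h
  · rw [h₁' n n']; simp only [coboundary, hm n n']; abel
  · have := key q n
    simp only [lam] at this
    linear_combination (norm := module) this

/-- A class in `H²(N, D)` that is invariant under the action of `Q` is represented by a cocycle
together with a coherent system of coboundaries trivializing its translates. -/
theorem exists_equivariant_cocycle (hD : Module.Baer ℤ D) (φ : Q →* MulAut N) (z : Q)
    (hz : ∀ q, z * q = q * z) (hreg : RegularOn (φ z) D) (ψ : H2Z N →+ D)
    (hψ : ∀ q x, ψ (H2Z.map (φ q).toMonoidHom x) = ψ x) :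
    ∃ (f : N → N → D) (hf : IsCocycle f) (h : Q → N → D), ev f hf = ψ ∧ f 1 1 = 0 ∧
      (∀ q x y, h q x + h q y + f (φ q x) (φ q y) = f x y + h q (x * y)) ∧
      ∀ q r x, h (q * r) x = h r x + h q (φ r x) := by
  obtain ⟨f, hf, hfψ, hf1⟩ : ∃ (f : N → N → D) (hf : IsCocycle f), ev f hf = ψ ∧ f 1 1 = 0 := by
    obtain ⟨f, hf, rfl⟩ := exists_cocycle_ev_eq hD ψ
    refine ⟨_, hf.sub (isCocycle_coboundary fun _ => f 1 1), ?_, ?_⟩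
    · ext x; rw [ev_sub _ _ hf (isCocycle_coboundary _), ev_coboundary, sub_zero]
    · simp [coboundary]
  have ex : ∀ q, ∃ w : N → D, ∀ x y,
      f x y - f (φ q x) (φ q y) = w x + w y - w (x * y) := by
    intro q
    have hc := hf.sub (hf.comap (φ q).toMonoidHom)
    obtain ⟨w, hw⟩ := exists_eq_coboundary hD _ hc (fun x => by
      rw [ev_sub _ _ hf (hf.comap (φ q).toMonoidHom), ← ev_map f hf, hfψ, hψ, sub_self])
    exact ⟨w, fun x y => congrFun (congrFun hw x) y⟩
  choose h₀ hh₀ using ex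
  have hcomm : ∀ q x, φ q (φ z x) = φ z (φ q x) := fun q x => by
    rw [← MulAut.mul_apply, ← MulAut.mul_apply, ← map_mul, ← map_mul, hz]
  -- `h₀ q` is free up to `Hom(N, D)`; this freedom is used to make it compatible with `h₀ z`.
  have ex' : ∀ q, ∃ w : N → D, (∀ x y, f x y - f (φ q x) (φ q y) = w x + w y - w (x * y)) ∧
      ∀ x, h₀ z (φ q x) + w x = w (φ z x) + h₀ z x := by
    intro q
    obtain ⟨k, hk, hk'⟩ := hreg.exists_sub_eq
      (fun x => h₀ z (φ q x) + h₀ q x - h₀ q (φ z x) - h₀ z x) (fun x y => by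
        have c1 := hh₀ z (φ q x) (φ q y)
        have c2 := hh₀ q x y
        have c3 := hh₀ q (φ z x) (φ z y)
        have c4 := hh₀ z x y
        rw [hcomm, hcomm] at c3
        simp only [map_mul]
        linear_combination (norm := module) -c3 - c4 + c1 + c2)
    refine ⟨fun x => h₀ q x + k x, fun x y => ?_, fun x => ?_⟩
    · linear_combination (norm := module) hh₀ q x y + hk x y
    · linear_combination (norm := module) - hk' x
  choose h hh hhz using ex'
  refine ⟨f, hf, h, hfψ, hf1, fun q x y => ?_, fun q r => ?_⟩
  · linear_combination (norm := module) -hh q x y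
  -- The defect of the crossed relation is a homomorphism fixed by `z`, so it vanishes.
  · have := hreg.eq_zero (fun x => h (q * r) x - (h r x + h q (φ r x))) (fun x y => ?_)
      (fun x => ?_)
    · intro x; exact sub_eq_zero.1 (this x)
    · have c1 := hh (q * r) x y
      have c2 := hh r x y
      have c3 := hh q (φ r x) (φ r y)
      simp only [map_mul, MulAut.mul_apply] at c1 ⊢
      linear_combination (norm := module) - c2 - c3 + c1
    · have c1 := hhz (q * r) x
      have c2 := hhz r x
      have c3 := hhz q (φ r x)
      simp only [map_mul, MulAut.mul_apply] at c1 ⊢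
      rw [hcomm r]
      linear_combination (norm := module) -c1 + c2 + c3

/-- By `hh` and `hh'`, `Q` acts through `h` on the central extension of `N` defined by `f`. The
formula is the cocycle of the semidirect product of that extension with `Q`. -/
theorem isCocycle_semidirect (φ : Q →* MulAut N) (f : N → N → D) (hf : IsCocycle f)
    (h : Q → N → D) (hh : ∀ q x y, h q x + h q y + f (φ q x) (φ q y) = f x y + h q (x * y))
    (hh' : ∀ q r x, h (q * r) x = h r x + h q (φ r x)) :
    IsCocycle fun a b : N ⋊[φ] Q => f a.left (φ a.right b.left) + h a.right b.left := by
  intro a b c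
  have c1 := hf a.left (φ a.right b.left) (φ (a.right * b.right) c.left)
  have c2 := hh a.right b.left (φ b.right c.left)
  have c3 := hh' a.right b.right c.left
  simp only [SemidirectProduct.mul_left, SemidirectProduct.mul_right, map_mul, MulAut.mul_apply]
    at c1 c2 c3 ⊢
  linear_combination (norm := module) c1 + c2 + c3

end Semidirect

section GeneralPosition

/-! Exactness in low degrees of the complexes of functions on tuples in general position: `cl x`
is the class of `x`, and a tuple is in general position when its classes are distinct. -/

variable {X Y D : Type*} [AddCommGroup D] {cl : X → Y}

theorem eq_of_generalPosition (h3 : ∀ a b : Y, ∃ x : X, cl x ≠ a ∧ cl x ≠ b) (v : X → D)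
    (hv : ∀ x y, cl x ≠ cl y → v x = v y) (x y : X) : v x = v y := by
  obtain ⟨z, hx, hy⟩ := h3 (cl x) (cl y)
  exact (hv z x hx).symm.trans (hv z y hy)

/-- Cone from a base point `o`: off the class of `o` the primitive is `u o x`. A point in the class
of `o` is joined to `o` through an auxiliary `p`, whose choice is immaterial by `ind`. -/
theorem exists_primitive₁ (h3 : ∀ a b : Y, ∃ x : X, cl x ≠ a ∧ cl x ≠ b) (u : X → X → D)
    (hu : ∀ x y z, cl x ≠ cl y → cl x ≠ cl z → cl y ≠ cl z → u y z - u x z + u x y = 0) :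
    ∃ v : X → D, ∀ x y, cl x ≠ cl y → u x y = v y - v x := by
  rcases isEmpty_or_nonempty X with hX | ⟨⟨o⟩⟩
  · exact ⟨fun _ => 0, fun x => (hX.false x).elim⟩
  have ind' : ∀ x, cl x = cl o → ∀ y y', cl y ≠ cl o → cl y' ≠ cl o → cl y ≠ cl y' →
      u o y - u x y = u o y' - u x y' := by
    intro x hx y y' hy hy' hyy
    have c1 := hu o y y' hy.symm hy'.symm hyy
    have c2 := hu x y y' (by rw [hx]; exact hy.symm) (by rw [hx]; exact hy'.symm) hyy
    linear_combination (norm := module) c1 - c2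
  have ind : ∀ x, cl x = cl o → ∀ y y', cl y ≠ cl o → cl y' ≠ cl o →
      u o y - u x y = u o y' - u x y' := by
    intro x hx y y' hy hy'
    by_cases hyy : cl y = cl y'
    · obtain ⟨t, ht, ht'⟩ := h3 (cl o) (cl y)
      exact (ind' x hx y t hy ht ht'.symm).trans (ind' x hx t y' ht hy' (hyy ▸ ht'))
    · exact ind' x hx y y' hy hy' hyy
  obtain ⟨p, hp, -⟩ := h3 (cl o) (cl o)
  classical
  refine ⟨fun x => if cl x = cl o then u o p - u x p else u o x, fun x y hxy => ?_⟩
  by_cases hx : cl x = cl o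
  · have hy : cl y ≠ cl o := fun h => hxy (hx.trans h.symm)
    simp only [if_neg hy, if_pos hx]
    rw [ind x hx p y hp hy]; abel
  · by_cases hy : cl y = cl o
    · simp only [if_pos hy, if_neg hx]
      obtain ⟨t, ht, ht'⟩ := h3 (cl o) (cl x)
      rw [ind y hy p t hp ht]
      have c1 := hu x y t hxy ht'.symm (by rw [hy]; exact ht.symm)
      have c2 := hu o x t (fun h => hx h.symm) ht.symm ht'.symm
      linear_combination (norm := module) c1 + c2
    · simp only [if_neg hx, if_neg hy]
      have c2 := hu o x y (fun h => hx h.symm) (fun h => hy h.symm) hxy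
      linear_combination (norm := module) c2

/-- The same cone, one degree higher. For `x` in the class of `o`, the difference of the cones from
`o` and `x` is a closed function of pairs off that class; its primitive `a x`, and then `b`, define
`v` on pairs meeting the class. Finding that primitive needs a point avoiding three classes. -/
theorem exists_primitive₂ (h4 : ∀ a b c : Y, ∃ x : X, cl x ≠ a ∧ cl x ≠ b ∧ cl x ≠ c)
    (u : X → X → X → D)
    (hu : ∀ x y z w, cl x ≠ cl y → cl x ≠ cl z → cl x ≠ cl w → cl y ≠ cl z → cl y ≠ cl w →
      cl z ≠ cl w → u y z w - u x z w + u x y w - u x y z = 0) :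
    ∃ v : X → X → D, ∀ x y z, cl x ≠ cl y → cl x ≠ cl z → cl y ≠ cl z →
      u x y z = v y z - v x z + v x y := by
  rcases isEmpty_or_nonempty X with hX | ⟨⟨o⟩⟩
  · exact ⟨fun _ _ => 0, fun x => (hX.false x).elim⟩
  have ha : ∀ x, cl x = cl o → ∃ a : X → D, ∀ y z, cl y ≠ cl o → cl z ≠ cl o → cl y ≠ cl z →
      u o y z - u x y z = a z - a y := by
    intro x hx
    obtain ⟨a, ha⟩ := exists_primitive₁ (X := {y : X // cl y ≠ cl o}) (cl := fun y => cl y.1)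
      (fun b c => by
        obtain ⟨t, h1, h2, h3⟩ := h4 (cl o) b c
        exact ⟨⟨t, h1⟩, h2, h3⟩) (fun y z => u o y z - u x y z) (by
        rintro ⟨y, hy⟩ ⟨z, hz⟩ ⟨w, hw⟩ hyz hyw hzw
        have c1 := hu o y z w hy.symm hz.symm hw.symm hyz hyw hzw
        have c2 := hu x y z w (hx ▸ hy.symm) (hx ▸ hz.symm) (hx ▸ hw.symm) hyz hyw hzw
        dsimp only at c1 c2 ⊢
        linear_combination (norm := module) -c1 + c2)
    classical
    refine ⟨fun y => if h : cl y ≠ cl o then a ⟨y, h⟩ else 0, fun y z hy hz hyz => ?_⟩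
    simp only [dif_pos hz, dif_pos hy]
    exact ha ⟨y, hy⟩ ⟨z, hz⟩ hyz
  choose! a ha using ha
  have hb' : ∀ x, cl x = cl o → ∀ y, cl y ≠ cl o → ∀ z z', cl z ≠ cl o → cl z' ≠ cl o →
      cl y ≠ cl z → cl y ≠ cl z' → cl z ≠ cl z' →
      u y x z - a x z + u o y z = u y x z' - a x z' + u o y z' := by
    intro x hx y hy z z' hz hz' hyz hyz' hzz'
    have c1 := hu y x z z' (hx ▸ hy) hyz hyz' (hx ▸ hz.symm) (hx ▸ hz'.symm) hzz'
    have c2 := hu o y z z' hy.symm hz.symm hz'.symm hyz hyz' hzz'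
    have c3 := ha x hx z z' hz hz' hzz'
    linear_combination (norm := module) -c1 - c2 - c3
  have hb : ∀ x, cl x = cl o → ∀ y, cl y ≠ cl o → ∃ b : D, ∀ z, cl z ≠ cl o → cl y ≠ cl z →
      u y x z - a x z + u o y z = b := by
    intro x hx y hy
    obtain ⟨p, hp, hp', -⟩ := h4 (cl o) (cl y) (cl y)
    refine ⟨u y x p - a x p + u o y p, fun z hz hyz => ?_⟩
    by_cases hpz : cl z = cl p
    · obtain ⟨t, h1, h2, h3⟩ := h4 (cl o) (cl y) (cl p)
      exact (hb' x hx y hy z t hz h1 hyz h2.symm (hpz ▸ h3.symm)).trans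
        (hb' x hx y hy t p h1 hp h2.symm hp'.symm h3)
    · exact hb' x hx y hy z p hz hp hyz hp'.symm hpz
  choose! b hb using hb
  classical
  refine ⟨fun x y => if cl x = cl o then a x y else if cl y = cl o then b y x else u o x y,
    fun x y z hxy hxz hyz => ?_⟩
  by_cases hx : cl x = cl o
  · have hy : cl y ≠ cl o := fun h => hxy (hx.trans h.symm)
    have hz : cl z ≠ cl o := fun h => hxz (hx.trans h.symm)
    simp only [if_pos hx, if_neg hy, if_neg hz]
    linear_combination (norm := module) -ha x hx y z hy hz hyz
  · by_cases hy : cl y = cl o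
    · have hz : cl z ≠ cl o := fun h => hyz (hy.trans h.symm)
      simp only [if_neg hx, if_pos hy, if_neg hz]
      linear_combination (norm := module) hb y hy x hx z hz hxz
    · by_cases hz : cl z = cl o
      · simp only [if_neg hx, if_neg hy, if_pos hz]
        obtain ⟨t, h1, h2, h3⟩ := h4 (cl o) (cl x) (cl y)
        have c1 := hu x y z t hxy hxz h2.symm hyz h3.symm (hz ▸ h1.symm)
        have c2 := hb z hz y hy t h1 h3.symm
        have c3 := hb z hz x hx t h1 h2.symm
        have c4 := hu o x y t (Ne.symm hx) (Ne.symm hy) h1.symm hxy h2.symm h3.symm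
        linear_combination (norm := module) -c1 + c2 - c3 + c4
      · simp only [if_neg hx, if_neg hy, if_neg hz]
        have c4 := hu o x y z (Ne.symm hx) (Ne.symm hy) (Ne.symm hz) hxy hxz hyz
        linear_combination (norm := module) c4

end GeneralPosition

/-! ### Descent of 2-cocycles from an action groupoid to the group. -/

section Descent

variable {G X Y D : Type*} [Group G] [MulAction G X] [AddCommGroup D]

/-- The data trivializing the two pullbacks of a 2-cocycle `f` on the action groupoid of `X` to
the pairs in general position, coherently on triples. -/
structure DescentDatum (cl : X → Y) (f : G → G → X → D) (v : G → X → X → D)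
    (u : X → X → X → D) : Prop where
  pairs : ∀ g h x y, cl x ≠ cl y →
    f g h y - f g h x = v g (h • x) (h • y) + v h x y - v (g * h) x y
  triples : ∀ g x y z, cl x ≠ cl y → cl x ≠ cl z → cl y ≠ cl z →
    v g y z - v g x z + v g x y = u (g • x) (g • y) (g • z) - u x y z

/-- Exactness on triples writes `u` as the boundary of `u'`. Corrected by `u'`, `v` is a difference
of functions `v'` of one point; corrected by `v'`, `f` agrees at any two points in general position,
hence at all points. -/
theorem DescentDatum.exists_descent {cl : X → Y} {f : G → G → X → D} {v : G → X → X → D}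
    {u : X → X → X → D} (hd : DescentDatum cl f v u)
    (hcl : ∀ (g : G) x y, cl x ≠ cl y → cl (g • x) ≠ cl (g • y))
    (h4 : ∀ a b c : Y, ∃ x : X, cl x ≠ a ∧ cl x ≠ b ∧ cl x ≠ c) (o : X)
    (hu : ∀ x y z w, cl x ≠ cl y → cl x ≠ cl z → cl x ≠ cl w → cl y ≠ cl z → cl y ≠ cl w →
      cl z ≠ cl w → u y z w - u x z w + u x y w - u x y z = 0) :
    ∃ (F : G → G → D) (v' : G → X → D),
      ∀ g h x, f g h x = F g h + v' g (h • x) + v' h x - v' (g * h) x := by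
  have h3 : ∀ a b : Y, ∃ x : X, cl x ≠ a ∧ cl x ≠ b := fun a b => by
    obtain ⟨x, h, h', -⟩ := h4 a b b
    exact ⟨x, h, h'⟩
  obtain ⟨u', hu'⟩ := exists_primitive₂ h4 u hu
  have : ∀ g, ∃ v' : X → D, ∀ x y, cl x ≠ cl y →
      v g x y - u' (g • x) (g • y) + u' x y = v' y - v' x := fun g =>
    exists_primitive₁ h3 (fun x y => v g x y - u' (g • x) (g • y) + u' x y)
      (fun x y z hxy hxz hyz => by
        have c1 := hd.triples g x y z hxy hxz hyz
        have c2 := hu' x y z hxy hxz hyz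
        have c3 := hu' _ _ _ (hcl g x y hxy) (hcl g x z hxz) (hcl g y z hyz)
        linear_combination (norm := module) c1 + c3 - c2)
  choose v' hv' using this
  refine ⟨fun g h => f g h o - v' g (h • o) - v' h o + v' (g * h) o, v', fun g h x => ?_⟩
  have := eq_of_generalPosition h3
    (fun x => f g h x - v' g (h • x) - v' h x + v' (g * h) x) (fun x y hxy => by
      have c1 := hd.pairs g h x y hxy
      have c2 := hv' g _ _ (hcl h x y hxy)
      have c3 := hv' h x y hxy
      have c4 := hv' (g * h) x y hxy
      rw [mul_smul, mul_smul] at c4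
      linear_combination (norm := module) -c1 - c2 - c3 + c4) x o
  linear_combination (norm := module) this

/-- Every 1-cocycle on the pairs in general position whose pullback to triples is a coboundary
comes, up to a coboundary, from a 1-cocycle on points. -/
def PairsDescend (G : Type*) [Group G] [MulAction G X] (cl : X → Y) (D : Type*)
    [AddCommGroup D] : Prop :=
  ∀ (χ : G → X → X → D) (u : X → X → X → D),
    (∀ g h x y, cl x ≠ cl y → χ (g * h) x y = χ g (h • x) (h • y) + χ h x y) →
    (∀ g x y z, cl x ≠ cl y → cl x ≠ cl z → cl y ≠ cl z →
      χ g y z - χ g x z + χ g x y = u (g • x) (g • y) (g • z) - u x y z) →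
    ∃ (η : G → X → D) (u' : X → X → D),
      (∀ g h x, η (g * h) x = η g (h • x) + η h x) ∧
      ∀ g x y, cl x ≠ cl y → χ g x y = η g y - η g x + u' (g • x) (g • y) - u' x y

/-- Transitivity of `G` on triples in general position. -/
def TransitiveOnTriples (G : Type*) [Group G] [MulAction G X] (cl : X → Y) : Prop :=
  ∀ x y z x' y' z', cl x ≠ cl y → cl x ≠ cl z → cl y ≠ cl z → cl x' ≠ cl y' → cl x' ≠ cl z' →
    cl y' ≠ cl z' → ∃ g : G, g • x = x' ∧ g • y = y' ∧ g • z = z'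

theorem TransitiveOnTriples.exists_const {cl : X → Y} (ht : TransitiveOnTriples G cl)
    (t : X → X → X → D) (h : ∀ (g : G) x y z, cl x ≠ cl y → cl x ≠ cl z → cl y ≠ cl z →
      t (g • x) (g • y) (g • z) = t x y z) :
    ∃ c : D, ∀ x y z, cl x ≠ cl y → cl x ≠ cl z → cl y ≠ cl z → t x y z = c := by
  by_cases hex : ∃ x y z, cl x ≠ cl y ∧ cl x ≠ cl z ∧ cl y ≠ cl z
  · obtain ⟨a, b, c, h1, h2, h3⟩ := hex
    refine ⟨t a b c, fun x y z hxy hxz hyz => ?_⟩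
    obtain ⟨g, rfl, rfl, rfl⟩ := ht a b c x y z h1 h2 h3 hxy hxz hyz
    exact h g a b c h1 h2 h3
  · exact ⟨0, fun x y z hxy hxz hyz => (hex ⟨x, y, z, hxy, hxz, hyz⟩).elim⟩

/-- Necessity of the obstruction. If `f` already descends, `v` minus the difference of `v'` is a
1-cocycle on pairs, which `PairsDescend` controls. So `u` is a boundary plus an invariant function,
constant by transitivity, and the alternating sum of four equal constants is zero. -/
theorem DescentDatum.boundary_eq_zero {cl : X → Y} {f : G → G → X → D} {v : G → X → X → D}
    {u : X → X → X → D} (hd : DescentDatum cl f v u)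
    (hp : PairsDescend G cl D) (ht : TransitiveOnTriples G cl)
    (F : G → G → D) (v' : G → X → D)
    (hF : ∀ g h x, f g h x = F g h + v' g (h • x) + v' h x - v' (g * h) x)
    (x y z w : X) (hxy : cl x ≠ cl y) (hxz : cl x ≠ cl z) (hxw : cl x ≠ cl w)
    (hyz : cl y ≠ cl z) (hyw : cl y ≠ cl w) (hzw : cl z ≠ cl w) :
    u y z w - u x z w + u x y w - u x y z = 0 := by
  obtain ⟨η, u', -, hu'⟩ := hp (fun g x y => v g x y - v' g y + v' g x) u
    (fun g h x y hxy => by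
      have c1 := hd.pairs g h x y hxy
      have c2 := hF g h x
      have c3 := hF g h y
      linear_combination (norm := module) c1 + c2 - c3)
    (fun g x y z hxy hxz hyz => by
      have c1 := hd.triples g x y z hxy hxz hyz
      linear_combination (norm := module) c1)
  obtain ⟨c, hc⟩ := ht.exists_const (fun x y z => u x y z - (u' y z - u' x z + u' x y))
    (fun g x y z hxy hxz hyz => by
      have c1 := hd.triples g x y z hxy hxz hyz
      have c2 := hu' g x y hxy
      have c3 := hu' g x z hxz
      have c4 := hu' g y z hyz
      linear_combination (norm := module) -c1 + c2 - c3 + c4)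
  have c1 := hc y z w hyz hyw hzw
  have c2 := hc x z w hxz hxw hzw
  have c3 := hc x y w hxy hxw hyw
  have c4 := hc x y z hxy hxz hyz
  linear_combination (norm := module) c1 - c2 + c3 - c4

/-- The trivializations `v'` at different points differ by a 1-cocycle on pairs; `η` and a function
on points absorb it, and the corrected trivialization no longer depends on the point. -/
theorem exists_eq_coboundary_of_points {cl : X → Y}
    (hp : PairsDescend G cl D) (ht : TransitiveOnTriples G cl)
    (h3 : ∀ a b : Y, ∃ x : X, cl x ≠ a ∧ cl x ≠ b)
    (hcl : ∀ (g : G) x y, cl x ≠ cl y → cl (g • x) ≠ cl (g • y)) (o : X)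
    (F : G → G → D) (v' : G → X → D)
    (hF : ∀ g h x, F g h = v' g (h • x) + v' h x - v' (g * h) x) :
    ∃ w : G → D, F = coboundary w := by
  obtain ⟨η, u', hη, hu'⟩ := hp (fun g x y => v' g y - v' g x) (fun _ _ _ => 0)
    (fun g h x y hxy => by
      have c2 := hF g h x
      have c3 := hF g h y
      linear_combination (norm := module) - c2 + c3)
    (fun g x y z hxy hxz hyz => by abel)
  obtain ⟨c, hc⟩ := ht.exists_const (fun x y z => u' y z - u' x z + u' x y)
    (fun g x y z hxy hxz hyz => by
      have c2 := hu' g x y hxy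
      have c3 := hu' g x z hxz
      have c4 := hu' g y z hyz
      linear_combination (norm := module) -c2 + c3 - c4)
  -- An alternating sum of three copies of `c` is `c`, so subtracting `c` makes `u'` closed.
  obtain ⟨v, hv⟩ := exists_primitive₁ h3 (fun x y => u' x y - c) (fun x y z hxy hxz hyz => by
    have := hc x y z hxy hxz hyz
    linear_combination (norm := module) this)
  have hm : ∀ g x y, v' g x - η g x - v (g • x) + v x = v' g y - η g y - v (g • y) + v y :=
    fun g => eq_of_generalPosition h3 _ (fun x y hxy => by
      have c1 := hu' g x y hxy
      have c2 := hv x y hxy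
      have c3 := hv _ _ (hcl g x y hxy)
      linear_combination (norm := module) -c1 + c2 - c3)
  refine ⟨fun g => v' g o - η g o - v (g • o) + v o, ?_⟩
  ext g h
  have c1 := hm g (h • o) o
  have c2 := hη g h o
  rw [coboundary, hF g h o]
  rw [mul_smul]
  linear_combination (norm := module) c1 - c2

end Descent

/-! ### Coordinates on the projective line and the torus part of the obstruction. -/

section Coordinates

/-- Coordinates for an action of `G` on a projective line over `R`: `lam` and `n` describe the
upper triangular matrices comparing frames along `x ↦ g • x`, `om x y` is the determinant of a
pair of representatives and `b x y` the affine coordinate of `y` from `x`. -/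
structure ProjCoord (G X R : Type*) {Y : Type*} [Group G] [MulAction G X] [CommRing R]
    (cl : X → Y) (det : G →* Rˣ) where
  lam : G → X → Rˣ
  n : G → X → R
  om : X → X → Rˣ
  b : X → X → R
  lam_mul : ∀ g h x, lam (g * h) x = lam g (h • x) * lam h x
  n_mul : ∀ g h x, n (g * h) x =
    n g (h • x) + (lam g (h • x) ^ 2 * (det g)⁻¹ : Rˣ) * n h x
  om_smul : ∀ g x y, cl x ≠ cl y → om (g • x) (g • y) =
    det g * om x y * (lam g x)⁻¹ * (lam g y)⁻¹
  om_swap : ∀ x y, cl x ≠ cl y → om y x = - om x y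
  b_smul : ∀ g x y, cl x ≠ cl y → b (g • x) (g • y) =
    n g x + (lam g x ^ 2 * (det g)⁻¹ : Rˣ) * b x y
  b_sub : ∀ x y z, cl x ≠ cl y → cl x ≠ cl z → cl y ≠ cl z →
    b x y = b x z + (om y z * (om x y)⁻¹ * (om x z)⁻¹ : Rˣ)
  plucker : ∀ x y z w, cl x ≠ cl y → cl x ≠ cl z → cl x ≠ cl w → cl y ≠ cl z → cl y ≠ cl w →
    cl z ≠ cl w →
    (om x w * om y z : R) + om x y * om z w = om x z * om y w

/-- A bilinear antisymmetric pairing on the units of `R`. -/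
structure AntisymPairing {M D : Type*} [CommGroup M] [AddCommGroup D] (B : M → M → D) : Prop where
  mul_left : ∀ a b c, B (a * b) c = B a c + B b c
  swap : ∀ a b, B b a = - B a b

namespace AntisymPairing

variable {M D : Type*} [CommGroup M] [AddCommGroup D] {B : M → M → D} (hB : AntisymPairing B)
include hB

theorem mul_right (a b c : M) : B a (b * c) = B a b + B a c := by
  rw [hB.swap, hB.mul_left, hB.swap a b, hB.swap a c]; abel

theorem inv_left (a c : M) : B a⁻¹ c = - B a c := by
  have h1 := hB.mul_left 1 1 c
  have h2 := hB.mul_left a⁻¹ a c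
  rw [inv_mul_cancel] at h2
  rw [one_mul] at h1
  linear_combination (norm := module) - h1 - h2

theorem inv_right (a c : M) : B a c⁻¹ = - B a c := by
  rw [hB.swap, hB.inv_left, hB.swap a c, neg_neg]

end AntisymPairing

variable {G X Y R D : Type*} [Group G] [MulAction G X] [CommRing R] [AddCommGroup D]
  {cl : X → Y} {det : G →* Rˣ} (P : ProjCoord G X R cl det)

namespace ProjCoord

/-- The cocycle is `B a d'` on diagonal pairs `(a, d)`, with `a = lam` and `d = det / lam`. By
`om_smul`, passing from `x` to `y` exchanges the two entries up to a coboundary in `om`, and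
antisymmetry makes the two pullbacks cohomologous. -/
theorem descentDatum_pairing {B : Rˣ → Rˣ → D} (hB : AntisymPairing B) :
    DescentDatum cl
      (fun g h x => B (P.lam g (h • x)) (det h * (P.lam h x)⁻¹))
      (fun g x y => B (P.lam g x) (P.lam g x * P.lam g y)
        + B (P.lam g y * (P.lam g x)⁻¹) (P.om x y))
      (fun x y z => B (P.om x z) (P.om x y) + B (P.om y z) (P.om x z)
        + B (P.om x y) (P.om y z) + B (P.om x z) (P.om x z)) where
  pairs g h x y hxy := by
    have e := P.om_smul h x y hxy
    rw [P.lam_mul, P.lam_mul, e]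
    generalize P.lam g (h • x) = l, P.lam g (h • y) = m, P.lam h x = l', P.lam h y = m',
      P.om x y = o, det h = d
    simp only [hB.mul_left, hB.mul_right, hB.inv_left, hB.inv_right]
    simp only [hB.swap l l', hB.swap m l']
    abel
  triples g x y z hxy hxz hyz := by
    rw [P.om_smul g x y hxy, P.om_smul g x z hxz, P.om_smul g y z hyz]
    generalize P.lam g x = l, P.lam g y = m, P.lam g z = n, P.om x y = p, P.om y z = q,
      P.om x z = s, det g = d
    simp only [hB.mul_left, hB.mul_right, hB.inv_left, hB.inv_right]
    simp only [hB.swap l m, hB.swap l n, hB.swap l q, hB.swap l s, hB.swap l d, hB.swap m n,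
      hB.swap m p, hB.swap m s, hB.swap m d, hB.swap n p, hB.swap n q, hB.swap n s, hB.swap n d,
      hB.swap p s, hB.swap p d, hB.swap q d, hB.swap s d]
    -- `B` need not be alternating: only `2 B(l, l) = 0` is known, and that is what these diagonal
    -- terms use.
    linear_combination (norm := module) -hB.swap l l - (2 : ℤ) • hB.swap d d - hB.swap n n

/-- A bilinear identity in six free units. For the determinants of four points the arguments on the
right are the cross-ratio and, by Plücker, its complement to one. -/
theorem boundary_pairing {B : Rˣ → Rˣ → D} (hB : AntisymPairing B) (o01 o02 o03 o12 o13 o23 : Rˣ) :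
    (B o13 o12 + B o23 o13 + B o12 o23 + B o13 o13)
      - (B o03 o02 + B o23 o03 + B o02 o23 + B o03 o03)
      + (B o03 o01 + B o13 o03 + B o01 o13 + B o03 o03)
      - (B o02 o01 + B o12 o02 + B o01 o12 + B o02 o02) =
    B (o03 * o12 * (o02 * o13)⁻¹) (o01 * o23 * (o02 * o13)⁻¹) := by
  simp only [hB.mul_left, hB.mul_right, hB.inv_left, hB.inv_right, mul_inv]
  simp only [hB.swap o01 o02, hB.swap o01 o03, hB.swap o01 o12, hB.swap o01 o13, hB.swap o02 o03,
    hB.swap o02 o12, hB.swap o02 o13, hB.swap o03 o13, hB.swap o03 o23, hB.swap o12 o13,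
    hB.swap o13 o23]
  linear_combination (norm := module) -hB.swap o02 o02

end ProjCoord

/-- The additive 2-cocycle `f` on `R` is equivariant for multiplication by units, up to the
coboundaries of the functions `h q`. -/
structure EquivariantCocycle (f : R → R → D) (h : Rˣ → R → D) : Prop where
  cocycle : ∀ x y z, f x y + f (x + y) z = f y z + f x (y + z)
  zero : f 0 0 = 0
  equivariant : ∀ (q : Rˣ) x y, h q x + h q y + f (q * x) (q * y) = f x y + h q (x + y)
  mul : ∀ (q r : Rˣ) x, h (q * r) x = h r x + h q (r * x)

/-! ### Products of lifts in the central extension of `R` by `D`. -/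

namespace EquivariantCocycle

variable {f : R → R → D} {h : Rˣ → R → D} (H : EquivariantCocycle f h)
include H

theorem zero_left (x : R) : f 0 x = 0 := by
  have := H.cocycle 0 0 x
  simp only [add_zero, zero_add, H.zero] at this
  linear_combination (norm := module) -this

theorem zero_right (x : R) : f x 0 = 0 := by
  have := H.cocycle x 0 0
  simp only [add_zero, H.zero] at this
  linear_combination (norm := module) this

theorem map_zero (q : Rˣ) : h q 0 = 0 := by
  have := H.equivariant q 0 0
  simp only [add_zero, mul_zero] at this
  linear_combination (norm := module) this

theorem apply_neg (x : R) : f x (-x) = f (-x) x := by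
  have := H.cocycle x (-x) x
  rw [add_neg_cancel, neg_add_cancel, H.zero_left, H.zero_right] at this
  linear_combination (norm := module) this

theorem mul_one (q r : Rˣ) : h (q * r) 1 = h r 1 + h q r := by
  rw [H.mul, _root_.mul_one]

variable (f h) in
/-- In the central extension of `R` by `D` defined by `f`, with `e r` the translate by `r` of the
chosen lift of `1`, this is the product `e r * e s * e t ∈ D` when `r + s + t = 0`. -/
def tripleProd (r s t : Rˣ) : D := h r 1 + h s 1 + h t 1 + f r s + f (r + s) t

omit H in
variable (f h) in
/-- The product of the lifts `e 1` and `e (-1)`. -/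
def negProd : D := h 1 1 + h (-1) 1 + f 1 (-1)

/-- The unit `r` carries the lifts of `1` and `-1` to those of `r` and `-r`, and fixes `D`, where
the product lies. -/
theorem negProd_eq (r : Rˣ) : h r 1 + h (-r) 1 + f r (-r) = negProd f h := by
  have c1 := H.mul_one r 1
  have c2 := H.mul_one r (-1)
  have c3 := H.equivariant r 1 (-1)
  have c4 := H.map_zero r
  simp only [Units.val_neg, Units.val_one, _root_.mul_one, mul_neg, add_neg_cancel] at c1 c2 c3
  rw [negProd]
  linear_combination (norm := module) c2 + c1 + c3 + c4

/-- The unit `q` carries `e r` to `e (q * r)` and fixes `D` (`map_zero`), to which the product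
belongs since `r + s + t = 0`. -/
theorem tripleProd_smul (q r s t : Rˣ) (hrst : (r + s + t : R) = 0) :
    tripleProd f h (q * r) (q * s) (q * t) = tripleProd f h r s t := by
  have c1 := H.mul_one q r
  have c2 := H.mul_one q s
  have c3 := H.mul_one q t
  have c4 := H.equivariant q r s
  have c5 := H.equivariant q (r + s) t
  have c6 := H.map_zero q
  rw [hrst] at c5
  simp only [tripleProd, Units.val_mul]
  rw [← mul_add]
  linear_combination (norm := module) c1 + c2 + c3 + c4 + c5 + c6

/-- The product is central, so conjugating by `e r` rotates its factors. -/
theorem tripleProd_rotate (r s t : Rˣ) (hrst : (r + s + t : R) = 0) :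
    tripleProd f h r s t = tripleProd f h s t r := by
  have c1 := H.cocycle r s t
  have e : (s + t : R) = -r := by linear_combination hrst
  have c2 := H.apply_neg r
  simp only [tripleProd]
  rw [e] at c1 ⊢
  linear_combination (norm := module) c1 + c2

/-- In `e r * e s * e t * e (-t) * e (-s) * e (-r)` the inner pairs collapse successively, each
leaving one `negProd`. -/
theorem tripleProd_add_neg (r s t : Rˣ) (hrst : (r + s + t : R) = 0) :
    tripleProd f h r s t + tripleProd f h (-t) (-s) (-r) = (3 : ℤ) • negProd f h := by
  have c1 := H.cocycle r s (-s)
  have c2 := H.negProd_eq r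
  have c3 := H.negProd_eq s
  have c4 := H.negProd_eq t
  have c5 := H.apply_neg t
  have e1 : (r + s : R) = -t := by linear_combination hrst
  have e2 : (-t + -s : R) = r := by linear_combination -hrst
  have c6 := H.zero_right r
  rw [e1, add_neg_cancel, c6] at c1
  simp only [tripleProd, Units.val_neg]
  rw [e1, e2]
  linear_combination (norm := module) c1 + c2 + c3 + c4 - c5

/-- Scaling by `-1` and rotating turns the second product of `tripleProd_add_neg` into the one with
`r` and `s` exchanged. The exchange costs a commutator, which is how `c(r, s)` enters the
obstruction. -/
theorem two_smul_tripleProd (r s t : Rˣ) (hrst : (r + s + t : R) = 0) :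
    (2 : ℤ) • tripleProd f h r s t = (3 : ℤ) • negProd f h + (f r s - f s r) := by
  have c1 := H.tripleProd_add_neg r s t hrst
  have c2 := H.tripleProd_smul (-1) t s r (by linear_combination hrst)
  have c3 := H.tripleProd_rotate t s r (by linear_combination hrst)
  have c4 := H.tripleProd_rotate s r t (by linear_combination hrst)
  have c5 := H.tripleProd_rotate r t s (by linear_combination hrst)
  have c6 : tripleProd f h r s t - tripleProd f h s r t = f r s - f s r := by
    simp only [tripleProd]
    rw [add_comm (s : R) r]
    abel
  simp only [neg_mul, one_mul] at c2
  linear_combination (norm := module) c1 - c2 + c6 + c4 + c5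

end EquivariantCocycle

/-! ### The unipotent part of the obstruction. -/

namespace ProjCoord

/-- The ratio of the diagonal entries of the matrix comparing frames along `x ↦ g • x`. -/
def ratio (g : G) (x : X) : Rˣ := P.lam g x ^ 2 * (det g)⁻¹

theorem ratio_mul (g h : G) (x : X) : P.ratio (g * h) x = P.ratio g (h • x) * P.ratio h x := by
  simp only [ratio, P.lam_mul, map_mul, mul_inv, mul_pow]
  exact mul_mul_mul_comm _ _ _ _

theorem n_mul' (g h : G) (x : X) :
    P.n (g * h) x = P.n g (h • x) + P.ratio g (h • x) * P.n h x := P.n_mul g h x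

theorem b_smul' (g : G) (x y : X) (hxy : cl x ≠ cl y) :
    P.b (g • x) (g • y) = P.n g x + P.ratio g x * P.b x y := P.b_smul g x y hxy

/-- The difference of the affine coordinates of `y` and `z` from `x`. -/
def diff (x y z : X) : Rˣ := P.om y z * (P.om x y)⁻¹ * (P.om x z)⁻¹

theorem b_sub' (x y z : X) (hxy : cl x ≠ cl y) (hxz : cl x ≠ cl z) (hyz : cl y ≠ cl z) :
    P.b x y = P.b x z + P.diff x y z := P.b_sub x y z hxy hxz hyz

variable {f : R → R → D} {h : Rˣ → R → D}

variable (f h) in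
/-- The trivialization over the pair `(x, y)` of the pullback of the unipotent cocycle. -/
def unipTriv (g : G) (x y : X) : D :=
  h (P.ratio g x) (P.b x y) + f (P.n g x) (P.ratio g x * P.b x y)

variable (f h) in
/-- The comparison of the lifts of the affine coordinates of `y` and `z` from `x`. -/
def unipDiff (x y z : X) : D := - h (P.diff x y z) 1 - f (P.b x z) (P.diff x y z)

variable (H : EquivariantCocycle f h)
include H

/-- Affine maps `b ↦ n + ratio * b` act on the central extension. `unipTriv` is the `D`-component of
the image of the chosen lift of `b x y`, so its coboundary is the cocycle of that action. -/
theorem unipTriv_mul (g k : G) (x y : X) (hxy : cl x ≠ cl y) :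
    f (P.n g (k • x)) (P.ratio g (k • x) * P.n k x) + h (P.ratio g (k • x)) (P.n k x) =
      P.unipTriv f h k x y + P.unipTriv f h g (k • x) (k • y) - P.unipTriv f h (g * k) x y := by
  simp only [unipTriv]
  rw [P.b_smul' k x y hxy, P.ratio_mul, P.n_mul', H.mul]
  generalize P.n g (k • x) = n, P.ratio g (k • x) = r, P.n k x = n', P.ratio k x = r', P.b x y = b
  have c1 := H.equivariant r n' (r' * b)
  have c2 := H.cocycle n (r * n') (r * (r' * b))
  rw [← mul_add] at c2
  rw [Units.val_mul, mul_assoc]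
  linear_combination (norm := module) c1 + c2

theorem unipTriv_sub (g : G) (x y z : X) (hxy : cl x ≠ cl y) (hxz : cl x ≠ cl z)
    (hyz : cl y ≠ cl z) : P.unipTriv f h g x z - P.unipTriv f h g x y =
      P.unipDiff f h (g • x) (g • y) (g • z) - P.unipDiff f h x y z := by
  have e : P.diff (g • x) (g • y) (g • z) = P.ratio g x * P.diff x y z := by
    simp only [diff, ratio]
    rw [P.om_smul g x y hxy, P.om_smul g x z hxz, P.om_smul g y z hyz]
    apply Additive.ofMul.injective
    simp only [ofMul_mul, ofMul_inv, ofMul_pow]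
    abel
  simp only [unipTriv, unipDiff]
  rw [e, P.b_smul' g x z hxz, H.mul_one, P.b_sub' x y z hxy hxz hyz]
  generalize P.n g x = n, P.ratio g x = r, P.b x z = b, P.diff x y z = d
  have c1 := H.equivariant r b d
  have c2 := H.cocycle n (r * b) (r * d)
  rw [← mul_add] at c2
  rw [Units.val_mul]
  linear_combination (norm := module) c1 + c2

/-- The pullbacks to a pair are each trivialized by using the other point as origin. `v` is the
difference of these trivializations, and `u` adds the changes of origin at the three vertices. -/
theorem descentDatum_unip :
    DescentDatum cl
      (fun g k x => f (P.n g (k • x)) (P.ratio g (k • x) * P.n k x)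
        + h (P.ratio g (k • x)) (P.n k x))
      (fun g x y => P.unipTriv f h g y x - P.unipTriv f h g x y)
      (fun x y z => P.unipDiff f h x y z + P.unipDiff f h y z x + P.unipDiff f h z x y) where
  pairs g k x y hxy := by
    rw [P.unipTriv_mul H g k x y hxy, P.unipTriv_mul H g k y x hxy.symm]
    abel
  triples g x y z hxy hxz hyz := by
    linear_combination (norm := module) P.unipTriv_sub H g x y z hxy hxz hyz +
      P.unipTriv_sub H g y z x hyz hxy.symm hxz.symm + P.unipTriv_sub H g z x y hxz.symm hyz.symm hxy

theorem unipDiff_swap (x y z : X) (hxy : cl x ≠ cl y) (hxz : cl x ≠ cl z) (hyz : cl y ≠ cl z) :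
    P.unipDiff f h x y z + P.unipDiff f h x z y = - EquivariantCocycle.negProd f h := by
  have e : P.diff x z y = - P.diff x y z := by
    simp only [diff, P.om_swap y z hyz, neg_mul, mul_right_comm]
  simp only [unipDiff]
  rw [e, P.b_sub' x y z hxy hxz hyz, ← H.negProd_eq (P.diff x y z)]
  have c1 := H.cocycle (P.b x z) (P.diff x y z) (-(P.diff x y z))
  rw [add_neg_cancel, H.zero_right] at c1
  rw [Units.val_neg]
  linear_combination (norm := module) -c1

/-- The three coordinate differences seen from `x` sum to zero; composing the changes of origin
leaves the product of their lifts. -/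
theorem unipDiff_cycle (x y z w : X) (hxy : cl x ≠ cl y) (hxz : cl x ≠ cl z) (hxw : cl x ≠ cl w)
    (hyz : cl y ≠ cl z) (hyw : cl y ≠ cl w) (hzw : cl z ≠ cl w) :
    P.unipDiff f h x y z + P.unipDiff f h x z w + P.unipDiff f h x w y =
      - EquivariantCocycle.tripleProd f h (P.diff x z w) (P.diff x y z) (P.diff x w y) := by
  have b1 := P.b_sub' x y z hxy hxz hyz
  have b2 := P.b_sub' x z w hxz hxw hzw
  have b3 := P.b_sub' x w y hxw hxy hyw.symm
  have e : (P.diff x z w + P.diff x y z + P.diff x w y : R) = 0 := by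
    linear_combination -b1 - b2 - b3
  simp only [unipDiff, EquivariantCocycle.tripleProd]
  have c1 := H.cocycle (P.b x w) (P.diff x z w) (P.diff x y z)
  have c2 := H.cocycle (P.b x w) (P.diff x z w + P.diff x y z) (P.diff x w y)
  rw [e, H.zero_right] at c2
  rw [← b2] at c1
  have b4 : P.b x w + (P.diff x z w + P.diff x y z) = P.b x y := by
    rw [b1, b2]; ring
  rw [b4] at c2
  linear_combination (norm := module) -c1 - c2

/-- The boundary on quadruples of the unipotent part is `-2 (f a a' - f a' a)`, `a` being the
cross-ratio and `a' = 1 - a`. -/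
theorem boundary_unip (x y z w : X) (hxy : cl x ≠ cl y) (hxz : cl x ≠ cl z) (hxw : cl x ≠ cl w)
    (hyz : cl y ≠ cl z) (hyw : cl y ≠ cl w) (hzw : cl z ≠ cl w) (a a' : Rˣ)
    (ha : a = P.om x w * P.om y z * (P.om x z * P.om y w)⁻¹)
    (ha' : a' = P.om x y * P.om z w * (P.om x z * P.om y w)⁻¹)
    (haa' : (a + a' : R) = 1) :
    (P.unipDiff f h y z w + P.unipDiff f h z w y + P.unipDiff f h w y z)
      - (P.unipDiff f h x z w + P.unipDiff f h z w x + P.unipDiff f h w x z)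
      + (P.unipDiff f h x y w + P.unipDiff f h y w x + P.unipDiff f h w x y)
      - (P.unipDiff f h x y z + P.unipDiff f h y z x + P.unipDiff f h z x y) =
    - (2 : ℤ) • (f a a' - f a' a) := by
  have s0 : (a + a' + (-1 : Rˣ) : R) = 0 := by rw [haa']; simp
  have s1 : (a' + (-1 : Rˣ) + a : R) = 0 := by rw [← s0]; ring
  have s2 : ((-1 : Rˣ) + a + a' : R) = 0 := by rw [← s0]; ring
  have t0 := H.two_smul_tripleProd a a' (-1) s0
  have r1 := H.tripleProd_rotate a a' (-1) s0
  have r2 := H.tripleProd_rotate a' (-1) a s1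
  -- The twelve terms are grouped by first point, three for each. Reversing the six that carry a
  -- minus sign (`n1` to `n6`) completes a cycle around every point.
  have k0 := P.unipDiff_cycle H x y w z hxy hxw hxz hyw hyz hzw.symm
  have k1 := P.unipDiff_cycle H y z w x hyz hyw hxy.symm hzw hxz.symm hxw.symm
  have k2 := P.unipDiff_cycle H z w y x hzw hyz.symm hxz.symm hyw.symm hxw.symm hxy.symm
  have k3 := P.unipDiff_cycle H w x y z hxw.symm hyw.symm hzw.symm hxy hxz hyz
  have n1 := P.unipDiff_swap H x w z hxw hxz hzw.symm
  have n2 := P.unipDiff_swap H x z y hxz hxy hyz.symm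
  have n3 := P.unipDiff_swap H y x z hxy.symm hyz hxz
  have n4 := P.unipDiff_swap H z x w hxz.symm hzw hxw
  have n5 := P.unipDiff_swap H z y x hyz.symm hxz.symm hxy.symm
  have n6 := P.unipDiff_swap H w z x hzw.symm hxw.symm hxz.symm
  -- Around each point the three differences are a common unit multiple of a cyclic rearrangement of
  -- `(a, a', -1)`, so all four triple products coincide.
  have q0 : EquivariantCocycle.tripleProd f h (P.diff x w z) (P.diff x y w) (P.diff x z y) =
      EquivariantCocycle.tripleProd f h a' (-1) a := by
    rw [← H.tripleProd_smul (-(P.om y w * (P.om x w * P.om x y)⁻¹)) a' (-1) a s1, ha, ha']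
    simp only [diff, P.om_swap y z hyz, P.om_swap z w hzw,
      neg_mul, mul_neg, mul_one, neg_neg]
    congr 1
    all_goals
      try apply neg_inj.2
      apply Additive.ofMul.injective
      simp only [ofMul_mul, ofMul_inv]
      abel
  have q1 : EquivariantCocycle.tripleProd f h (P.diff y w x) (P.diff y z w) (P.diff y x z) =
      EquivariantCocycle.tripleProd f h a a' (-1) := by
    rw [← H.tripleProd_smul (P.om x z * (P.om x y * P.om y z)⁻¹) a a' (-1) s0, ha, ha']
    simp only [diff, P.om_swap x y hxy, P.om_swap x w hxw,
      neg_mul, mul_neg, mul_one, neg_neg, inv_neg]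
    congr 1
    all_goals
      try apply neg_inj.2
      apply Additive.ofMul.injective
      simp only [ofMul_mul, ofMul_inv]
      abel
  have q2 : EquivariantCocycle.tripleProd f h (P.diff z y x) (P.diff z w y) (P.diff z x w) =
      EquivariantCocycle.tripleProd f h a' (-1) a := by
    rw [← H.tripleProd_smul (-(P.om y w * (P.om y z * P.om z w)⁻¹)) a' (-1) a s1, ha, ha']
    simp only [diff, P.om_swap x y hxy, P.om_swap x z hxz, P.om_swap y z hyz, P.om_swap y w hyw,
      neg_mul, mul_neg, mul_one, neg_neg, inv_neg]
    congr 1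
    all_goals
      try apply neg_inj.2
      apply Additive.ofMul.injective
      simp only [ofMul_mul, ofMul_inv]
      abel
  have q3 : EquivariantCocycle.tripleProd f h (P.diff w y z) (P.diff w x y) (P.diff w z x) =
      EquivariantCocycle.tripleProd f h a a' (-1) := by
    rw [← H.tripleProd_smul (P.om x z * (P.om x w * P.om z w)⁻¹) a a' (-1) s0, ha, ha']
    simp only [diff, P.om_swap x z hxz, P.om_swap x w hxw, P.om_swap y w hyw, P.om_swap z w hzw,
      neg_mul, mul_neg, mul_one, neg_neg, inv_neg]
    congr 1
    all_goals
      try apply neg_inj.2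
      apply Additive.ofMul.injective
      simp only [ofMul_mul, ofMul_inv]
      abel
  rw [q0] at k0
  rw [q1] at k1
  rw [q2] at k2
  rw [q3] at k3
  -- With `T` the triple product and `N` the `negProd`, the total is `-4T + 6N = -2(2T - 3N)`, and
  -- `2T - 3N` is the commutator: hence the factor 2 in `K`.
  linear_combination (norm := module) k0 + k1 + k2 + k3 - n1 - n2 - n3 - n4 - n5 - n6
    - (2 : ℤ) • t0 + (2 : ℤ) • r1

end ProjCoord
end Coordinates

/-! ### Upper triangular matrices, frames and the projective line. -/

section ProjectiveLine

variable (R : Type u) [CommRing R]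

/-- `GL₂(R)`. -/
abbrev GL2 : Type u := Matrix.GeneralLinearGroup (Fin 2) R

/-- The character `(a, d) ↦ a / d` of the diagonal torus. -/
def torusRatio : Rˣ × Rˣ →* Rˣ := MonoidHom.fst Rˣ Rˣ / MonoidHom.snd Rˣ Rˣ

/-- The group of upper triangular matrices as a semidirect product. -/
abbrev Borel : Type u :=
  Multiplicative R ⋊[(unitsActAdd R).comp (torusRatio R)] (Rˣ × Rˣ)

theorem toAdd_unitsActAdd (a : Rˣ) (x : Multiplicative R) :
    (unitsActAdd R a x).toAdd = a * x.toAdd := rfl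

/-- The embedding of the upper triangular matrices into `GL₂(R)`. -/
def borelHom : Borel R →* GL2 R where
  toFun b := Matrix.GeneralLinearGroup.mk''
    !![(b.right.1 : R), b.left.toAdd * b.right.2; 0, b.right.2] (by
      rw [Matrix.det_fin_two_of]; simp)
  map_one' := by
    ext i j
    fin_cases i <;> fin_cases j <;> simp
  map_mul' b c := by
    ext i j
    have e : ((unitsActAdd R) ((torusRatio R) b.right) c.left).toAdd =
      ((b.right.1 * b.right.2⁻¹ : Rˣ) : R) * c.left.toAdd := rfl
    rw [Units.val_mul] at e
    have e2 : (((b.right.2⁻¹ : Rˣ) : R) * b.right.2) = 1 := Units.inv_mul _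
    fin_cases i <;> fin_cases j <;> simp [Matrix.mul_apply, Fin.sum_univ_two, e]
    linear_combination (c.right.2 * b.right.1 * c.left.toAdd : R) * e2

variable {R}

theorem borelHom_apply (b : Borel R) : (borelHom R b : Matrix (Fin 2) (Fin 2) R) =
    !![(b.right.1 : R), b.left.toAdd * b.right.2; 0, b.right.2] := rfl

theorem borelHom_injective : Function.Injective (borelHom R) := by
  intro b c h
  have h' := congrArg (fun g : GL2 R => (g : Matrix (Fin 2) (Fin 2) R)) h
  simp only [borelHom_apply] at h'
  have h00 := congrFun (congrFun h' 0) 0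
  have h01 := congrFun (congrFun h' 0) 1
  have h11 := congrFun (congrFun h' 1) 1
  simp at h00 h01 h11
  have e2 : b.right.2 = c.right.2 := Units.ext h11
  apply SemidirectProduct.ext
  · apply Multiplicative.toAdd.injective
    rw [← e2] at h01
    exact (Units.mul_left_inj _).1 h01
  · exact Prod.ext (Units.ext h00) e2

theorem det_eq (g : GL2 R) : ((Matrix.GeneralLinearGroup.det g : Rˣ) : R) =
    g 0 0 * g 1 1 - g 0 1 * g 1 0 := by
  rw [Matrix.GeneralLinearGroup.val_det_apply, Matrix.det_fin_two]

theorem mem_range_borelHom (g : GL2 R) (h : g 1 0 = 0) : ∃ b, borelHom R b = g := by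
  have hd := det_eq g
  rw [h, mul_zero, sub_zero] at hd
  have hu : IsUnit (g 0 0 * g 1 1) := hd ▸ Units.isUnit _
  have h0 : IsUnit (g 0 0) := isUnit_of_mul_isUnit_left hu
  have h1 : IsUnit (g 1 1) := isUnit_of_mul_isUnit_right hu
  refine ⟨⟨Multiplicative.ofAdd (g 0 1 * (h1.unit⁻¹ : Rˣ)), (h0.unit, h1.unit)⟩, ?_⟩
  ext i j
  fin_cases i <;> fin_cases j <;> simp [borelHom_apply, h, mul_assoc]

/-- The matrix with given entries and unit determinant. -/
def mkGL (a b c d : R) (h : IsUnit (a * d - b * c)) : GL2 R :=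
  Matrix.GeneralLinearGroup.mk'' !![a, b; c, d] (by rwa [Matrix.det_fin_two_of])

section
variable (a b c d : R) (h : IsUnit (a * d - b * c))
@[simp] theorem mkGL_00 : mkGL a b c d h 0 0 = a := rfl
@[simp] theorem mkGL_01 : mkGL a b c d h 0 1 = b := rfl
@[simp] theorem mkGL_10 : mkGL a b c d h 1 0 = c := rfl
@[simp] theorem mkGL_11 : mkGL a b c d h 1 1 = d := rfl
end

theorem GL2_ext {g h : GL2 R} (h00 : g 0 0 = h 0 0) (h01 : g 0 1 = h 0 1) (h10 : g 1 0 = h 1 0)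
    (h11 : g 1 1 = h 1 1) : g = h := by
  ext i j
  fin_cases i <;> fin_cases j <;> assumption

theorem GL2_mul_apply (g h : GL2 R) (i j : Fin 2) : (g * h) i j = g i 0 * h 0 j + g i 1 * h 1 j := by
  rw [Matrix.GeneralLinearGroup.coe_mul, Matrix.mul_apply, Fin.sum_univ_two]

variable (R) in
/-- The projective line over `R` as the homogeneous space of the upper triangular matrices. -/
abbrev PLine : Type u := GL2 R ⧸ (borelHom R).range

variable (R) in
/-- The point at infinity. -/
def infPt : PLine R := QuotientGroup.mk 1

/-- Determinant one makes the diagonal entries of the comparison matrices multiply to `det g`; the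
identity at infinity makes comparison restrict to the identity on upper triangular matrices. -/
theorem exists_frame : ∃ k : PLine R → GL2 R, (∀ x, QuotientGroup.mk (k x) = x) ∧
    (∀ x, Matrix.GeneralLinearGroup.det (k x) = 1) ∧ k (infPt R) = 1 := by
  classical
  have : ∀ x : PLine R, ∃ k : GL2 R, QuotientGroup.mk k = x ∧
      Matrix.GeneralLinearGroup.det k = 1 := by
    intro x
    obtain ⟨g, rfl⟩ := QuotientGroup.mk_surjective x
    let b : Borel R := SemidirectProduct.inr (1, (Matrix.GeneralLinearGroup.det g)⁻¹)
    refine ⟨g * borelHom R b, ?_, ?_⟩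
    · exact QuotientGroup.mk_mul_of_mem g ⟨b, rfl⟩
    · rw [map_mul]
      have : Matrix.GeneralLinearGroup.det (borelHom R b) =
          (Matrix.GeneralLinearGroup.det g)⁻¹ := by
        ext
        rw [det_eq, borelHom_apply]
        simp [b]
      rw [this, mul_inv_cancel]
  choose k hk hk' using this
  refine ⟨Function.update k (infPt R) 1, fun x => ?_, fun x => ?_, ?_⟩
  · by_cases h : x = infPt R
    · subst h; rw [Function.update_self]; rfl
    · rw [Function.update_of_ne h]; exact hk x
  · by_cases h : x = infPt R
    · subst h; rw [Function.update_self, map_one]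
    · rw [Function.update_of_ne h]; exact hk' x
  · rw [Function.update_self]

/-- A frame at each point of the projective line: a matrix of determinant one taking the point at
infinity to it. -/
def frame : PLine R → GL2 R := exists_frame.choose

theorem mk_frame (x : PLine R) : QuotientGroup.mk (frame x) = x := exists_frame.choose_spec.1 x

theorem det_frame (x : PLine R) :
    frame x 0 0 * frame x 1 1 - frame x 0 1 * frame x 1 0 = 1 := by
  have := exists_frame.choose_spec.2.1 x
  rw [← det_eq]
  exact congrArg Units.val this

theorem frame_infPt : frame (infPt R) = 1 := exists_frame.choose_spec.2.2

theorem exists_cmp (g : GL2 R) (x : PLine R) :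
    ∃ b : Borel R, g * frame x = frame (g • x) * borelHom R b := by
  have : (QuotientGroup.mk (frame (g • x)) : PLine R) = QuotientGroup.mk (g * frame x) := by
    rw [mk_frame]
    conv_lhs => rw [← mk_frame x]
    rfl
  obtain ⟨b, hb⟩ := QuotientGroup.eq.1 this
  exact ⟨b, by rw [hb, mul_inv_cancel_left]⟩

/-- The upper triangular matrix comparing the frames along `x ↦ g • x`. -/
def cmp (g : GL2 R) (x : PLine R) : Borel R := (exists_cmp g x).choose

theorem cmp_spec (g : GL2 R) (x : PLine R) :
    g * frame x = frame (g • x) * borelHom R (cmp g x) := (exists_cmp g x).choose_spec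

theorem cmp_mul (g h : GL2 R) (x : PLine R) : cmp (g * h) x = cmp g (h • x) * cmp h x := by
  apply borelHom_injective
  have h1 := cmp_spec (g * h) x
  rw [mul_assoc, cmp_spec h x, ← mul_assoc, cmp_spec g (h • x), mul_assoc, ← map_mul,
    mul_smul] at h1
  exact (mul_left_cancel h1).symm

theorem smul_infPt (b : Borel R) : borelHom R b • infPt R = infPt R :=
  QuotientGroup.eq.2 (by simp)

theorem cmp_borelHom (b : Borel R) : cmp (borelHom R b) (infPt R) = b := by
  apply borelHom_injective
  have := cmp_spec (borelHom R b) (infPt R)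
  rw [smul_infPt, frame_infPt, mul_one, one_mul] at this
  exact this.symm

variable (g : GL2 R) (x y z : PLine R)

theorem cmp_00 : g 0 0 * frame x 0 0 + g 0 1 * frame x 1 0 =
    frame (g • x) 0 0 * (cmp g x).right.1 := by
  have := congrArg (fun m : GL2 R => m 0 0) (cmp_spec g x)
  simpa [GL2_mul_apply, borelHom_apply] using this

theorem cmp_10 : g 1 0 * frame x 0 0 + g 1 1 * frame x 1 0 =
    frame (g • x) 1 0 * (cmp g x).right.1 := by
  have := congrArg (fun m : GL2 R => m 1 0) (cmp_spec g x)
  simpa [GL2_mul_apply, borelHom_apply] using this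

theorem cmp_01 : g 0 0 * frame x 0 1 + g 0 1 * frame x 1 1 =
    frame (g • x) 0 0 * ((cmp g x).left.toAdd * (cmp g x).right.2)
      + frame (g • x) 0 1 * (cmp g x).right.2 := by
  have := congrArg (fun m : GL2 R => m 0 1) (cmp_spec g x)
  simpa [GL2_mul_apply, borelHom_apply] using this

theorem cmp_11 : g 1 0 * frame x 0 1 + g 1 1 * frame x 1 1 =
    frame (g • x) 1 0 * ((cmp g x).left.toAdd * (cmp g x).right.2)
      + frame (g • x) 1 1 * (cmp g x).right.2 := by
  have := congrArg (fun m : GL2 R => m 1 1) (cmp_spec g x)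
  simpa [GL2_mul_apply, borelHom_apply] using this

theorem det_cmp : Matrix.GeneralLinearGroup.det g = (cmp g x).right.1 * (cmp g x).right.2 := by
  ext
  rw [det_eq, Units.val_mul]
  have h1 := det_frame x
  have h2 := det_frame (g • x)
  have c1 := cmp_00 g x
  have c2 := cmp_10 g x
  have c3 := cmp_01 g x
  have c4 := cmp_11 g x
  set a := ((cmp g x).right.1 : R)
  set d := ((cmp g x).right.2 : R)
  linear_combination (-(g 0 0 * g 1 1 - g 0 1 * g 1 0)) * h1 + a * d * h2
    + (g 1 0 * frame x 0 1 + g 1 1 * frame x 1 1) * c1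
    - (g 0 0 * frame x 0 1 + g 0 1 * frame x 1 1) * c2
    + (frame (g • x) 0 0 * a) * c4 - (frame (g • x) 1 0 * a) * c3

/-- The determinant of the pair of representatives of two points. -/
def omR : R := frame x 0 0 * frame y 1 0 - frame x 1 0 * frame y 0 0

theorem omR_smul : omR (g • x) (g • y) * ((cmp g x).right.1 * (cmp g y).right.1) =
    (Matrix.GeneralLinearGroup.det g : Rˣ) * omR x y := by
  have c1 := cmp_00 g x
  have c2 := cmp_10 g x
  have c3 := cmp_00 g y
  have c4 := cmp_10 g y
  rw [det_eq, omR, omR]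
  set a := ((cmp g x).right.1 : R)
  set a' := ((cmp g y).right.1 : R)
  linear_combination -(g 1 0 * frame y 0 0 + g 1 1 * frame y 1 0) * c1
    - (frame (g • x) 0 0 * a) * c4 + (g 0 0 * frame y 0 0 + g 0 1 * frame y 1 0) * c2
    + (frame (g • x) 1 0 * a) * c3

theorem omR_swap : omR y x = - omR x y := by rw [omR, omR]; ring

theorem omR_self : omR x x = 0 := by rw [omR]; ring

theorem omR_plucker (w : PLine R) : omR x w * omR y z + omR x y * omR z w = omR x z * omR y w := by
  simp only [omR]; ring

theorem exists_col (m : GL2 R) : ∃ c : Rˣ, m 0 0 = frame (QuotientGroup.mk m : PLine R) 0 0 * c ∧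
    m 1 0 = frame (QuotientGroup.mk m : PLine R) 1 0 * c := by
  have e : (m • infPt R : PLine R) = QuotientGroup.mk m := by
    change QuotientGroup.mk (m * 1) = _
    rw [mul_one]
  refine ⟨(cmp m (infPt R)).right.1, ?_, ?_⟩
  · rw [← e, ← cmp_00, frame_infPt]; simp
  · rw [← e, ← cmp_10, frame_infPt]; simp

/-- The lower left entry of `(frame x)⁻¹ * m` vanishes. Invertibility of that matrix does the rest,
so `c` need not be known to be a unit. -/
theorem mk_eq_of_col (m : GL2 R) (c : R) (h0 : m 0 0 = frame x 0 0 * c)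
    (h1 : m 1 0 = frame x 1 0 * c) : (QuotientGroup.mk m : PLine R) = x := by
  obtain ⟨d, hd, hd'⟩ := exists_col m
  rw [← mk_frame x]
  symm
  apply QuotientGroup.eq.2
  obtain ⟨b, hb⟩ := mem_range_borelHom ((frame x)⁻¹ * m) (by
    have e : m = frame x * ((frame x)⁻¹ * m) := by simp
    have e0 := congrArg (fun g : GL2 R => g 0 0) e
    have e1 := congrArg (fun g : GL2 R => g 1 0) e
    simp only [GL2_mul_apply (frame x)] at e0 e1
    rw [h0] at e0
    rw [h1] at e1
    have hf := det_frame x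
    generalize ((frame x)⁻¹ * m) 0 0 = p at *
    generalize ((frame x)⁻¹ * m) 1 0 = q at *
    linear_combination (-q) * hf + frame x 1 0 * e0 - frame x 0 0 * e1)
  exact ⟨b, hb⟩

end ProjectiveLine

/-! ### Reduction to the residue field and the coordinates over a local ring. -/

section LocalRing

variable (R : Type u) [CommRing R] [IsLocalRing R]

theorem isUnit_frame (x : PLine R) : IsUnit (frame x 0 0) ∨ IsUnit (frame x 1 0) := by
  have h := det_frame x
  have h1 : IsUnit (frame x 0 0 * frame x 1 1 + -(frame x 0 1 * frame x 1 0)) := by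
    rw [← sub_eq_add_neg, h]; exact isUnit_one
  rcases IsLocalRing.isUnit_or_isUnit_of_isUnit_add h1 with h2 | h2
  · exact Or.inl (isUnit_of_mul_isUnit_left h2)
  · exact Or.inr (isUnit_of_mul_isUnit_right (IsUnit.neg_iff _ |>.1 h2))

/-- Two points are equivalent when they have the same reduction to the residue field. -/
def residueSetoid : Setoid (PLine R) where
  r x y := ¬ IsUnit (omR x y)
  iseqv :=
    { refl := fun x => by rw [omR_self]; exact not_isUnit_zero
      symm := fun {x y} h => by rwa [omR_swap, IsUnit.neg_iff]
      trans := fun {x y z} hxy hyz hxz => by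
        -- Cramer's relation among three representatives. Some coordinate of the one for `y` is a
        -- unit, so a unit `omR x z` forces `omR x y` or `omR y z` to be one.
        have e0 : omR x z * frame y 0 0 = omR y z * frame x 0 0 + omR x y * frame z 0 0 := by
          simp only [omR]; ring
        have e1 : omR x z * frame y 1 0 = omR y z * frame x 1 0 + omR x y * frame z 1 0 := by
          simp only [omR]; ring
        have aux : ∀ a b : R, ¬ IsUnit (omR y z * a + omR x y * b) := by
          intro a b h
          rcases IsLocalRing.isUnit_or_isUnit_of_isUnit_add h with h | h
          · exact hyz (isUnit_of_mul_isUnit_left h)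
          · exact hxy (isUnit_of_mul_isUnit_left h)
        rcases isUnit_frame R y with h | h
        · exact aux _ _ (e0 ▸ hxz.mul h)
        · exact aux _ _ (e1 ▸ hxz.mul h) }

variable {R}

/-- The reduction of a point of the projective line. -/
def cl (x : PLine R) : Quotient (residueSetoid R) := Quotient.mk _ x

theorem cl_ne_iff (x y : PLine R) : cl x ≠ cl y ↔ IsUnit (omR x y) := by
  rw [Ne, cl, cl, Quotient.eq]
  exact not_not

theorem cl_smul_ne (g : GL2 R) (x y : PLine R) (h : cl x ≠ cl y) : cl (g • x) ≠ cl (g • y) := by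
  rw [cl_ne_iff] at h ⊢
  have := omR_smul g x y
  exact isUnit_of_mul_isUnit_left (this ▸ (Units.isUnit _).mul h)

theorem cl_mk_ne_iff (m m' : GL2 R) :
    cl (QuotientGroup.mk m : PLine R) ≠ cl (QuotientGroup.mk m' : PLine R) ↔
      IsUnit (m 0 0 * m' 1 0 - m 1 0 * m' 0 0) := by
  obtain ⟨c, h0, h1⟩ := exists_col m
  obtain ⟨c', h0', h1'⟩ := exists_col m'
  rw [cl_ne_iff, h0, h1, h0', h1']
  have : frame (QuotientGroup.mk m : PLine R) 0 0 * c * (frame (QuotientGroup.mk m' : PLine R) 1 0 * c')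
      - frame (QuotientGroup.mk m : PLine R) 1 0 * c * (frame (QuotientGroup.mk m' : PLine R) 0 0 * c')
      = omR (QuotientGroup.mk m : PLine R) (QuotientGroup.mk m') * (c * c' : Rˣ) := by
    rw [omR, Units.val_mul]; ring
  rw [this, Units.isUnit_mul_units]

open Classical in
/-- The determinant of a pair of representatives as a unit. -/
def om (x y : PLine R) : Rˣ := if h : IsUnit (omR x y) then h.unit else 1

theorem coe_om (x y : PLine R) (h : cl x ≠ cl y) : (om x y : R) = omR x y := by
  rw [cl_ne_iff] at h
  rw [om, dif_pos h, IsUnit.unit_spec]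

/-- The first coordinate of the representative of `y` in the frame at `x`. -/
def firstCoord (x y : PLine R) : R := frame y 0 0 * frame x 1 1 - frame y 1 0 * frame x 0 1

theorem firstCoord_smul (g : GL2 R) (x y : PLine R) :
    firstCoord (g • x) (g • y) * (cmp g y).right.1 = firstCoord x y * (cmp g x).right.1 +
      (cmp g x).left.toAdd * (cmp g x).right.2 * omR x y := by
  have c1 := cmp_00 g x
  have c2 := cmp_10 g x
  have c3 := cmp_01 g x
  have c4 := cmp_11 g x
  have c5 := cmp_00 g y
  have c6 := cmp_10 g y
  have d1 := det_frame x
  have d2 := det_frame (g • x)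
  -- In the frame at `x`, the representative of `y` has coordinates `firstCoord x y` and `omR x y`.
  have p0 : frame y 0 0 = firstCoord x y * frame x 0 0 + omR x y * frame x 0 1 := by
    rw [firstCoord, omR]; linear_combination (-frame y 0 0) * d1
  have p1 : frame y 1 0 = firstCoord x y * frame x 1 0 + omR x y * frame x 1 1 := by
    rw [firstCoord, omR]; linear_combination (-frame y 1 0) * d1
  rw [p0, p1] at c5 c6
  rw [firstCoord]
  generalize firstCoord x y = p at *
  generalize omR x y = q at *
  generalize ((cmp g x).right.1 : R) = a at *
  generalize ((cmp g y).right.1 : R) = a' at *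
  generalize ((cmp g x).right.2 : R) = d at *
  generalize (cmp g x).left.toAdd = n at *
  linear_combination (-frame (g • x) 1 1) * c5 + frame (g • x) 0 1 * c6 +
    (p * a + q * (n * d)) * d2 + (p * frame (g • x) 1 1) * c1 - (p * frame (g • x) 0 1) * c2
    + (q * frame (g • x) 1 1) * c3 - (q * frame (g • x) 0 1) * c4

/-- The coordinates on the projective line over a local ring. -/
def projCoord : ProjCoord (GL2 R) (PLine R) R cl Matrix.GeneralLinearGroup.det where
  lam g x := (cmp g x).right.1
  n g x := (cmp g x).left.toAdd
  om := om
  b x y := firstCoord x y * (om x y)⁻¹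
  lam_mul g h x := by rw [cmp_mul]; rfl
  n_mul g h x := by
    rw [cmp_mul, det_cmp g (h • x)]
    have : (cmp g (h • x)).right.1 ^ 2 * ((cmp g (h • x)).right.1 * (cmp g (h • x)).right.2)⁻¹ =
        torusRatio R (cmp g (h • x)).right := by
      rw [sq, mul_inv, mul_assoc, mul_inv_cancel_left]
      exact (div_eq_mul_inv _ _).symm
    rw [this]
    rfl
  om_smul g x y h := by
    have h1 := omR_smul g x y
    rw [← coe_om _ _ h, ← coe_om _ _ (cl_smul_ne g x y h)] at h1
    rw [mul_assoc, ← mul_inv, eq_mul_inv_iff_mul_eq]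
    ext
    push_cast
    exact h1
  om_swap x y h := by
    ext
    rw [coe_om _ _ h.symm, Units.val_neg, coe_om _ _ h, omR_swap]
  b_smul g x y h := by
    have h1 := omR_smul g x y
    rw [← coe_om _ _ h, ← coe_om _ _ (cl_smul_ne g x y h), det_cmp g x, Units.val_mul] at h1
    have h2 := firstCoord_smul g x y
    rw [← coe_om _ _ h] at h2
    have e : ((cmp g x).right.1 ^ 2 * (Matrix.GeneralLinearGroup.det g)⁻¹ : Rˣ) =
        (cmp g x).right.1 * (cmp g x).right.2⁻¹ := by
      rw [det_cmp g x, sq, mul_inv, mul_assoc, mul_inv_cancel_left]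
    rw [e]
    have h3 : (om (g • x) (g • y) : R) * (cmp g y).right.1 = (cmp g x).right.2 * om x y := by
      apply (Units.mul_right_inj (cmp g x).right.1).1
      linear_combination h1
    have h4 : om (g • x) (g • y) * (cmp g y).right.1 = (cmp g x).right.2 * om x y := by
      ext; push_cast; exact h3
    have h5 : (om (g • x) (g • y))⁻¹ = (cmp g y).right.1 * ((cmp g x).right.2 * om x y)⁻¹ := by
      rw [eq_mul_inv_iff_mul_eq, ← h4, inv_mul_cancel_left]
    rw [h5, mul_inv]
    push_cast
    have i1 : ((om x y : Rˣ) : R) * ((om x y)⁻¹ : Rˣ) = 1 := Units.mul_inv _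
    have i2 : ((cmp g x).right.2 : R) * ((cmp g x).right.2⁻¹ : Rˣ) = 1 := Units.mul_inv _
    generalize (((om x y)⁻¹ : Rˣ) : R) = oi at *
    generalize (((cmp g x).right.2⁻¹ : Rˣ) : R) = di at *
    linear_combination (di * oi) * h2 +
      ((cmp g x).left.toAdd * ((cmp g x).right.2 : R) * di) * i1 + (cmp g x).left.toAdd * i2
  b_sub x y z hxy hxz hyz := by
    have d1 := det_frame x
    have i1 : ((om x y : Rˣ) : R) * ((om x y)⁻¹ : Rˣ) = 1 := Units.mul_inv _
    have i2 : ((om x z : Rˣ) : R) * ((om x z)⁻¹ : Rˣ) = 1 := Units.mul_inv _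
    push_cast
    rw [coe_om _ _ hyz]
    rw [coe_om _ _ hxy] at i1
    rw [coe_om _ _ hxz] at i2
    have h : firstCoord x y * omR x z = firstCoord x z * omR x y + omR y z := by
      simp only [firstCoord, omR]
      linear_combination (frame y 0 0 * frame z 1 0 - frame y 1 0 * frame z 0 0) * d1
    generalize (((om x y)⁻¹ : Rˣ) : R) = a at *
    generalize (((om x z)⁻¹ : Rˣ) : R) = b at *
    linear_combination (a * b) * h - firstCoord x y * a * i2 + firstCoord x z * b * i1
  plucker x y z w hxy hxz hxw hyz hyw hzw := by
    rw [coe_om _ _ hxy, coe_om _ _ hxz, coe_om _ _ hxw, coe_om _ _ hyz, coe_om _ _ hyw,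
      coe_om _ _ hzw, omR_plucker]

end LocalRing

/-! ### Points in general position, triple transitivity and the cocycles on pairs. -/

section LocalRing

variable {R : Type u} [CommRing R]

variable (R) in
/-- The point `0` of the projective line. -/
def zeroPt : PLine R := QuotientGroup.mk (mkGL 0 1 1 0 (by simp))

/-- The point of the projective line with representative `(1, t)`. -/
def affPt (t : R) : PLine R := QuotientGroup.mk (mkGL 1 0 t 1 (by simp))

variable [IsLocalRing R]

theorem cl_infPt_ne_zeroPt : cl (infPt R) ≠ cl (zeroPt R) :=
  (cl_mk_ne_iff _ _).2 (by simp)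

theorem cl_infPt_ne_affPt {t : R} (ht : IsUnit t) : cl (infPt R) ≠ cl (affPt t) :=
  (cl_mk_ne_iff _ _).2 (by simpa)

theorem cl_zeroPt_ne_affPt (t : R) : cl (zeroPt R) ≠ cl (affPt t) :=
  (cl_mk_ne_iff _ _).2 (by simp)

theorem cl_affPt_ne_affPt {s t : R} (h : IsUnit (t - s)) : cl (affPt s) ≠ cl (affPt t) :=
  (cl_mk_ne_iff _ _).2 (by simpa)

/-- The points `∞, 0, 1, t` lie in four distinct classes, so three classes cannot contain them all.
-/
theorem exists_cl_ne {t : R} (ht : IsUnit t) (ht' : IsUnit (t - 1)) (a b c : Quotient (residueSetoid R)) :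
    ∃ x : PLine R, cl x ≠ a ∧ cl x ≠ b ∧ cl x ≠ c := by
  by_contra! h
  have h1 := cl_infPt_ne_zeroPt (R := R)
  have h2 := cl_infPt_ne_affPt (isUnit_one (M := R))
  have h3 := cl_infPt_ne_affPt ht
  have h4 := cl_zeroPt_ne_affPt (1 : R)
  have h5 := cl_zeroPt_ne_affPt t
  have h6 := cl_affPt_ne_affPt ht'
  have k : ∀ x : PLine R, cl x = a ∨ cl x = b ∨ cl x = c := fun x => by
    have := h x
    tauto
  have k1 := k (infPt R)
  have k2 := k (zeroPt R)
  have k3 := k (affPt 1)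
  have k4 := k (affPt t)
  clear h k
  generalize cl (infPt R) = p1 at *
  generalize cl (zeroPt R) = p2 at *
  generalize cl (affPt (1 : R)) = p3 at *
  generalize cl (affPt t) = p4 at *
  grind

/-- Existence of a matrix whose columns are proportional to given representatives. -/
theorem exists_smul_eq (x y : PLine R) (h : cl x ≠ cl y) (a b : Rˣ) :
    ∃ m : GL2 R, m 0 0 = frame x 0 0 * a ∧ m 1 0 = frame x 1 0 * a ∧ m 0 1 = frame y 0 0 * b ∧
      m 1 1 = frame y 1 0 * b := by
  refine ⟨mkGL (frame x 0 0 * a) (frame y 0 0 * b) (frame x 1 0 * a) (frame y 1 0 * b) ?_,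
    rfl, rfl, rfl, rfl⟩
  have : frame x 0 0 * a * (frame y 1 0 * b) - frame y 0 0 * b * (frame x 1 0 * a) =
      omR x y * (a * b : Rˣ) := by rw [omR, Units.val_mul]; ring
  rw [this, Units.isUnit_mul_units]
  exact (cl_ne_iff x y).1 h

theorem smul_mk (g m : GL2 R) :
    g • (QuotientGroup.mk m : PLine R) = QuotientGroup.mk (g * m) := rfl

theorem smul_infPt_eq (m : GL2 R) (x : PLine R) (c : R) (h0 : m 0 0 = frame x 0 0 * c)
    (h1 : m 1 0 = frame x 1 0 * c) : m • infPt R = x := by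
  rw [infPt, smul_mk, mul_one]
  exact mk_eq_of_col x m c h0 h1

theorem smul_zeroPt_eq (m : GL2 R) (x : PLine R) (c : R) (h0 : m 0 1 = frame x 0 0 * c)
    (h1 : m 1 1 = frame x 1 0 * c) : m • zeroPt R = x := by
  rw [zeroPt, smul_mk]
  exact mk_eq_of_col x _ c (by simpa [GL2_mul_apply] using h0) (by simpa [GL2_mul_apply] using h1)

theorem transitiveOnTriples : TransitiveOnTriples (X := PLine R) (GL2 R) cl := by
  have key : ∀ x y z : PLine R, cl x ≠ cl y → cl x ≠ cl z → cl y ≠ cl z →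
      ∃ g : GL2 R, g • infPt R = x ∧ g • zeroPt R = y ∧ g • affPt 1 = z := by
    intro x y z hxy hxz hyz
    -- By Cramer's relation these weights make the sum of the columns `omR x y` times the
    -- representative of `z`.
    obtain ⟨m, h1, h2, h3, h4⟩ := exists_smul_eq x y hxy (- om y z) (om x z)
    refine ⟨m, smul_infPt_eq m x _ h1 h2, smul_zeroPt_eq m y _ h3 h4, ?_⟩
    rw [affPt, smul_mk]
    rw [Units.val_neg, coe_om _ _ hyz] at h1 h2
    rw [coe_om _ _ hxz] at h3 h4
    refine mk_eq_of_col z _ (omR x y) ?_ ?_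
    · simp only [GL2_mul_apply m, mkGL_00, mkGL_10, h1, h3, omR]; ring
    · simp only [GL2_mul_apply m, mkGL_00, mkGL_10, h2, h4, omR]; ring
  intro x y z x' y' z' hxy hxz hyz hxy' hxz' hyz'
  obtain ⟨g, rfl, rfl, rfl⟩ := key x y z hxy hxz hyz
  obtain ⟨g', rfl, rfl, rfl⟩ := key x' y' z' hxy' hxz' hyz'
  exact ⟨g' * g⁻¹, by simp [mul_smul], by simp [mul_smul], by simp [mul_smul]⟩

variable (R) in
/-- The diagonal matrices. -/
def torusHom : Rˣ × Rˣ →* GL2 R := (borelHom R).comp SemidirectProduct.inr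

theorem torusHom_00 (t : Rˣ × Rˣ) : torusHom R t 0 0 = t.1 := rfl
theorem torusHom_10 (t : Rˣ × Rˣ) : torusHom R t 1 0 = 0 := rfl
theorem torusHom_11 (t : Rˣ × Rˣ) : torusHom R t 1 1 = t.2 := rfl
theorem torusHom_01 (t : Rˣ × Rˣ) : torusHom R t 0 1 = 0 := by
  change (1 : Multiplicative R).toAdd * (t.2 : R) = 0
  simp

theorem torusHom_smul_infPt (t : Rˣ × Rˣ) : torusHom R t • infPt R = infPt R := smul_infPt _

theorem frame_zeroPt : ∃ c : Rˣ, frame (zeroPt R) 0 0 = 0 ∧ frame (zeroPt R) 1 0 = c := by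
  obtain ⟨c, h0, h1⟩ := exists_col (mkGL (0 : R) 1 1 0 (by simp))
  refine ⟨c⁻¹, ?_, ?_⟩
  · rw [mkGL_00] at h0
    exact (Units.mul_left_eq_zero c).1 h0.symm
  · rw [mkGL_10] at h1
    exact Units.eq_inv_of_mul_eq_one_left (by rw [mul_comm]; exact h1.symm)

theorem torusHom_smul_zeroPt (t : Rˣ × Rˣ) : torusHom R t • zeroPt R = zeroPt R := by
  obtain ⟨c, h0, h1⟩ := frame_zeroPt (R := R)
  refine smul_zeroPt_eq _ _ (t.2 * c⁻¹ : Rˣ) ?_ ?_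
  · rw [h0, torusHom_01, zero_mul]
  · rw [h1, torusHom_11, ← Units.val_mul, mul_comm, inv_mul_cancel_right]

theorem cmp_torusHom_infPt (t : Rˣ × Rˣ) : (cmp (torusHom R t) (infPt R)).right.1 = t.1 := by
  rw [torusHom, MonoidHom.comp_apply, cmp_borelHom, SemidirectProduct.right_inr]

theorem cmp_torusHom_zeroPt (t : Rˣ × Rˣ) : (cmp (torusHom R t) (zeroPt R)).right.1 = t.2 := by
  obtain ⟨c, h0, h1⟩ := frame_zeroPt (R := R)
  have := cmp_10 (torusHom R t) (zeroPt R)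
  rw [torusHom_smul_zeroPt, h0, h1, torusHom_11, mul_zero, zero_add] at this
  rw [mul_comm] at this
  exact Units.ext ((Units.mul_right_inj c).1 this.symm)

theorem torusHom_diag_smul (a : Rˣ) (x : PLine R) : torusHom R (a, a) • x = x := by
  rw [← mk_frame x, smul_mk]
  refine (mk_eq_of_col (QuotientGroup.mk (frame x)) _ (a : R) ?_ ?_)
  · rw [mk_frame, GL2_mul_apply, torusHom_00, torusHom_01]; ring
  · rw [mk_frame, GL2_mul_apply, torusHom_10, torusHom_11]; ring

theorem torusHom_diag_comm (a : Rˣ) (g : GL2 R) :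
    torusHom R (a, a) * g = g * torusHom R (a, a) := by
  apply GL2_ext <;> simp only [GL2_mul_apply, torusHom_00, torusHom_01, torusHom_10, torusHom_11] <;>
    ring

/-- By transitivity on pairs, a 1-cocycle there is governed by a homomorphism on the torus
stabilizing `(∞, 0)`. Triviality on triples kills it on scalars, leaving `ξ a - ξ d`, which is the
difference of the point cocycles `-ξ (lam)`. -/
theorem pairsDescend (D : Type*) [AddCommGroup D] : PairsDescend (X := PLine R) (GL2 R) cl D := by
  intro χ u hχ hu
  have h0 := cl_infPt_ne_zeroPt (R := R)
  let ξ : Rˣ → D := fun a => χ (torusHom R (a, 1)) (infPt R) (zeroPt R)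
  have hmul : ∀ s t : Rˣ × Rˣ, χ (torusHom R (s * t)) (infPt R) (zeroPt R) =
      χ (torusHom R s) (infPt R) (zeroPt R) + χ (torusHom R t) (infPt R) (zeroPt R) := by
    intro s t
    rw [map_mul, hχ _ _ _ _ h0, torusHom_smul_infPt, torusHom_smul_zeroPt]
  have hξ : ∀ a b, ξ (a * b) = ξ a + ξ b := by
    intro a b
    rw [← hmul (a, 1) (b, 1)]
    simp [ξ]
  -- a scalar matrix has the same value on all pairs, hence the value zero
  have hsc : ∀ a x y, cl x ≠ cl y → ∀ g : GL2 R, χ (torusHom R (a, a)) (g • x) (g • y) =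
      χ (torusHom R (a, a)) x y := by
    intro a x y hxy g
    have c1 := hχ (torusHom R (a, a)) g x y hxy
    have c2 := hχ g (torusHom R (a, a)) x y hxy
    rw [torusHom_diag_smul, torusHom_diag_smul, ← torusHom_diag_comm] at c2
    linear_combination (norm := module) c2 - c1
  have hdiag : ∀ a, χ (torusHom R (a, a)) (infPt R) (zeroPt R) = 0 := by
    intro a
    have h1 := cl_infPt_ne_affPt (isUnit_one (M := R))
    have h2 := cl_zeroPt_ne_affPt (1 : R)
    have c1 := hu (torusHom R (a, a)) _ _ _ h0 h1 h2
    simp only [torusHom_diag_smul] at c1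
    -- All three pairs from `∞, 0, 1` carry the same value, and its alternating sum is that value,
    -- so it is zero.
    obtain ⟨g, e1, e2, -⟩ := transitiveOnTriples _ _ _ _ _ _ h0 h1 h2 h2 h0.symm h1.symm
    have c2 := hsc a _ _ h0 g
    rw [e1, e2] at c2
    obtain ⟨g', e1, e2, -⟩ := transitiveOnTriples _ _ _ _ _ _ h0 h1 h2 h1 h0 h2.symm
    have c3 := hsc a _ _ h0 g'
    rw [e1, e2] at c3
    linear_combination (norm := module) c1 - c2 + c3
  have hall : ∀ t : Rˣ × Rˣ, χ (torusHom R t) (infPt R) (zeroPt R) = ξ t.1 - ξ t.2 := by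
    intro t
    have c1 := hmul (t.1, 1) (t.2, t.2)
    have c2 := hmul (t.2, 1) t
    rw [hdiag] at c1
    have e : ((t.2, 1) * t : Rˣ × Rˣ) = (t.1, 1) * (t.2, t.2) := by
      ext <;> simp [mul_comm]
    rw [e] at c2
    linear_combination (norm := module) c1 - c2
  have hk := fun x y (h : cl x ≠ cl y) => exists_smul_eq (R := R) x y h 1 1
  choose! k hk0 hk1 hk2 hk3 using hk
  have hkinf : ∀ x y, cl x ≠ cl y → k x y • infPt R = x := fun x y h =>
    smul_infPt_eq _ _ _ (hk0 x y h) (hk1 x y h)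
  have hkzero : ∀ x y, cl x ≠ cl y → k x y • zeroPt R = y := fun x y h =>
    smul_zeroPt_eq _ _ _ (hk2 x y h) (hk3 x y h)
  let η : GL2 R → PLine R → D := fun g x => - ξ (cmp g x).right.1
  have hη : ∀ g h x, η (g * h) x = η g (h • x) + η h x := by
    intro g h x
    simp only [η]
    rw [cmp_mul, SemidirectProduct.mul_right, Prod.fst_mul, hξ]; abel
  let χ' : GL2 R → PLine R → PLine R → D := fun g x y => χ g x y - (η g y - η g x)
  have hχ' : ∀ g h x y, cl x ≠ cl y → χ' (g * h) x y = χ' g (h • x) (h • y) + χ' h x y := by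
    intro g h x y hxy
    simp only [χ']
    rw [hχ g h x y hxy, hη, hη]; abel
  refine ⟨η, fun x y => χ' (k x y) (infPt R) (zeroPt R), hη, fun g x y hxy => ?_⟩
  -- Between the chosen matrices `k`, which carry `(∞, 0)` to a given pair, `g` becomes a torus
  -- element, on which `χ'` vanishes.
  have e : g * k x y = k (g • x) (g • y) *
      torusHom R ((cmp g x).right.1, (cmp g y).right.1) := by
    have hgxy := cl_smul_ne g x y hxy
    apply GL2_ext <;>
      simp only [GL2_mul_apply, hk0 x y hxy, hk1 x y hxy, hk2 x y hxy, hk3 x y hxy,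
        hk0 _ _ hgxy, hk1 _ _ hgxy, hk2 _ _ hgxy, hk3 _ _ hgxy, torusHom_00, torusHom_01,
        torusHom_10, torusHom_11, Units.val_one, mul_one, mul_zero, add_zero, zero_add, cmp_00,
        cmp_10]
  have c1 := hχ' g (k x y) _ _ h0
  rw [e, hχ' _ _ _ _ h0, torusHom_smul_infPt, torusHom_smul_zeroPt, hkinf x y hxy,
    hkzero x y hxy] at c1
  have c2 : χ' (torusHom R ((cmp g x).right.1, (cmp g y).right.1)) (infPt R) (zeroPt R) = 0 := by
    simp only [χ', η]
    rw [hall, cmp_torusHom_infPt, cmp_torusHom_zeroPt]; abel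
  rw [c2] at c1
  simp only [χ'] at c1 ⊢
  linear_combination (norm := module) -c1

/-- The cross-ratios of quadruples in general position realize all `a` with `a`, `1 - a` units. -/
theorem exists_crossRatio (a b : Rˣ) (hab : (b : R) = 1 - a) : ∃ x y z w : PLine R,
    cl x ≠ cl y ∧ cl x ≠ cl z ∧ cl x ≠ cl w ∧ cl y ≠ cl z ∧ cl y ≠ cl w ∧ cl z ≠ cl w ∧
    a = om x w * om y z * (om x z * om y w)⁻¹ ∧
    b = om x y * om z w * (om x z * om y w)⁻¹ := by
  have h01 := cl_infPt_ne_zeroPt (R := R)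
  have h02 := cl_infPt_ne_affPt (isUnit_one (M := R))
  have h03 := cl_infPt_ne_affPt a.isUnit
  have h12 := cl_zeroPt_ne_affPt (1 : R)
  have h13 := cl_zeroPt_ne_affPt (a : R)
  have h23 := cl_affPt_ne_affPt (s := 1) (t := (a : R)) (by
    rw [show (a : R) - 1 = -b by rw [hab]; ring]; exact b.isUnit.neg)
  -- The points are `∞, 0, 1, a`. The chosen frames rescale the columns `(1,0), (0,1), (1,1), (1,a)`
  -- by units, which cancel in the cross-ratio.
  have e : ∀ m m' : GL2 R, ∀ c c' : Rˣ, m 0 0 = frame (QuotientGroup.mk m : PLine R) 0 0 * c →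
      m 1 0 = frame (QuotientGroup.mk m : PLine R) 1 0 * c →
      m' 0 0 = frame (QuotientGroup.mk m' : PLine R) 0 0 * c' →
      m' 1 0 = frame (QuotientGroup.mk m' : PLine R) 1 0 * c' →
      omR (QuotientGroup.mk m : PLine R) (QuotientGroup.mk m') * (c * c') =
        m 0 0 * m' 1 0 - m 1 0 * m' 0 0 := by
    intro m m' c c' h1 h2 h3 h4
    rw [h1, h2, h3, h4, omR]; ring
  obtain ⟨c0, k0, l0⟩ := exists_col (1 : GL2 R)
  obtain ⟨c1, k1, l1⟩ := exists_col (mkGL (0 : R) 1 1 0 (by simp))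
  obtain ⟨c2, k2, l2⟩ := exists_col (mkGL (1 : R) 0 1 1 (by simp))
  obtain ⟨c3, k3, l3⟩ := exists_col (mkGL (1 : R) 0 a 1 (by simp))
  have e01 := e _ _ _ _ k0 l0 k1 l1
  have e02 := e _ _ _ _ k0 l0 k2 l2
  have e03 := e _ _ _ _ k0 l0 k3 l3
  have e12 := e _ _ _ _ k1 l1 k2 l2
  have e13 := e _ _ _ _ k1 l1 k3 l3
  have e23 := e _ _ _ _ k2 l2 k3 l3
  simp only [mkGL_00, mkGL_10, Matrix.GeneralLinearGroup.coe_one, Matrix.one_apply_eq,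
    Matrix.one_apply_ne (show (1 : Fin 2) ≠ 0 by decide)] at e01 e02 e03 e12 e13 e23
  change omR (infPt R) (zeroPt R) * _ = _ at e01
  change omR (infPt R) (affPt 1) * _ = _ at e02
  change omR (infPt R) (affPt (a : R)) * _ = _ at e03
  change omR (zeroPt R) (affPt 1) * _ = _ at e12
  change omR (zeroPt R) (affPt (a : R)) * _ = _ at e13
  change omR (affPt 1) (affPt (a : R)) * _ = _ at e23
  rw [← coe_om _ _ h01] at e01
  rw [← coe_om _ _ h02] at e02
  rw [← coe_om _ _ h03] at e03
  rw [← coe_om _ _ h12] at e12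
  rw [← coe_om _ _ h13] at e13
  rw [← coe_om _ _ h23] at e23
  refine ⟨_, _, _, _, h01, h02, h03, h12, h13, h23, ?_, ?_⟩
  all_goals
    rw [eq_mul_inv_iff_mul_eq]
    ext
    push_cast
    apply (Units.mul_left_inj (c0 * c1 * c2 * c3)).1
    push_cast
  · linear_combination (a * om (zeroPt R) (affPt (a : R)) * c1 * c3 : R) * e02 + (a : R) * e13
      - (om (zeroPt R) (affPt 1) * c1 * c2 : R) * e03 - (a : R) * e12
  · linear_combination (b * om (zeroPt R) (affPt (a : R)) * c1 * c3 : R) * e02 + (b : R) * e13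
      - (om (affPt 1) (affPt (a : R)) * c2 * c3 : R) * e01 - e23 - hab

end LocalRing

/-! ### Units provided by the size of the residue field. -/

section Residue

theorem exists_notMem_of_encard_lt {k : Type*} (s : Set k) {n : ℕ∞} (hs : s.encard < n)
    (h : n ≤ ENat.card k) : ∃ x, x ∉ s := by
  by_contra! hx
  rw [← Set.encard_univ, ← Set.eq_univ_of_forall hx] at h
  exact absurd hs (not_lt.2 h)

variable {R : Type u} [CommRing R] [IsLocalRing R]

theorem isUnit_sub_of_residue_ne {x y : R}
    (h : IsLocalRing.residue R x ≠ IsLocalRing.residue R y) : IsUnit (x - y) := by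
  rw [← IsLocalRing.residue_ne_zero_iff_isUnit, map_sub]
  exact sub_ne_zero.2 h

theorem exists_isUnit_sub_one (h : 3 ≤ ENat.card (IsLocalRing.ResidueField R)) :
    ∃ t : Rˣ, IsUnit (t - 1 : R) := by
  obtain ⟨x, hx⟩ := exists_notMem_of_encard_lt ({0, 1} : Set (IsLocalRing.ResidueField R))
    (n := 3) (lt_of_le_of_lt (Set.encard_insert_le _ _) (by
      rw [Set.encard_singleton]; norm_num)) h
  obtain ⟨t, rfl⟩ := IsLocalRing.residue_surjective x
  simp only [Set.mem_insert_iff, Set.mem_singleton_iff, not_or] at hx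
  exact ⟨((IsLocalRing.residue_ne_zero_iff_isUnit t).1 hx.1).unit,
    isUnit_sub_of_residue_ne (by simpa using hx.2)⟩

theorem exists_isUnit_sq_sub_one (h : 4 ≤ ENat.card (IsLocalRing.ResidueField R)) :
    ∃ t : Rˣ, IsUnit (t ^ 2 - 1 : R) := by
  obtain ⟨x, hx⟩ := exists_notMem_of_encard_lt ({0, 1, -1} : Set (IsLocalRing.ResidueField R))
    (n := 4) (lt_of_le_of_lt (Set.encard_insert_le _ _) (by
      refine lt_of_le_of_lt (add_le_add_left (Set.encard_insert_le _ _) _) ?_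
      rw [Set.encard_singleton]; norm_num)) h
  obtain ⟨t, rfl⟩ := IsLocalRing.residue_surjective x
  simp only [Set.mem_insert_iff, Set.mem_singleton_iff, not_or] at hx
  refine ⟨((IsLocalRing.residue_ne_zero_iff_isUnit t).1 hx.1).unit, ?_⟩
  have h1 : IsUnit (t - 1) := isUnit_sub_of_residue_ne (by simpa using hx.2.1)
  have h2 : IsUnit (t - (-1)) := isUnit_sub_of_residue_ne (by simpa using hx.2.2)
  have := h1.mul h2
  rwa [show (t - 1) * (t - (-1)) = t ^ 2 - 1 by ring] at this

end Residue

/-! ### Vanishing criterion for cocycles on upper triangular matrices. -/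

section BorelCohomology

variable {R : Type u} [CommRing R] {D : Type u} [AddCommGroup D]

/-- On `R`, `θ - 1` is multiplication by the unit `t - 1`, so precomposition with it is bijective on
homomorphisms. -/
theorem regularOn_unitsActAdd (D : Type*) [AddCommGroup D] (t : Rˣ) (ht : IsUnit (t - 1 : R)) :
    RegularOn (unitsActAdd R t) D := by
  obtain ⟨s, hs⟩ := ht
  have e : ∀ x : Multiplicative R, unitsActAdd R t x = unitsActAdd R s x * x := fun x => by
    apply Multiplicative.toAdd.injective
    rw [toAdd_mul, toAdd_unitsActAdd, toAdd_unitsActAdd, hs]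
    ring
  have e' : ∀ x : Multiplicative R, unitsActAdd R s (unitsActAdd R s⁻¹ x) = x := fun x => by
    rw [← MulAut.mul_apply, ← map_mul, mul_inv_cancel, map_one, MulAut.one_apply]
  have e'' : ∀ x : Multiplicative R, unitsActAdd R s⁻¹ (unitsActAdd R s x) = x := fun x => by
    rw [← MulAut.mul_apply, ← map_mul, inv_mul_cancel, map_one, MulAut.one_apply]
  refine ⟨fun k hk => ⟨fun x => k (unitsActAdd R s⁻¹ x), fun x y => by
    dsimp only; rw [map_mul, hk], fun x => ?_⟩, fun k hk h x => ?_⟩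
  · dsimp only
    rw [e, map_mul, hk, e'', add_sub_cancel_right]
  · have := h (unitsActAdd R s⁻¹ x)
    rw [e, hk, e'] at this
    simpa using this

theorem ev_eq_zero_of_eq_coboundary {G : Type u} [Group G] {f : G → G → D} (hf : IsCocycle f)
    (w : G → D) (h : f = coboundary w) (x : H2Z G) : ev f hf x = 0 := by
  subst h
  exact ev_coboundary w hf x

/-- A cocycle on the upper triangular matrices is a coboundary when its restrictions to the
unipotent radical and to the diagonal torus are. -/
theorem exists_eq_coboundary_of_borel (hD : Module.Baer ℤ D) (t : Rˣ) (ht : IsUnit (t - 1 : R))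
    (f : Borel R → Borel R → D) (hf : IsCocycle f)
    (hN : ∀ x, ev _ (hf.comap (SemidirectProduct.inl : Multiplicative R →* Borel R)) x = 0)
    (h₁ : ∀ x, ev _ (hf.comap
      ((SemidirectProduct.inr : Rˣ × Rˣ →* Borel R).comp (MonoidHom.inl Rˣ Rˣ))) x = 0)
    (h₂ : ∀ x, ev _ (hf.comap
      ((SemidirectProduct.inr : Rˣ × Rˣ →* Borel R).comp (MonoidHom.inr Rˣ Rˣ))) x = 0)
    (h : ∀ a d : Rˣ, f (SemidirectProduct.inr (a, 1)) (SemidirectProduct.inr (1, d)) =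
      f (SemidirectProduct.inr (1, d)) (SemidirectProduct.inr (a, 1))) :
    ∃ w, f = coboundary w := by
  refine ev_eq_zero_of_semidirect hD _ (t, 1) (fun q => mul_comm _ _) ?_ f hf hN ?_
  · have := regularOn_unitsActAdd D t ht
    have e : ((unitsActAdd R).comp (torusRatio R)) (t, 1) = unitsActAdd R t := by
      rw [MonoidHom.comp_apply]
      congr 1
      simp [torusRatio]
    rwa [e]
  · obtain ⟨w₁, hw₁⟩ := exists_eq_coboundary hD _ _ h₁
    obtain ⟨w₂, hw₂⟩ := exists_eq_coboundary hD _ _ h₂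
    obtain ⟨w, hw⟩ := exists_eq_coboundary_of_split (MonoidHom.inl Rˣ Rˣ) (MonoidHom.inr Rˣ Rˣ)
      (fun _ n => n) (fun q n => mul_comm _ _) (fun g => ⟨g.1, g.2, by simp⟩)
      (fun n q n' q' h => by simpa using h) _
      (hf.comap (SemidirectProduct.inr : Rˣ × Rˣ →* Borel R)) w₁ w₂
      (fun n n' => congrFun (congrFun hw₁ n) n') (fun n n' => congrFun (congrFun hw₂ n) n')
      (fun q n => by
        dsimp only [MonoidHom.inl_apply, MonoidHom.inr_apply]
        rw [h])
    exact fun x => ev_eq_zero_of_eq_coboundary _ w hw x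

end BorelCohomology

theorem DescentDatum.add {G X Y D : Type*} [Group G] [MulAction G X] [AddCommGroup D]
    {cl : X → Y} {f f' : G → G → X → D} {v v' : G → X → X → D} {u u' : X → X → X → D}
    (hd : DescentDatum cl f v u) (hd' : DescentDatum cl f' v' u') :
    DescentDatum cl (fun g h x => f g h x + f' g h x) (fun g x y => v g x y + v' g x y)
      (fun x y z => u x y z + u' x y z) where
  pairs g h x y hxy := by
    linear_combination (norm := module) hd.pairs g h x y hxy + hd'.pairs g h x y hxy
  triples g x y z hxy hxz hyz := by
    linear_combination (norm := module) hd.triples g x y z hxy hxz hyz +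
      hd'.triples g x y z hxy hxz hyz

/-! ### Classes in the homology of `GL₂` from the torus and the unipotent radical. -/

section Comparison

variable {R : Type u} [CommRing R] [IsLocalRing R] {D : Type u} [AddCommGroup D]

theorem AntisymPairing.lift_aux {B : Rˣ → Rˣ → D} (hB : AntisymPairing B) :
    ∃ k : TensorSigma R →+ D, ∀ a b, k (tensorSigma R a b) = B a b := by
  let β : Additive Rˣ →+ Additive Rˣ →+ D :=
    AddMonoidHom.mk' (fun a => AddMonoidHom.mk' (fun b => B a.toMul b.toMul)
      (fun b c => hB.mul_right _ _ _)) (fun a b => by ext c; exact hB.mul_left _ _ _)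
  refine ⟨QuotientAddGroup.lift (symmRel R) (TensorProduct.liftAddHom β (fun r a b => by
    rw [map_zsmul, map_zsmul]; rfl)) ?_, fun a b => ?_⟩
  · rw [symmRel, AddSubgroup.closure_le]
    rintro _ ⟨c, d, rfl⟩
    change TensorProduct.liftAddHom β _ _ = 0
    rw [map_add, TensorProduct.liftAddHom_tmul, TensorProduct.liftAddHom_tmul]
    change B c d + B d c = 0
    rw [hB.swap c d, add_neg_cancel]
  · rfl

/-- The homomorphism from `(R^× ⊗ R^×)_σ` given by an antisymmetric pairing. -/
def AntisymPairing.lift {B : Rˣ → Rˣ → D} (hB : AntisymPairing B) : TensorSigma R →+ D :=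
  hB.lift_aux.choose

theorem AntisymPairing.lift_tensorSigma {B : Rˣ → Rˣ → D} (hB : AntisymPairing B) (a b : Rˣ) :
    hB.lift (tensorSigma R a b) = B a b := hB.lift_aux.choose_spec a b

theorem tensorSigma_hom_ext {k k' : TensorSigma R →+ D}
    (h : ∀ a b, k (tensorSigma R a b) = k' (tensorSigma R a b)) : k = k' := by
  refine DFunLike.ext _ _ fun x => ?_
  obtain ⟨x, rfl⟩ := QuotientAddGroup.mk_surjective x
  induction x using TensorProduct.induction_on with
  | zero => rw [QuotientAddGroup.mk_zero, map_zero, map_zero]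
  | tmul a b => exact h a.toMul b.toMul
  | add x y hx hy => rw [QuotientAddGroup.mk_add, map_add, map_add, hx, hy]

theorem antisymPairing_tensorSigma (k : TensorSigma R →+ D) :
    AntisymPairing fun a b => k (tensorSigma R a b) where
  mul_left a b c := by
    rw [← map_add]
    congr 1
    simp only [tensorSigma, ofMul_mul, TensorProduct.add_tmul]
    rfl
  swap a b := by
    rw [← map_neg]
    congr 1
    rw [eq_neg_iff_add_eq_zero]
    exact (QuotientAddGroup.eq_zero_iff _).2 (AddSubgroup.subset_closure ⟨b, a, rfl⟩)

variable (R) in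
/-- The homomorphism `a ↦ diag(a, 1)`. -/
def dOne : Rˣ →* GL2 R := (torusHom R).comp (MonoidHom.inl Rˣ Rˣ)

variable (R) in
/-- The homomorphism `a ↦ diag(1, a)`. -/
def dTwo : Rˣ →* GL2 R := (torusHom R).comp (MonoidHom.inr Rˣ Rˣ)

variable (R) in
/-- The homomorphism taking `x` to the unipotent matrix with upper right entry `x`. -/
def unip : Multiplicative R →* GL2 R := (borelHom R).comp SemidirectProduct.inl

theorem commute_torusHom (s t : Rˣ × Rˣ) : Commute (torusHom R s) (torusHom R t) := by
  rw [Commute, SemiconjBy, ← map_mul, ← map_mul, mul_comm]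

theorem det_torusHom (t : Rˣ × Rˣ) :
    Matrix.GeneralLinearGroup.det (torusHom R t) = t.1 * t.2 := by
  ext
  rw [det_eq, torusHom_00, torusHom_01, torusHom_10, torusHom_11]
  simp

theorem det_borelHom (b : Borel R) :
    Matrix.GeneralLinearGroup.det (borelHom R b) = b.right.1 * b.right.2 := by
  ext
  rw [det_eq, borelHom_apply]
  simp

theorem exists_swap : ∃ s : GL2 R, ∀ t, torusHom R t.swap = s * torusHom R t * s⁻¹ := by
  refine ⟨mkGL 0 1 1 0 (by simp), fun t => ?_⟩
  rw [eq_mul_inv_iff_mul_eq]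
  apply GL2_ext <;>
    simp only [GL2_mul_apply, torusHom_00, torusHom_01, torusHom_10, torusHom_11, Prod.fst_swap,
      Prod.snd_swap, mkGL_00, mkGL_01, mkGL_10, mkGL_11] <;> ring

theorem cClass_conj {G : Type u} [Group G] (g x y : G) (h : Commute x y)
    (h' : Commute (g * x * g⁻¹) (g * y * g⁻¹)) : cClass _ _ h' = cClass x y h := by
  have := H2Z.map_eq_of_conj (MonoidHom.id G) (MulAut.conj g).toMonoidHom g (fun x => rfl)
    (cClass x y h)
  rw [H2Z.map_id, map_cClass _ x y h h'] at this
  exact this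

theorem cClass_congr {G : Type u} [Group G] {x y x' y' : G} (hx : x = x') (hy : y = y')
    (h : Commute x y) (h' : Commute x' y') : cClass x y h = cClass x' y' h' := by
  subst hx hy; rfl

theorem commute_dOne_dTwo (a b : Rˣ) : Commute (dOne R a) (dTwo R b) := commute_torusHom _ _

theorem commute_dOne (a b : Rˣ) : Commute (dOne R a) (dOne R b) := commute_torusHom _ _

variable (R) in
/-- The class `c(diag(a, 1), diag(1, b)) - c(diag(a, 1), diag(b, 1))`. -/
def torusClass (a b : Rˣ) : H2Z (GL2 R) :=
  cClass (dOne R a) (dTwo R b) (commute_dOne_dTwo a b) -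
    cClass (dOne R a) (dOne R b) (commute_dOne a b)

/-- Conjugation by the permutation matrix exchanges the diagonal entries and acts trivially on
homology, which makes the first term antisymmetric; the second is so by itself. -/
theorem antisymPairing_torusClass : AntisymPairing (torusClass R) where
  mul_left a b c := by
    simp only [torusClass]
    rw [cClass_congr (map_mul (dOne R) a b) rfl (commute_dOne_dTwo (a * b) c)
        ((commute_dOne_dTwo a c).mul_left (commute_dOne_dTwo b c)),
      cClass_congr (map_mul (dOne R) a b) rfl (commute_dOne (a * b) c)
        ((commute_dOne a c).mul_left (commute_dOne b c)),
      cClass_mul_left _ _ _ (commute_dOne_dTwo a c) (commute_dOne_dTwo b c),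
      cClass_mul_left _ _ _ (commute_dOne a c) (commute_dOne b c)]
    abel
  swap a b := by
    obtain ⟨s, hs⟩ := exists_swap (R := R)
    have e1 : dOne R b = s * dTwo R b * s⁻¹ := hs (1, b)
    have e2 : dTwo R a = s * dOne R a * s⁻¹ := hs (a, 1)
    have h1 : cClass (dOne R b) (dTwo R a) (commute_dOne_dTwo b a) =
        cClass (dTwo R b) (dOne R a) (commute_dOne_dTwo a b).symm := by
      rw [cClass_congr e1 e2 _ (by rw [← e1, ← e2]; exact commute_dOne_dTwo b a)]
      exact cClass_conj s _ _ _ _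
    have h2 := cClass_swap (dOne R a) (dTwo R b) (commute_dOne_dTwo a b)
    have h3 := cClass_swap (dOne R a) (dOne R b) (commute_dOne a b)
    simp only [torusClass]
    rw [h1, h2, h3]
    abel

/-- Multiplication by `a` on the unipotent radical is conjugation by `diag(a, 1)`. -/
theorem map_unip_act (a : Rˣ) (x : H2Z (Multiplicative R)) :
    H2Z.map (unip R) (H2Z.map (unitsActAdd R a).toMonoidHom x) = H2Z.map (unip R) x := by
  rw [← LinearMap.comp_apply, ← H2Z.map_comp]
  refine H2Z.map_eq_of_conj _ _ (dOne R a) (fun x => ?_) x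
  change borelHom R (SemidirectProduct.inl (unitsActAdd R a x)) = borelHom R
    (SemidirectProduct.inr (a, 1)) * borelHom R (SemidirectProduct.inl x) *
    (borelHom R (SemidirectProduct.inr (a, 1)))⁻¹
  rw [← map_inv, ← map_mul, ← map_mul, ← map_inv SemidirectProduct.inr,
    ← SemidirectProduct.inl_aut]
  congr 3
  rw [MonoidHom.comp_apply]
  congr 1
  simp [torusRatio]

theorem toAddMonoidEnd_ulift {M : Type*} [AddCommGroup M] [Module (ULift.{u} ℤ) M]
    (n : ULift.{u} ℤ) (x : M) : Module.toAddMonoidEnd (ULift.{u} ℤ) M n x = n.down • x := by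
  have e : ((n.down : ℤ) : ULift.{u} ℤ) = n := by ext; simp
  rw [← e, map_intCast]
  simp

/-- A homomorphism on `H₂(G)` that is invariant under the action of `M` factors through the
coinvariants. -/
theorem exists_coinvariants_lift {M G : Type u} [Group M] [Group G] (φ : M →* MulAut G)
    (k : H2Z G →+ D) (hk : ∀ q x, k (H2Z.map (φ q).toMonoidHom x) = k x) :
    ∃ k' : (H2Z.rep φ).Coinvariants →+ D, ∀ x, k' (Representation.Coinvariants.mk _ x) = k x := by
  refine ⟨QuotientAddGroup.lift _ k ?_, fun x => rfl⟩
  intro x hx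
  change x ∈ Representation.Coinvariants.ker _ at hx
  induction hx using Submodule.span_induction with
  | mem x h =>
    obtain ⟨⟨q, y⟩, rfl⟩ := h
    change k (H2Z.map (φ q).toMonoidHom y - y) = 0
    rw [map_sub, hk, sub_self]
  | zero => exact map_zero k
  | add x y _ _ hx hy => change k (x + y) = 0; rw [map_add]; exact (congrArg₂ _ hx hy).trans (add_zero _)
  | smul n x _ hx =>
    rw [AddMonoidHom.mem_ker] at hx ⊢
    exact (congrArg k (toAddMonoidEnd_ulift n x)).trans (by rw [map_zsmul, hx, smul_zero])

end Comparison

/-! ### Extending cocycles from upper triangular matrices to `GL₂`. -/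

section BorelCocycle

variable {R : Type u} [CommRing R] [IsLocalRing R] {D : Type u} [AddCommGroup D]

theorem exists_equivariantCocycle (hD : Module.Baer ℤ D) (t : Rˣ) (ht : IsUnit (t - 1 : R))
    (ψ : H2Z (Multiplicative R) →+ D)
    (hψ : ∀ q x, ψ (H2Z.map (unitsActAdd R q).toMonoidHom x) = ψ x) :
    ∃ (f : R → R → D) (h : Rˣ → R → D) (_ : EquivariantCocycle f h)
      (hf : IsCocycle fun x y : Multiplicative R => f x.toAdd y.toAdd), ev _ hf = ψ := by
  obtain ⟨f, hf, h, rfl, h1, hh, hh'⟩ := exists_equivariant_cocycle hD (unitsActAdd R) t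
    (fun q => mul_comm _ _) (regularOn_unitsActAdd D t ht) ψ hψ
  exact ⟨fun x y => f (.ofAdd x) (.ofAdd y), fun q x => h q (.ofAdd x),
    ⟨fun x y z => hf (.ofAdd x) (.ofAdd y) (.ofAdd z), h1,
      fun q x y => hh q (.ofAdd x) (.ofAdd y), fun q r x => hh' q r (.ofAdd x)⟩, hf, rfl⟩

theorem EquivariantCocycle.one {f : R → R → D} {h : Rˣ → R → D} (H : EquivariantCocycle f h)
    (x : R) : h 1 x = 0 := by
  have := H.mul 1 1 x
  simpa using this

/-- The cocycle on the upper triangular matrices given by a pairing on the units of `R` and an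
equivariant cocycle on `R`. -/
def borelCocycle (B : Rˣ → Rˣ → D) (f : R → R → D) (h : Rˣ → R → D) (b c : Borel R) : D :=
  B b.right.1 c.right.2 + (f b.left.toAdd (torusRatio R b.right * c.left.toAdd) +
    h (torusRatio R b.right) c.left.toAdd)

variable {B : Rˣ → Rˣ → D} {f : R → R → D} {h : Rˣ → R → D}

theorem isCocycle_borelCocycle (hB : AntisymPairing B) (H : EquivariantCocycle f h) :
    IsCocycle (borelCocycle B f h) := by
  refine IsCocycle.add (f := fun b c : Borel R => B b.right.1 c.right.2) (fun a b c => ?_) ?_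
  · simp only [SemidirectProduct.mul_right, Prod.fst_mul, Prod.snd_mul, hB.mul_left, hB.mul_right]
    abel
  · exact isCocycle_semidirect ((unitsActAdd R).comp (torusRatio R))
      (fun x y => f x.toAdd y.toAdd) (fun x y z => H.cocycle x.toAdd y.toAdd z.toAdd)
      (fun q x => h (torusRatio R q) x.toAdd)
      (fun q x y => H.equivariant (torusRatio R q) x.toAdd y.toAdd)
      (fun q r x => by
        rw [map_mul]
        exact H.mul (torusRatio R q) (torusRatio R r) x.toAdd)

theorem borelCocycle_inl (hB : AntisymPairing B) (H : EquivariantCocycle f h)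
    (x y : Multiplicative R) :
    borelCocycle B f h (SemidirectProduct.inl x) (SemidirectProduct.inl y) =
      f x.toAdd y.toAdd := by
  have h1 := hB.mul_left 1 1 1
  simp only [mul_one, left_eq_add] at h1
  simp [borelCocycle, H.one, h1]

theorem borelCocycle_inr (H : EquivariantCocycle f h) (s t : Rˣ × Rˣ) :
    borelCocycle B f h (SemidirectProduct.inr s) (SemidirectProduct.inr t) = B s.1 t.2 := by
  simp [borelCocycle, H.zero, H.map_zero]

theorem ratio_projCoord (g : GL2 R) (x : PLine R) :
    (projCoord (R := R)).ratio g x = torusRatio R (cmp g x).right := by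
  change (cmp g x).right.1 ^ 2 * (Matrix.GeneralLinearGroup.det g)⁻¹ = _
  rw [det_cmp g x]
  change _ = (cmp g x).right.1 / (cmp g x).right.2
  rw [div_eq_mul_inv, mul_inv, sq]
  group

theorem crossRatio_add (x y z w : PLine R) (hxy : cl x ≠ cl y) (hxz : cl x ≠ cl z)
    (hxw : cl x ≠ cl w) (hyz : cl y ≠ cl z) (hyw : cl y ≠ cl w) (hzw : cl z ≠ cl w) :
    ((om x w * om y z * (om x z * om y w)⁻¹ : Rˣ) : R) +
      (om x y * om z w * (om x z * om y w)⁻¹ : Rˣ) = 1 := by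
  have e : (om x w * om y z : R) + om x y * om z w = om x z * om y w :=
    projCoord.plucker x y z w hxy hxz hxw hyz hyw hzw
  rw [Units.val_mul, Units.val_mul (om x y * om z w), ← add_mul, Units.val_mul, Units.val_mul, e,
    ← Units.val_mul (om x z), ← Units.val_mul, mul_inv_cancel, Units.val_one]

/-- The sum of the torus and unipotent data. Its boundary on quadruples is the obstruction from
which the generators of `K` arise. -/
theorem exists_descentDatum_borelCocycle (hB : AntisymPairing B) (H : EquivariantCocycle f h) :
    ∃ v u, DescentDatum (X := PLine R) cl
      (fun g k x => borelCocycle B f h (cmp g (k • x)) (cmp k x)) v u ∧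
      ∀ x y z w, cl x ≠ cl y → cl x ≠ cl z → cl x ≠ cl w → cl y ≠ cl z → cl y ≠ cl w →
        cl z ≠ cl w → ∀ a b : Rˣ, a = om x w * om y z * (om x z * om y w)⁻¹ →
        b = om x y * om z w * (om x z * om y w)⁻¹ →
        u y z w - u x z w + u x y w - u x y z = B a b - (2 : ℤ) • (f a b - f b a) := by
  have hd := (projCoord (R := R)).descentDatum_pairing hB |>.add
    ((projCoord (R := R)).descentDatum_unip H)
  refine ⟨_, _, Eq.mp (congrArg (fun f => DescentDatum cl f _ _) ?_) hd, ?_⟩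
  · funext g k x
    rw [ratio_projCoord, borelCocycle]
    congr 2
    change Matrix.GeneralLinearGroup.det k * (cmp k x).right.1⁻¹ = _
    rw [det_cmp k x, mul_inv_cancel_comm]
  · intro x y z w hxy hxz hxw hyz hyw hzw a b ha hb
    have hab : (a + b : R) = 1 := by
      rw [ha, hb]
      exact crossRatio_add x y z w hxy hxz hxw hyz hyw hzw
    have c1 := ProjCoord.boundary_pairing hB (projCoord.om x y) (projCoord.om x z)
      (projCoord.om x w) (projCoord.om y z) (projCoord.om y w) (projCoord.om z w)
    have c3 := c1.trans (congrArg₂ B ha hb).symm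
    have c2 := projCoord.boundary_unip H x y z w hxy hxz hxw hyz hyw hzw a b ha hb hab
    linear_combination (norm := module) c2 + c3

/-- A cocycle on `GL₂` is cohomologous, on the action groupoid of the projective line, to its
restriction to the upper triangular matrices. -/
theorem eq_comp_cmp_add {F : GL2 R → GL2 R → D} (hF : IsCocycle F) (g k : GL2 R) (x : PLine R) :
    let v : GL2 R → PLine R → D := fun g x =>
      F g (frame x) - F (frame (g • x)) (borelHom R (cmp g x))
    F g k = F (borelHom R (cmp g (k • x))) (borelHom R (cmp k x)) +
      v g (k • x) + v k x - v (g * k) x := by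
  intro v
  have c1 := hF g k (frame x)
  have c2 := hF g (frame (k • x)) (borelHom R (cmp k x))
  have c3 := hF (frame (g • k • x)) (borelHom R (cmp g (k • x))) (borelHom R (cmp k x))
  rw [cmp_spec k x] at c1
  rw [cmp_spec g (k • x)] at c2
  rw [← map_mul, ← cmp_mul] at c3
  simp only [v, mul_smul]
  linear_combination (norm := module) c1 - c2 + c3

/-- Every quadruple has obstruction `B a b - 2 (f a b - f b a)` with `a + b = 1`, which is zero by
`hK`, so the groupoid cocycle descends. At the point at infinity it is the original cocycle up to
the coboundary of `w`. -/
theorem exists_cocycle_extending (t : Rˣ) (ht : IsUnit (t - 1 : R)) (hB : AntisymPairing B)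
    (H : EquivariantCocycle f h)
    (hK : ∀ a b : Rˣ, (b : R) = 1 - a → B a b = (2 : ℤ) • (f a b - f b a)) :
    ∃ (F : GL2 R → GL2 R → D) (_ : IsCocycle F) (w : Borel R → D), ∀ b c,
      F (borelHom R b) (borelHom R c) = borelCocycle B f h b c + coboundary w b c := by
  obtain ⟨v, u, hd, hu⟩ := exists_descentDatum_borelCocycle hB H
  obtain ⟨F, v', hF⟩ := hd.exists_descent (fun g x y => cl_smul_ne g x y)
    (exists_cl_ne t.isUnit ht) (infPt R) (fun x y z w hxy hxz hxw hyz hyw hzw => by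
      rw [hu x y z w hxy hxz hxw hyz hyw hzw _ _ rfl rfl, hK _ _ (eq_sub_iff_add_eq'.2
        (crossRatio_add x y z w hxy hxz hxw hyz hyw hzw)), sub_self])
  refine ⟨F, fun g k l => ?_, fun b => -v' (borelHom R b) (infPt R), fun b c => ?_⟩
  · have c := isCocycle_borelCocycle hB H (cmp g (k • l • infPt R)) (cmp k (l • infPt R))
      (cmp l (infPt R))
    rw [← cmp_mul, ← cmp_mul] at c
    have c1 := hF g k (l • infPt R)
    have c2 := hF (g * k) l (infPt R)
    have c3 := hF k l (infPt R)
    have c4 := hF g (k * l) (infPt R)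
    rw [mul_smul] at c4
    rw [mul_assoc] at c2
    linear_combination (norm := module) c - c1 - c2 + c3 + c4
  · have := hF (borelHom R b) (borelHom R c) (infPt R)
    rw [smul_infPt, cmp_borelHom, cmp_borelHom] at this
    simp only [coboundary, map_mul]
    linear_combination (norm := module) -this

end BorelCocycle

/-! ### Relations and generators for the second homology of `GL₂`. -/

section SecondHomology

variable {R : Type u} [CommRing R] [IsLocalRing R] {D : Type u} [AddCommGroup D]

local notation "detHom" => (Matrix.GeneralLinearGroup.det : GL2 R →* Rˣ)

theorem det_dOne (a : Rˣ) : detHom (dOne R a) = a := by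
  rw [dOne, MonoidHom.comp_apply, det_torusHom]
  simp

theorem det_dTwo (a : Rˣ) : detHom (dTwo R a) = a := by
  rw [dTwo, MonoidHom.comp_apply, det_torusHom]
  simp

theorem det_unip (x : Multiplicative R) : detHom (unip R x) = 1 := by
  rw [unip, MonoidHom.comp_apply, det_borelHom]
  simp

theorem ev_dTwo {F : GL2 R → GL2 R → D} (hF : IsCocycle F) (x : H2Z Rˣ) :
    ev _ (hF.comap (dTwo R)) x = ev _ (hF.comap (dOne R)) x := by
  obtain ⟨s, hs⟩ := exists_swap (R := R)
  rw [← ev_map F hF, ← ev_map F hF, H2Z.map_eq_of_conj (dOne R) (dTwo R) s fun x => hs (x, 1)]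

theorem ev_torusClass {F : GL2 R → GL2 R → D} (hF : IsCocycle F) (a b : Rˣ) :
    ev F hF (torusClass R a b) = F (dOne R a) (dTwo R b) - F (dTwo R b) (dOne R a) -
      (F (dOne R a) (dOne R b) - F (dOne R b) (dOne R a)) := by
  rw [torusClass, map_sub, ev_cClass, ev_cClass]

/-- The restriction of a cocycle on `GL₂` to the upper triangular matrices is determined, up to
coboundaries, by its values on the classes of the torus and of the unipotent radical. -/
theorem exists_comp_borelHom_eq (hD : Module.Baer ℤ D) (t : Rˣ) (ht : IsUnit (t - 1 : R))
    {F : GL2 R → GL2 R → D} (hF : IsCocycle F) {B : Rˣ → Rˣ → D} {f : R → R → D} {h : Rˣ → R → D}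
    (hB : AntisymPairing B) (H : EquivariantCocycle f h)
    (hf : IsCocycle fun x y : Multiplicative R => f x.toAdd y.toAdd)
    (hFB : ∀ a b, ev F hF (torusClass R a b) = B a b)
    (hFf : ∀ x, ev F hF (H2Z.map (unip R) x) = ev _ hf x) :
    ∃ w : Borel R → D, ∀ b c, F (borelHom R b) (borelHom R c) = borelCocycle B f h b c +
      F (dOne R (detHom (borelHom R b))) (dOne R (detHom (borelHom R c))) + coboundary w b c := by
  have hc := isCocycle_borelCocycle hB H
  have hd : IsCocycle fun b c => F (dOne R (detHom (borelHom R b)))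
      (dOne R (detHom (borelHom R c))) := (hF.comap ((dOne R).comp detHom)).comap (borelHom R)
  have hs := ((hF.comap (borelHom R)).sub hc).sub hd
  have hB1 : ∀ a, B a 1 = 0 := fun a => by simpa using hB.mul_right a 1 1
  have hB1' : ∀ a, B 1 a = 0 := fun a => by rw [hB.swap, hB1, neg_zero]
  suffices ∃ w, (fun b c => F (borelHom R b) (borelHom R c) - borelCocycle B f h b c -
      F (dOne R (detHom (borelHom R b))) (dOne R (detHom (borelHom R c)))) = coboundary w by
    obtain ⟨w, hw⟩ := this
    refine ⟨w, fun b c => ?_⟩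
    have := congrFun (congrFun hw b) c
    linear_combination (norm := module) this
  -- The determinant term accounts for the class along `diag(a, 1)`, and also along `diag(1, a)`,
  -- which is conjugate to it; `B` accounts for the commutator of the two factors.
  refine exists_eq_coboundary_of_borel hD t ht _ hs ?_ ?_ ?_ ?_
  · intro x
    rw [ev_sub _ _ (((hF.comap (borelHom R)).sub hc).comap _) (hd.comap _),
      ev_sub _ _ ((hF.comap (borelHom R)).comap _) (hc.comap _)]
    have e1 := (ev_map F hF (unip R) x).symm.trans (hFf x)
    have e2 : ev _ (hc.comap (SemidirectProduct.inl : Multiplicative R →* Borel R)) x =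
        ev _ hf x := by
      refine ev_congr _ _ (fun _ => 0) (fun x y => ?_) x
      rw [borelCocycle_inl hB H]
      simp [coboundary]
    have e3 : ev _ (hd.comap (SemidirectProduct.inl : Multiplicative R →* Borel R)) x = 0 := by
      refine ev_eq_zero_of_eq_coboundary _ (fun _ => F 1 1) ?_ x
      ext x y
      have hx : ∀ x, detHom (borelHom R (SemidirectProduct.inl x)) = 1 := det_unip
      simp only [coboundary]
      rw [hx, hx, map_one]
      abel
    rw [e2, e3, sub_zero, sub_eq_zero]
    exact e1
  · intro x
    refine ev_eq_zero_of_eq_coboundary _ (fun _ => 0) ?_ x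
    ext a b
    simp only [MonoidHom.comp_apply, borelCocycle_inr H, MonoidHom.inl_apply, hB1]
    have hx : ∀ x, detHom (borelHom R (SemidirectProduct.inr (x, 1))) = x := det_dOne
    rw [hx, hx]
    simp [coboundary, dOne, torusHom]
  · intro x
    rw [ev_sub _ _ (((hF.comap (borelHom R)).sub hc).comap _) (hd.comap _),
      ev_sub _ _ ((hF.comap (borelHom R)).comap _) (hc.comap _)]
    have e2 : ev _ (hc.comap
        ((SemidirectProduct.inr : Rˣ × Rˣ →* Borel R).comp (MonoidHom.inr Rˣ Rˣ))) x = 0 := by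
      refine ev_eq_zero_of_eq_coboundary _ (fun _ => 0) ?_ x
      ext a b
      simp only [MonoidHom.comp_apply, borelCocycle_inr H, MonoidHom.inr_apply, hB1']
      simp [coboundary]
    have e3 : ev _ (hd.comap ((SemidirectProduct.inr : Rˣ × Rˣ →* Borel R).comp
        (MonoidHom.inr Rˣ Rˣ))) x = ev _ (hF.comap (dOne R)) x := by
      refine ev_congr _ _ (fun _ => 0) (fun a b => ?_) x
      have hx : ∀ x, detHom (borelHom R (SemidirectProduct.inr (1, x))) = x := det_dTwo
      simp only [MonoidHom.comp_apply, MonoidHom.inr_apply, coboundary]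
      rw [hx, hx]
      abel
    rw [e2, e3, sub_zero, sub_eq_zero]
    exact ev_dTwo hF x
  · intro a b
    have e1 := hFB a b
    rw [ev_torusClass] at e1
    have hx : ∀ x, detHom (borelHom R (SemidirectProduct.inr (x, 1))) = x := det_dOne
    have hy : ∀ x, detHom (borelHom R (SemidirectProduct.inr (1, x))) = x := det_dTwo
    simp only [borelCocycle_inr H, hx, hy, hB1]
    simp only [dOne, dTwo, torusHom, MonoidHom.comp_apply, MonoidHom.inl_apply,
      MonoidHom.inr_apply] at e1 ⊢
    linear_combination (norm := module) e1

/-- A cocycle on `GL₂`, minus its determinant part, restricts to a Borel cocycle that descends by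
construction. Its obstruction therefore vanishes, and a quadruple of cross-ratio `a` gives the
relation. -/
theorem torusClass_relation (hD : Module.Baer ℤ D) (t : Rˣ) (ht : IsUnit (t - 1 : R))
    {F : GL2 R → GL2 R → D} (hF : IsCocycle F) (a b : Rˣ) (hab : (b : R) = 1 - a) :
    ev F hF (torusClass R a b) = (2 : ℤ) • ev F hF (H2Z.map (unip R)
      (cClass (.ofAdd (a : R)) (.ofAdd (b : R)) (Commute.all _ _))) := by
  have hB : AntisymPairing fun a b => ev F hF (torusClass R a b) :=
    ⟨fun a b c => by rw [antisymPairing_torusClass.mul_left, map_add],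
      fun a b => by rw [antisymPairing_torusClass.swap, map_neg]⟩
  obtain ⟨f, h, H, hf, hψ⟩ := exists_equivariantCocycle hD t ht
    ((ev F hF).comp (H2Z.map (unip R)).toAddMonoidHom)
    (fun q x => congrArg (ev F hF) (map_unip_act q x))
  obtain ⟨w, hw⟩ := exists_comp_borelHom_eq hD t ht hF hB H hf (fun _ _ => rfl)
    (fun x => (DFunLike.congr_fun hψ x).symm)
  have hF' := hF.sub (hF.comap ((dOne R).comp detHom))
  obtain ⟨v, u, hd, hu⟩ := exists_descentDatum_borelCocycle hB H
  obtain ⟨x, y, z, p, hxy, hxz, hxp, hyz, hyp, hzp, ha, hb⟩ := exists_crossRatio a b hab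
  have := hd.boundary_eq_zero (pairsDescend D) transitiveOnTriples
    (fun g k => F g k - F (dOne R (detHom g)) (dOne R (detHom k)))
    (fun g x => - (F g (frame x) - F (dOne R (detHom g)) (dOne R (detHom (frame x))) -
      (F (frame (g • x)) (borelHom R (cmp g x)) - F (dOne R (detHom (frame (g • x))))
        (dOne R (detHom (borelHom R (cmp g x)))))) - w (cmp g x)) (fun g k x => by
      have c1 := eq_comp_cmp_add hF' g k x
      have c2 := hw (cmp g (k • x)) (cmp k x)
      simp only [coboundary, ← cmp_mul] at c2
      dsimp only [MonoidHom.comp_apply] at c1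
      linear_combination (norm := module) -c1 - c2) x y z p hxy hxz hxp hyz hyp hzp
  rw [hu x y z p hxy hxz hxp hyz hyp hzp a b ha hb, sub_eq_zero] at this
  have c := DFunLike.congr_fun hψ (cClass (.ofAdd (a : R)) (.ofAdd (b : R)) (Commute.all _ _))
  rw [ev_cClass] at c
  exact this.trans (congrArg _ c)

/-- The hypotheses make the restriction to upper triangular matrices a coboundary, hence trivialize
`F` over the points of the projective line, and `exists_eq_coboundary_of_points` applies. -/
theorem ev_eq_zero_of_generators (hD : Module.Baer ℤ D) (t : Rˣ) (ht : IsUnit (t - 1 : R))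
    {F : GL2 R → GL2 R → D} (hF : IsCocycle F) (h₁ : ∀ x, ev F hF (H2Z.map (dOne R) x) = 0)
    (h₂ : ∀ a b, ev F hF (torusClass R a b) = 0)
    (h₃ : ∀ x, ev F hF (H2Z.map (unip R) x) = 0) (x : H2Z (GL2 R)) : ev F hF x = 0 := by
  obtain ⟨w, hw⟩ := exists_comp_borelHom_eq hD t ht hF (B := fun _ _ => 0) (f := fun _ _ => 0)
    (h := fun _ _ => 0) ⟨by simp, by simp⟩ ⟨by simp, by simp, by simp, by simp⟩
    (fun _ _ _ => rfl) h₂ (fun x => by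
      rw [h₃]
      exact (ev_eq_zero_of_eq_coboundary _ (fun _ => 0) (by ext; simp [coboundary]) x).symm)
  obtain ⟨w₁, hw₁⟩ := exists_eq_coboundary hD _ (hF.comap (dOne R)) (fun x => by
    rw [← ev_map F hF, h₁])
  obtain ⟨w₂, rfl⟩ := exists_eq_coboundary_of_points (pairsDescend D) transitiveOnTriples
    (fun a b => by
      obtain ⟨x, hx⟩ := exists_cl_ne t.isUnit ht a b b
      exact ⟨x, hx.1, hx.2.1⟩) (fun g x y => cl_smul_ne g x y) (infPt R) F
    (fun g x => F g (frame x) - F (frame (g • x)) (borelHom R (cmp g x)) + w (cmp g x) +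
      w₁ (detHom (borelHom R (cmp g x)))) (fun g k x => by
      have c1 := eq_comp_cmp_add hF g k x
      have c2 := hw (cmp g (k • x)) (cmp k x)
      have c3 := congrFun (congrFun hw₁ (detHom (borelHom R (cmp g (k • x)))))
        (detHom (borelHom R (cmp k x)))
      simp only [coboundary, ← map_mul, ← cmp_mul, borelCocycle] at c2 c3
      linear_combination (norm := module) c1 + c2 + c3)
  exact ev_coboundary _ _ x

end SecondHomology

/-! ### The kernel of the determinant and the theorem for `GL₂`. -/

section GeneralLinear

variable {R : Type u} [CommRing R] [IsLocalRing R]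

local notation "detHom" => (Matrix.GeneralLinearGroup.det : GL2 R →* Rˣ)

theorem map_map {G H K : Type u} [Group G] [Group H] [Group K] (φ : G →* H) (ψ : H →* K)
    (x : H2Z G) : H2Z.map ψ (H2Z.map φ x) = H2Z.map (ψ.comp φ) x := by
  rw [H2Z.map_comp, LinearMap.comp_apply]

theorem map_det_map_dOne (x : H2Z Rˣ) : H2Z.map detHom (H2Z.map (dOne R) x) = x := by
  rw [map_map, show MonoidHom.comp detHom (dOne R) = MonoidHom.id _ from MonoidHom.ext det_dOne, H2Z.map_id,
    LinearMap.id_apply]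

theorem map_one_eq_zero {G H : Type u} [Group G] [Group H] (x : H2Z G) :
    H2Z.map (1 : G →* H) x = 0 := by
  refine H2Z_ext fun D _ f hf => ?_
  rw [ev_map, ev_one, map_zero]

theorem map_det_map_unip (x : H2Z (Multiplicative R)) :
    H2Z.map detHom (H2Z.map (unip R) x) = 0 := by
  rw [map_map, show MonoidHom.comp detHom (unip R) = 1 from MonoidHom.ext det_unip, map_one_eq_zero]

/-- Both terms of `torusClass` map to `c(a, b)`; this is why the second one is subtracted. -/
theorem map_det_torusClass (a b : Rˣ) : H2Z.map detHom (torusClass R a b) = 0 := by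
  rw [torusClass, map_sub, map_cClass _ _ _ _ (Commute.all _ _),
    map_cClass _ _ _ _ (Commute.all _ _), sub_eq_zero]
  exact cClass_congr rfl ((det_dTwo b).trans (det_dOne b).symm) _ _

theorem ev_eq_ev_of_generators {D : Type u} [AddCommGroup D] (hD : Module.Baer ℤ D) (t : Rˣ)
    (ht : IsUnit (t - 1 : R)) {F : GL2 R → GL2 R → D} (hF : IsCocycle F)
    (h₂ : ∀ a b, ev F hF (torusClass R a b) = 0) (h₃ : ∀ x, ev F hF (H2Z.map (unip R) x) = 0)
    (x : H2Z (GL2 R)) : ev F hF x = ev F hF (H2Z.map (dOne R) (H2Z.map detHom x)) := by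
  have hF' := (hF.comap (dOne R)).comap detHom
  have e : ∀ x, ev _ (hF.sub hF') x =
      ev F hF x - ev F hF (H2Z.map (dOne R) (H2Z.map detHom x)) := fun x => by
    rw [ev_sub _ _ hF hF', ev_map F hF, ev_map _ (hF.comap (dOne R))]
  rw [← sub_eq_zero, ← e]
  refine ev_eq_zero_of_generators hD t ht (hF.sub hF') (fun x => ?_) (fun a b => ?_) (fun x => ?_) x
  · rw [e, map_det_map_dOne, sub_self]
  · rw [e, map_det_torusClass, map_zero, map_zero, h₂, sub_zero]
  · rw [e, map_det_map_unip, map_zero, map_zero, h₃, sub_zero]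

/-- The cocycle is built from the pairing `χ (a ⊗ b, 0)` and from minus the restriction of `χ` to
the second factor. The sign turns `χ = 0` on `K` into the vanishing of the obstruction. -/
theorem exists_cocycle_of_character {D : Type u} [AddCommGroup D] (hD : Module.Baer ℤ D) (t : Rˣ)
    (ht : IsUnit (t - 1 : R)) (χ : TensorSigma R × H2AddCoinv R →+ D)
    (hχ : ∀ k ∈ subgroupK R, χ k = 0) :
    ∃ (F : GL2 R → GL2 R → D) (hF : IsCocycle F),
      (∀ a b, ev F hF (torusClass R a b) = χ (tensorSigma R a b, 0)) ∧
      ∀ x, ev F hF (H2Z.map (unip R) x) = - χ (0, Representation.Coinvariants.mk _ x) := by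
  have hB := antisymPairing_tensorSigma (χ.comp (AddMonoidHom.inl _ _))
  obtain ⟨f, h, H, hf, hψ⟩ := exists_equivariantCocycle hD t ht
    (-((χ.comp (AddMonoidHom.inr _ _)).comp
      (Representation.Coinvariants.mk (H2Z.rep (unitsActAdd R))).toAddMonoidHom)) (fun q x => by
      have := Representation.Coinvariants.mk_self_apply (H2Z.rep (unitsActAdd R)) q x
      exact congrArg (fun y => - χ (0, y)) this)
  have hψ' : ∀ x, ev _ hf x = - χ (0, Representation.Coinvariants.mk _ x) :=
    fun x => DFunLike.congr_fun hψ x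
  obtain ⟨F, hF, w, hw⟩ := exists_cocycle_extending t ht hB H (fun a b hab => by
    have e := hψ' (cClass (.ofAdd (a : R)) (.ofAdd (b : R)) (Commute.all _ _))
    rw [ev_cClass] at e
    have e1 := hχ _ (AddSubgroup.subset_closure ⟨a, b, hab, rfl⟩)
    have e2 : (tensorSigma R a b, 2 • cAdd R (a : R) (b : R)) =
      ((tensorSigma R a b, 0) + 2 • (0, cAdd R (a : R) (b : R)) :
        TensorSigma R × H2AddCoinv R) := by
      ext <;> simp
    rw [e2, map_add, map_nsmul] at e1
    change f a b - f b a = - χ (0, cAdd R (a : R) (b : R)) at e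
    rw [e]
    change χ (tensorSigma R a b, 0) = _
    linear_combination (norm := module) e1)
  have hB1 : ∀ a, χ (tensorSigma R a 1, 0) = 0 := fun a => by
    simpa using hB.mul_right a 1 1
  refine ⟨F, hF, fun a b => ?_, fun x => ?_⟩
  · have hs : ∀ s t : Rˣ × Rˣ, F (torusHom R s) (torusHom R t) =
        χ (tensorSigma R s.1 t.2, 0) + (w (SemidirectProduct.inr s) + w (SemidirectProduct.inr t) -
          w (SemidirectProduct.inr (s * t))) := fun s t => by
      have := hw (SemidirectProduct.inr s) (SemidirectProduct.inr t)
      rw [borelCocycle_inr H, coboundary, ← map_mul] at this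
      exact this
    have c1 := hs (a, 1) (1, b)
    have c2 := hs (1, b) (a, 1)
    have c3 := hs (a, 1) (b, 1)
    have c4 := hs (b, 1) (a, 1)
    rw [mul_comm (1, b)] at c2
    rw [mul_comm (b, 1)] at c4
    rw [ev_torusClass]
    simp only [hB1] at c2 c3 c4
    simp only [dOne, dTwo, MonoidHom.comp_apply, MonoidHom.inl_apply, MonoidHom.inr_apply]
    linear_combination (norm := module) c1 - c2 - c3 + c4
  · rw [← hψ', ev_map F hF]
    refine ev_congr _ _ (fun x => w (SemidirectProduct.inl x)) (fun x y => ?_) x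
    have := hw (SemidirectProduct.inl x) (SemidirectProduct.inl y)
    rw [borelCocycle_inl hB H, coboundary, ← map_mul] at this
    exact this

/-- The quotient of `(R^× ⊗ R^×)_σ ⊕ H₂(R)_{R^×}` by `K` is the kernel of the determinant on
`H₂(GL₂(R))`. -/
theorem exists_quotK_hom (t : Rˣ) (ht : IsUnit (t - 1 : R)) :
    ∃ Ψ : QuotK R →+ H2Z (GL2 R), Function.Injective Ψ ∧
      ∀ x, (∃ y, Ψ y = x) ↔ H2Z.map detHom x = 0 := by
  have hτ : AntisymPairing (torusClass R) := antisymPairing_torusClass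
  obtain ⟨ν, hν⟩ := exists_coinvariants_lift (unitsActAdd R) (H2Z.map (unip R)).toAddMonoidHom
    map_unip_act
  have hν' : ∀ x, ν (Representation.Coinvariants.mk _ x) = H2Z.map (unip R) x := hν
  -- With `-ν`, the relation of `torusClass_relation` says that `Θ` kills the generators of `K`.
  let Θ : TensorSigma R × H2AddCoinv R →+ H2Z (GL2 R) := hτ.lift.coprod (-ν)
  have hΘ : ∀ a x, Θ (a, x) = hτ.lift a - ν x := fun a x => (sub_eq_add_neg _ _).symm
  have hΘ₁ : ∀ a b, Θ (tensorSigma R a b, 0) = torusClass R a b := fun a b => by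
    rw [hΘ, map_zero, sub_zero, hτ.lift_tensorSigma]
  have hΘ₂ : ∀ x, Θ (0, Representation.Coinvariants.mk _ x) = - H2Z.map (unip R) x := fun x => by
    rw [hΘ, map_zero, zero_sub, hν']
  have hext : ∀ {A : Type u} [AddCommGroup A] (k k' : TensorSigma R × H2AddCoinv R →+ A),
      (∀ a b, k (tensorSigma R a b, 0) = k' (tensorSigma R a b, 0)) →
      (∀ x, k (0, Representation.Coinvariants.mk _ x) =
        k' (0, Representation.Coinvariants.mk _ x)) → k = k' := by
    intro A _ k k' h h'
    have h1 : k.comp (AddMonoidHom.inl _ _) = k'.comp (AddMonoidHom.inl _ _) :=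
      tensorSigma_hom_ext h
    refine DFunLike.ext _ _ fun ⟨a, x⟩ => ?_
    obtain ⟨x, rfl⟩ := Representation.Coinvariants.mk_surjective _ x
    rw [← Prod.fst_add_snd (a, _), map_add, map_add]
    exact congrArg₂ (· + ·) (DFunLike.congr_fun h1 a) (h' x)
  have hK : subgroupK R ≤ Θ.ker := by
    rw [subgroupK, AddSubgroup.closure_le]
    rintro _ ⟨a, b, hab, rfl⟩
    obtain ⟨D, _, hD, ι, hι⟩ := exists_injective_hull (H2Z (GL2 R))
    obtain ⟨F, hF, hFι⟩ := exists_cocycle_ev_eq hD ι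
    have := torusClass_relation hD t ht hF a b hab
    rw [hFι, ← map_zsmul] at this
    have := hι this
    change Θ _ = 0
    rw [hΘ, hτ.lift_tensorSigma, this, map_nsmul, cAdd, hν', sub_eq_zero]
    exact ofNat_zsmul _ 2
  refine ⟨QuotientAddGroup.lift _ Θ hK, (injective_iff_map_eq_zero _).2 fun y hy => ?_,
    fun x => ⟨?_, fun hx => ?_⟩⟩
  · obtain ⟨k, rfl⟩ := QuotientAddGroup.mk_surjective y
    change Θ k = 0 at hy
    -- An embedding of `QuotK R` in an injective group extends along `Θ` to a character of
    -- `H₂(GL₂(R))`, so `Θ` loses nothing beyond `K`.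
    obtain ⟨D, _, hD, ι, hι⟩ := exists_injective_hull (QuotK R)
    obtain ⟨F, hF, h₁, h₂⟩ := exists_cocycle_of_character hD t ht
      (ι.comp (QuotientAddGroup.mk' (subgroupK R))) (fun k hk => by
        rw [AddMonoidHom.comp_apply, QuotientAddGroup.mk'_apply,
          (QuotientAddGroup.eq_zero_iff k).2 hk, map_zero])
    have := hext ((ev F hF).comp Θ) (ι.comp (QuotientAddGroup.mk' (subgroupK R)))
      (fun a b => by rw [← h₁, AddMonoidHom.comp_apply, hΘ₁])
      (fun x => by rw [AddMonoidHom.comp_apply, hΘ₂, map_neg, h₂, neg_neg])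
    have e := DFunLike.congr_fun this k
    rw [AddMonoidHom.comp_apply, hy, map_zero] at e
    exact hι (e.symm.trans (map_zero ι).symm)
  · rintro ⟨y, rfl⟩
    obtain ⟨k, rfl⟩ := QuotientAddGroup.mk_surjective y
    exact DFunLike.congr_fun (hext ((H2Z.map detHom).toAddMonoidHom.comp Θ) 0
      (fun a b => (congrArg (H2Z.map detHom) (hΘ₁ a b)).trans (map_det_torusClass a b))
      (fun x => (congrArg (H2Z.map detHom) (hΘ₂ x)).trans (by
        rw [map_neg, map_det_map_unip, neg_zero]; rfl))) k
  -- A character of the cokernel of `Θ` kills the generators, so it factors through `det` and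
  -- vanishes on `x`.
  · obtain ⟨D, _, hD, ι, hι⟩ := exists_injective_hull (H2Z (GL2 R) ⧸ Θ.range)
    obtain ⟨F, hF, hFι⟩ := exists_cocycle_ev_eq hD (ι.comp (QuotientAddGroup.mk' Θ.range))
    have h0 : ∀ k, ev F hF (Θ k) = 0 := fun k => by
      rw [hFι, AddMonoidHom.comp_apply, QuotientAddGroup.mk'_apply,
        (QuotientAddGroup.eq_zero_iff (Θ k)).2 (AddMonoidHom.mem_range.2 ⟨k, rfl⟩), map_zero]
    have e := ev_eq_ev_of_generators hD t ht hF (fun a b => by rw [← hΘ₁, h0])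
      (fun x => by rw [← neg_eq_zero, ← map_neg, ← hΘ₂, h0]) x
    rw [hx, map_zero, map_zero, hFι] at e
    obtain ⟨k, hk⟩ := (QuotientAddGroup.eq_zero_iff x).1 (hι (e.trans (map_zero ι).symm))
    exact ⟨QuotientAddGroup.mk k, hk⟩

/-- The isomorphism on `H₂` induced by an isomorphism of groups. -/
def mapEquiv {G H : Type u} [Group G] [Group H] (e : G ≃* H) : H2Z G ≃+ H2Z H where
  toFun := H2Z.map e.toMonoidHom
  invFun := H2Z.map e.symm.toMonoidHom
  left_inv x := by
    rw [map_map, show e.symm.toMonoidHom.comp e.toMonoidHom = MonoidHom.id G by ext; simp,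
      H2Z.map_id, LinearMap.id_apply]
  right_inv x := by
    rw [map_map, show e.toMonoidHom.comp e.symm.toMonoidHom = MonoidHom.id H by ext; simp,
      H2Z.map_id, LinearMap.id_apply]
  map_add' x y := map_add _ x y

variable (R) in
/-- `GL₁(R)` is the group of units of `R`. -/
def gl1Equiv : Matrix.GeneralLinearGroup (Fin 1) R ≃* Rˣ :=
  MulEquiv.ofBijective Matrix.GeneralLinearGroup.det ⟨fun a b h => by
    ext i j
    have := congrArg Units.val h
    rw [Matrix.GeneralLinearGroup.val_det_apply, Matrix.GeneralLinearGroup.val_det_apply,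
      Matrix.det_fin_one, Matrix.det_fin_one] at this
    rwa [Subsingleton.elim i 0, Subsingleton.elim j 0],
    fun a => ⟨Matrix.GeneralLinearGroup.mk'' !![(a : R)] (by simp), by
      ext
      rw [Matrix.GeneralLinearGroup.val_det_apply, Matrix.det_fin_one]
      rfl⟩⟩

theorem nonempty_H2_GL2_equiv (t : Rˣ) (ht : IsUnit (t - 1 : R)) :
    Nonempty (H2Z (GL2 R) ≃+ H2Z (Matrix.GeneralLinearGroup (Fin 1) R) × QuotK R) := by
  obtain ⟨Ψ, hΨ, hr⟩ := exists_quotK_hom t ht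
  have hd : ∀ y, H2Z.map detHom (Ψ y) = 0 := fun y => (hr _).1 ⟨y, rfl⟩
  refine ⟨((AddEquiv.ofBijective ((H2Z.map (dOne R)).toAddMonoidHom.coprod Ψ) ⟨?_, ?_⟩).symm).trans
    (AddEquiv.prodCongr (mapEquiv (gl1Equiv R)).symm (AddEquiv.refl _))⟩
  · refine (injective_iff_map_eq_zero _).2 fun ⟨x, y⟩ h => ?_
    change H2Z.map (dOne R) x + Ψ y = 0 at h
    have h1 := congrArg (H2Z.map detHom) h
    rw [map_add, map_det_map_dOne, hd, add_zero, map_zero] at h1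
    rw [h1, map_zero, zero_add] at h
    rw [h1, hΨ (h.trans (map_zero Ψ).symm)]
    rfl
  · intro x
    obtain ⟨y, hy⟩ := (hr (x - H2Z.map (dOne R) (H2Z.map detHom x))).2 (by
      rw [map_sub, map_det_map_dOne, sub_self])
    exact ⟨(H2Z.map detHom x, y), (congrArg _ hy).trans (add_sub_cancel _ _)⟩

end GeneralLinear

/-! ### Perfectness of `SL₂`, its coinvariants and the second isomorphism. -/

section SpecialLinear

variable {R : Type u} [CommRing R]

local notation "SL2" => Matrix.SpecialLinearGroup (Fin 2) R

/-- The matrix with given entries and determinant one. -/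
def mkSL (a b c d : R) (h : a * d - b * c = 1) : SL2 :=
  ⟨!![a, b; c, d], by rwa [Matrix.det_fin_two_of]⟩

theorem SL2_ext {g h : SL2} (h00 : g.1 0 0 = h.1 0 0) (h01 : g.1 0 1 = h.1 0 1)
    (h10 : g.1 1 0 = h.1 1 0) (h11 : g.1 1 1 = h.1 1 1) : g = h := by
  ext i j
  fin_cases i <;> fin_cases j <;> assumption

theorem mkSL_mul (a b c d a' b' c' d' : R) (h : a * d - b * c = 1) (h' : a' * d' - b' * c' = 1) :
    mkSL a b c d h * mkSL a' b' c' d' h' = mkSL (a * a' + b * c') (a * b' + b * d')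
      (c * a' + d * c') (c * b' + d * d')
      (by linear_combination (a' * d' - b' * c') * h + h') := by
  apply Subtype.ext
  exact Matrix.mul_fin_two _ _ _ _ _ _ _ _

theorem exists_mkSL (g : SL2) : ∃ a b c d h, g = mkSL a b c d h := by
  have h := g.2
  rw [Matrix.det_fin_two] at h
  exact ⟨_, _, _, _, h, SL2_ext rfl rfl rfl rfl⟩

/-- `SL₂(R)` has no homomorphism to an abelian group when `t ^ 2 - 1` is invertible. -/
theorem IsMulAddHom.eq_zero_of_SL2 [IsLocalRing R] {D : Type*} [AddCommGroup D] (t : Rˣ)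
    (ht : IsUnit (t ^ 2 - 1 : R)) {k : SL2 → D} (hk : IsMulAddHom k) (g : SL2) : k g = 0 := by
  have hU : ∀ r : R, k (mkSL 1 r 0 1 (by ring)) = 0 := by
    intro r
    obtain ⟨s, hs⟩ := ht
    -- Conjugation by `diag(t, t⁻¹)` multiplies the upper right entry by `t ^ 2`, so `r` is the
    -- entry of a commutator, with `s = t ^ 2 - 1`.
    have e : mkSL (t : R) 0 0 (t⁻¹ : Rˣ) (by simp) * mkSL 1 (s⁻¹ * r : R) 0 1 (by ring) =
        mkSL 1 r 0 1 (by ring) * mkSL 1 (s⁻¹ * r : R) 0 1 (by ring) *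
          mkSL (t : R) 0 0 (t⁻¹ : Rˣ) (by simp) := by
      simp only [mkSL_mul]
      congr 1 <;> simp
      have h1 : (t : R) * (t⁻¹ : Rˣ) = 1 := Units.mul_inv t
      have h2 : (s : R) * (s⁻¹ : Rˣ) = 1 := Units.mul_inv s
      rw [hs] at h2
      linear_combination (-(t : R) * (s⁻¹ : Rˣ) * r) * h1 + (t⁻¹ : Rˣ) * r * h2
    have := congrArg k e
    simp only [hk _ _] at this
    linear_combination (norm := module) -this
  have hL : ∀ r : R, k (mkSL 1 0 r 1 (by ring)) = 0 := by
    intro r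
    have e : mkSL 0 1 (-1) 0 (by ring) * mkSL 1 0 r 1 (by ring) =
        mkSL 1 (-r) 0 1 (by ring) * mkSL 0 1 (-1) 0 (by ring) := by
      simp only [mkSL_mul]
      congr 1 <;> ring
    have := congrArg k e
    simp only [hk _ _, hU] at this
    linear_combination (norm := module) this
  have hc : ∀ (a b d : R) (c : Rˣ) (h : a * d - b * c = 1), k (mkSL a b c d h) = 0 := by
    intro a b d c h
    -- With `c` a unit, the matrix is upper, lower, upper unipotent. If `c` is not a unit, then `a`
    -- and `a + c` are, and adding the first row to the second reduces to this case.
    have e : mkSL a b (c : R) d h = mkSL 1 ((a - 1) * (c⁻¹ : Rˣ)) 0 1 (by ring) *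
        mkSL 1 0 (c : R) 1 (by ring) * mkSL 1 ((d - 1) * (c⁻¹ : Rˣ)) 0 1 (by ring) := by
      have h1 : (c : R) * (c⁻¹ : Rˣ) = 1 := Units.mul_inv c
      simp only [mkSL_mul]
      congr 1
      · linear_combination (1 - a) * h1
      · linear_combination (-(c⁻¹ : Rˣ) : R) * h + (-b - (a - 1) * (c⁻¹ : Rˣ) * (d - 1)) * h1
      · ring
      · linear_combination (1 - d) * h1
    rw [e, hk, hk, hU, hU, hL, add_zero, add_zero]
  obtain ⟨a, b, c, d, h, rfl⟩ := exists_mkSL g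
  by_cases hu : IsUnit c
  · obtain ⟨c, rfl⟩ := hu
    exact hc a b d c h
  · have ha : IsUnit a := by
      have h1 : IsUnit (a * d + -(b * c)) := by rw [← sub_eq_add_neg, h]; exact isUnit_one
      rcases IsLocalRing.isUnit_or_isUnit_of_isUnit_add h1 with h2 | h2
      · exact isUnit_of_mul_isUnit_left h2
      · exact (hu (isUnit_of_mul_isUnit_right (IsUnit.neg_iff _ |>.1 h2))).elim
    have hac : IsUnit (a + c) := by
      have h1 : IsUnit ((a + c) + -c) := by rwa [add_neg_cancel_right]
      rcases IsLocalRing.isUnit_or_isUnit_of_isUnit_add h1 with h2 | h2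
      · exact h2
      · exact (hu (IsUnit.neg_iff _ |>.1 h2)).elim
    obtain ⟨s, hs⟩ := hac
    have e : mkSL 1 0 1 1 (by ring) * mkSL a b c d h =
        mkSL a b (s : R) (b + d) (by rw [hs]; linear_combination h) := by
      simp only [mkSL_mul]
      congr 1 <;> [ring; ring; (rw [hs]; ring); ring]
    have := congrArg k e
    rw [hk, hL, hc, zero_add] at this
    exact this

variable [IsLocalRing R]

local notation "detHom" => (Matrix.GeneralLinearGroup.det : GL2 R →* Rˣ)

theorem coe_dOne (a : Rˣ) : (dOne R a : Matrix (Fin 2) (Fin 2) R) = diagOne R a := by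
  ext i j
  fin_cases i <;> fin_cases j <;>
    simp [dOne, diagOne, torusHom_00, torusHom_01, torusHom_10, torusHom_11]

theorem toGL_unitsActSL (a : Rˣ) (A : SL2) :
    Matrix.SpecialLinearGroup.toGL (unitsActSL R a A) =
      dOne R a * Matrix.SpecialLinearGroup.toGL A * (dOne R a)⁻¹ := by
  apply Units.ext
  rw [← map_inv, Units.val_mul, Units.val_mul]
  erw [coe_dOne, coe_dOne]
  rfl

theorem det_toGL (A : SL2) : detHom (Matrix.SpecialLinearGroup.toGL A) = 1 :=
  Units.ext A.2

theorem toGL_injective :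
    Function.Injective (Matrix.SpecialLinearGroup.toGL : SL2 →* GL2 R) := fun _ _ h =>
  Subtype.ext (congrArg Units.val h)

variable (R) in
/-- The homomorphism from `SL₂(R) ⋊ R^×` to `GL₂(R)`. -/
def slHom : SL2 ⋊[unitsActSL R] Rˣ →* GL2 R :=
  SemidirectProduct.lift Matrix.SpecialLinearGroup.toGL (dOne R) (fun a =>
    MonoidHom.ext fun A => toGL_unitsActSL a A)

theorem slHom_bijective : Function.Bijective (slHom R) := by
  constructor
  · refine (injective_iff_map_eq_one _).2 fun x hx => ?_
    have hx' : Matrix.SpecialLinearGroup.toGL x.left * dOne R x.right = 1 := hx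
    have h1 := congrArg detHom hx'
    rw [map_mul, det_toGL, det_dOne, one_mul, map_one] at h1
    rw [h1, map_one, mul_one] at hx'
    exact SemidirectProduct.ext (toGL_injective (hx'.trans (map_one _).symm)) h1
  · intro g
    have hd : detHom (g * (dOne R (detHom g))⁻¹) = 1 := by
      rw [map_mul, map_inv, det_dOne, mul_inv_cancel]
    refine ⟨⟨⟨_, congrArg Units.val hd⟩, detHom g⟩, ?_⟩
    change Matrix.SpecialLinearGroup.toGL _ * dOne R _ = _
    rw [← eq_mul_inv_iff_mul_eq]
    exact Units.ext rfl

variable (R) in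
/-- `GL₂(R)` is the semidirect product of `SL₂(R)` and the units of `R`. -/
def slEquiv : SL2 ⋊[unitsActSL R] Rˣ ≃* GL2 R := MulEquiv.ofBijective (slHom R) slHom_bijective

/-- The inclusion `SL₂(R) → GL₂(R)` identifies the coinvariants of `H₂(SL₂(R))` with the kernel of
the determinant on `H₂(GL₂(R))`. -/
theorem exists_H2SLCoinv_hom (t : Rˣ) (ht : IsUnit (t ^ 2 - 1 : R)) :
    ∃ Ψ : H2SLCoinv R →+ H2Z (GL2 R), Function.Injective Ψ ∧
      ∀ x, (∃ y, Ψ y = x) ↔ H2Z.map detHom x = 0 := by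
  -- `SL₂(R)` has no nonzero homomorphism to `D`, so even the trivial central element `1` is
  -- regular.
  have hreg : ∀ (D : Type u) [AddCommGroup D], RegularOn (unitsActSL R 1) D := fun D _ =>
    ⟨fun k hk => ⟨fun _ => 0, fun _ _ => (add_zero 0).symm, fun x => by
      rw [hk.eq_zero_of_SL2 t ht, sub_zero]⟩, fun k hk _ => hk.eq_zero_of_SL2 t ht⟩
  have h1 : ∀ q : Rˣ, 1 * q = q * 1 := fun q => by rw [one_mul, mul_one]
  let i : SL2 →* GL2 R := Matrix.SpecialLinearGroup.toGL
  obtain ⟨Ψ, hΨ⟩ := exists_coinvariants_lift (unitsActSL R) (H2Z.map i).toAddMonoidHom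
    (fun q x => by
      change H2Z.map i (H2Z.map _ x) = H2Z.map i x
      rw [map_map]
      exact H2Z.map_eq_of_conj _ _ (dOne R q) (fun x => toGL_unitsActSL q x) x)
  have hΨ' : ∀ x, Ψ (Representation.Coinvariants.mk _ x) = H2Z.map i x := hΨ
  have hdi : ∀ x, H2Z.map detHom (H2Z.map i x) = 0 := fun x => by
    rw [map_map, show MonoidHom.comp detHom i = 1 from MonoidHom.ext det_toGL, map_one_eq_zero]
  refine ⟨Ψ, (injective_iff_map_eq_zero _).2 fun y hy => ?_, fun x => ⟨?_, fun hx => ?_⟩⟩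
  · obtain ⟨x, rfl⟩ := Representation.Coinvariants.mk_surjective _ y
    obtain ⟨D, _, hD, ι, hι⟩ := exists_injective_hull (H2SLCoinv R)
    -- An invariant class on `SL₂(R)` extends to the semidirect product `GL₂(R)`, so a class dying
    -- in `H₂(GL₂(R))` is already zero in the coinvariants.
    obtain ⟨f, hf, h, hψ, -, hh, hh'⟩ := exists_equivariant_cocycle hD (unitsActSL R) 1 h1 (hreg D)
      (ι.comp (Representation.Coinvariants.mk (H2Z.rep (unitsActSL R))).toAddMonoidHom)
      (fun q x => congrArg ι
        (Representation.Coinvariants.mk_self_apply (H2Z.rep (unitsActSL R)) q x))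
    have hF := (isCocycle_semidirect (unitsActSL R) f hf h hh hh').comap (slEquiv R).symm.toMonoidHom
    have hi : ∀ A, (slEquiv R).symm (i A) = SemidirectProduct.inl A := fun A => by
      rw [MulEquiv.symm_apply_eq]
      change _ = i A * dOne R 1
      rw [map_one, mul_one]
    have h0 : ∀ x, h 1 x = 0 := fun x => by simpa using hh' 1 1 x
    have e := ev_map _ hF i x
    rw [hΨ'] at hy
    rw [hy, map_zero] at e
    have e' := DFunLike.congr_fun hψ x
    have e2 : ev _ (hF.comap i) x = ev f hf x := by
      refine ev_congr _ _ (fun _ => 0) (fun A B => ?_) x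
      simp [hi, h0, coboundary]
    rw [← e2, ← e] at e'
    exact hι (e'.symm.trans (map_zero ι).symm)
  · rintro ⟨y, rfl⟩
    obtain ⟨x, rfl⟩ := Representation.Coinvariants.mk_surjective _ y
    rw [hΨ', hdi]
  · obtain ⟨D, _, hD, ι, hι⟩ := exists_injective_hull (H2Z (GL2 R) ⧸ Ψ.range)
    obtain ⟨F, hF, hFι⟩ := exists_cocycle_ev_eq hD (ι.comp (QuotientAddGroup.mk' Ψ.range))
    have h0 : ∀ y, ev F hF (Ψ y) = 0 := fun y => by
      rw [hFι, AddMonoidHom.comp_apply, QuotientAddGroup.mk'_apply,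
        (QuotientAddGroup.eq_zero_iff (Ψ y)).2 (AddMonoidHom.mem_range.2 ⟨y, rfl⟩), map_zero]
    have hF' := (hF.comap (dOne R)).comap detHom
    have e : ∀ x, ev _ (hF.sub hF') x =
        ev F hF x - ev F hF (H2Z.map (dOne R) (H2Z.map detHom x)) := fun x => by
      rw [ev_sub _ _ hF hF', ev_map F hF, ev_map _ (hF.comap (dOne R))]
    -- Without its determinant part, a cocycle killing the image of `Ψ` is trivial on both factors
    -- of the semidirect product, hence trivial.
    obtain ⟨w, hw⟩ := ev_eq_zero_of_semidirect hD (unitsActSL R) 1 h1 (hreg D) _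
      ((hF.sub hF').comap (slEquiv R).toMonoidHom) (fun x => by
        have e1 := ev_map _ ((hF.sub hF').comap (slEquiv R).toMonoidHom)
          (SemidirectProduct.inl : SL2 →* SL2 ⋊[unitsActSL R] Rˣ) x
        rw [← e1, ← ev_map _ (hF.sub hF'), map_map]
        have e2 : (slEquiv R).toMonoidHom.comp SemidirectProduct.inl = i := by
          ext1 A
          change i A * dOne R 1 = i A
          rw [map_one, mul_one]
        rw [e2, e, ← hΨ', h0, hΨ', hdi, map_zero, map_zero, sub_zero]) (fun x => by
        have e1 := ev_map _ ((hF.sub hF').comap (slEquiv R).toMonoidHom)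
          (SemidirectProduct.inr : Rˣ →* SL2 ⋊[unitsActSL R] Rˣ) x
        rw [← e1, ← ev_map _ (hF.sub hF'), map_map]
        have e2 : (slEquiv R).toMonoidHom.comp SemidirectProduct.inr = dOne R := by
          ext1 a
          change i 1 * dOne R a = dOne R a
          rw [map_one, one_mul]
        rw [e2, e, map_det_map_dOne, sub_self])
    have e3 := ev_eq_zero_of_eq_coboundary (hF.sub hF') (fun g => w ((slEquiv R).symm g)) (by
      ext g k
      have := congrFun (congrFun hw ((slEquiv R).symm g)) ((slEquiv R).symm k)
      simpa [coboundary] using this) x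
    rw [e, hx, map_zero, map_zero, sub_zero, hFι] at e3
    obtain ⟨y, hy⟩ := (QuotientAddGroup.eq_zero_iff x).1 (hι (e3.trans (map_zero ι).symm))
    exact ⟨y, hy⟩

theorem nonempty_addEquiv_of_range_eq {A B C : Type*} [AddCommGroup A] [AddCommGroup B]
    [AddCommGroup C] (f : A →+ C) (g : B →+ C) (hf : Function.Injective f)
    (hg : Function.Injective g) (h : f.range = g.range) : Nonempty (A ≃+ B) :=
  ⟨((AddMonoidHom.ofInjective hf).trans (AddEquiv.addSubgroupCongr h)).trans
    (AddMonoidHom.ofInjective hg).symm⟩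

theorem nonempty_H2SLCoinv_equiv (t : Rˣ) (ht : IsUnit (t ^ 2 - 1 : R)) :
    Nonempty (H2SLCoinv R ≃+ QuotK R) := by
  obtain ⟨Ψ, hΨ, h⟩ := exists_H2SLCoinv_hom t ht
  have ht' : IsUnit (t - 1 : R) := by
    rw [show (t ^ 2 - 1 : R) = (t - 1) * (t + 1) by ring] at ht
    exact isUnit_of_mul_isUnit_left ht
  obtain ⟨Ψ', hΨ', h'⟩ := exists_quotK_hom t ht'
  exact nonempty_addEquiv_of_range_eq Ψ Ψ' hΨ hΨ' (by
    ext x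
    rw [AddMonoidHom.mem_range, AddMonoidHom.mem_range, h, h'])

end SpecialLinear

end BlochWigner

end

theorem mainTheorem11 (R : Type u) [CommRing R] [IsLocalRing R] :
    (3 ≤ ENat.card (IsLocalRing.ResidueField R) →
      Nonempty (BlochWigner.H2Z (Matrix.GeneralLinearGroup (Fin 2) R) ≃+
        BlochWigner.H2Z (Matrix.GeneralLinearGroup (Fin 1) R) × BlochWigner.QuotK R)) ∧
    (4 ≤ ENat.card (IsLocalRing.ResidueField R) →
      Nonempty (BlochWigner.H2SLCoinv R ≃+ BlochWigner.QuotK R)) := by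
  refine ⟨fun h => ?_, fun h => ?_⟩
  · obtain ⟨t, ht⟩ := BlochWigner.exists_isUnit_sub_one h
    exact BlochWigner.nonempty_H2_GL2_equiv t ht
  · obtain ⟨t, ht⟩ := BlochWigner.exists_isUnit_sq_sub_one h
    exact BlochWigner.nonempty_H2SLCoinv_equiv t ht
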